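/- **Conventions.** Let $\mathbb K$ be a field and $H$ a Hopf algebra over $\mathbb K$ (of arbitrary dimension) with invertible antipode $S$. Sweedler notation $\Delta(x)=x_{(1)}\otimes x_{(2)}$ is used. For an algebra $A$ with multiplication $\nabla$, the restricted dual is $A^o=(\nabla^*)^{-1}(A^*\otimes A^*)\subset A^*$; if $A$ is a Hopf algebra, $A^o$ is a Hopf algebra with the structure dual to that of $A$. The quantum double $D(H)$ is the algebra generated by (the images under algebra maps $\imath,\jmath$ of) $H$ and $H^{o,\mathrm{op}}$ subject to the relations $$\jmath(f)\,\imath(x)=\langle f_{(1)},x_{(1)}\rangle\,\langle f_{(3)},S(x_{(3)})\rangle\;\imath(x_{(2)})\,\jmath(f_{(2)}),\qquad x\in H,\ f\in H^o,$$ with the Hopf algebra structure for which $\imath\colon H\to D(H)$ and $\jmath\colon H^{o,\mathrm{op}}\to D(H)$ are Hopf algebra maps. Put $$\varrho\colon D(H)^o\otimes D(H)^o\to\mathbb K,\qquad \varrho(x\otimes y)=\langle x,\jmath(\imath^o(y))\rangle ,\qquad \imath^o(y)=y\circ\imath .$$ *Rigid R-matrices.* Let $(F,G,\varepsilon\colon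 F\otimes G\to \mathbb 1,\eta\colon \mathbb 1\to G\otimes F)$ be an adjunction in a monoidal category. For $f\colon X\otimes G\to G\otimes Y$ put $\widetilde f=(\varepsilon\otimes\mathrm{id}_{Y\otimes F})(\mathrm{id}_F\otimes f\otimes\mathrm{id}_F)(\mathrm{id}_{F\otimes X}\otimes\eta)\colon F\otimes X\to Y\otimes F$. An automorphism $r$ of $G\otimes G$ is a rigid R-matrix if $(r\otimes \mathrm{id}_G)(\mathrm{id}_G\otimes r)(r\otimes \mathrm{id}_G)=(\mathrm{id}_G\otimes r)(r\otimes \mathrm{id}_G)(\mathrm{id}_G\otimes r)$ and $\widetilde{r}$, $\widetilde{r^{-1}}$ are invertible. *Long knots.* A long knot diagram is an oriented $(1,1)$-tangle diagram in the strip $\mathbb R\times[0,1]$ with exactly one component, directed upwards at both ends, in generic position with respect to the height function; a long knot is a Reidemeister equivalence class (planar isotopy and the Reidemeister moves I, II, III) of long knot diagrams. A diagram is normal if it has no local extrema oriented from left to right. The normalization $\dot D$ of $D$ is obtained by replacing each local extremum oriented from left to right by one oriented from right to left together with a crossing of its two ends (below the maximum, above the minimum); of the two ends of the extremum one is directed upwards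 and one downwards, and at a maximum the upward one passes over at the new crossing, while at a minimum the downward one passes over. Let $w$ denote the writhe. For a rigid R-matrix $r$ over $G$, $RT_r$ of a normal diagram is the composition, from bottom to top, of the morphisms assigned to horizontal slices by tensoring, from left to right, the following: a vertical strand gives $\mathrm{id}_G$ (upward) or $\mathrm{id}_F$ (downward); a maximum (minimum) oriented from right to left gives $\varepsilon$ (resp. $\eta$); at a crossing let $a$ be the strand joining the bottom left to the top right and $b$ the strand joining the bottom right to the top left. The crossing gives - $r$ if both are upward and $a$ is over, $r^{-1}$ if both are upward and $b$ is over; - $\widetilde r$ if $a$ is downward, $b$ is upward and $b$ is over, $\widetilde{r^{-1}}$ if $a$ is downward, $b$ is upward and $a$ is over; - $\widetilde{\widetilde r}$ if both are downward and $a$ is over, $\widetilde{\widetilde{r^{-1}}}$ if both are downward and $b$ is over; - $(\widetilde{r^{-1}})^{-1}$ if $a$ is upward, $b$ is downward and $b$ is over, $(\widetilde r)^{-1}$ if $a$ is upward, $b$ is downward and $a$ is over. Let $\xi^{+}$, $\xi^{-}$ be the normal long knot diagrams of writhe $+2$, $-2$ which consist, from bottom to top, of: a minimum oriented from right to left placed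 to the right of the incoming upward strand; a crossing of the two strands issuing from this minimum; a crossing of the incoming strand with the strand now adjacent to it; a maximum oriented from right to left joining the two leftmost strands. (Both crossings are positive for $\xi^+$ and negative for $\xi^-$.) For $n\ge 0$ let $\xi^{n}$ and $\xi^{-n}$ be the $n$-fold compositions of $\xi^+$ and of $\xi^-$. Then $$J_r(D)=RT_r\bigl(\dot D\circ\xi^{-w(\dot D)/2}\bigr)\in\operatorname{End}(G).$$ **Theorem.** 1. $(D(H)^o,\varrho)$ is a dual quasitriangular Hopf algebra: $\varrho$ is invertible in the convolution algebra $(D(H)^o\otimes D(H)^o)^*$ and, for all $a,b,c\in D(H)^o$, $$\varrho(ab\otimes c)=\varrho(a\otimes c_{(1)})\varrho(b\otimes c_{(2)}),\quad \varrho(a\otimes bc)=\varrho(a_{(1)}\otimes c)\varrho(a_{(2)}\otimes b),\quad \varrho(a_{(1)}\otimes b_{(1)})\,a_{(2)}b_{(2)}=b_{(1)}a_{(1)}\,\varrho(a_{(2)}\otimes b_{(2)}).$$ Moreover $\varrho_{1,2}*\varrho_{1,3}*\varrho_{2,3}=\varrho_{2,3}*\varrho_{1,3}*\varrho_{1,2}$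 in the convolution algebra $((D(H)^o)^{\otimes 3})^*$. 2. For every finite-dimensional right comodule $V\to V\otimes D(H)^o$, $v\mapsto v_{(0)}\otimes v_{(1)}$, the map $$r_V\colon V\otimes V\to V\otimes V,\qquad u\otimes v\mapsto v_{(0)}\otimes u_{(0)}\,\varrho(u_{(1)}\otimes v_{(1)})$$ is a rigid R-matrix over $V$ with respect to every adjunction $(F,V,\varepsilon,\eta)$ in the monoidal category of finite-dimensional vector spaces (for example with $F=V^*$). 3. There is a map $K\mapsto Z_H(K)$ from the set of long knots to the convolution algebra $(D(H)^o)^*$ such that, for every finite-dimensional right $D(H)^o$-comodule $V$, every adjunction $(F,V,\varepsilon,\eta)$ as in 2, every long knot $K$, every diagram $D$ of $K$ and every $v\in V$, $$J_{r_V}(D)\,v=v_{(0)}\,\langle Z_H(K),v_{(1)}\rangle .$$ -/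

import Mathlib

universe u v w

noncomputable section

open scoped TensorProduct
open Coalgebra

namespace LongKnotInvariant

section RestrictedDual

variable (K : Type u) [Field K] (A : Type v) [Ring A] [Algebra K A]

/-- The restricted (finite) dual `A^o = (∇^*)⁻¹(A^* ⊗ A^*)` of an algebra `A` with multiplication
`∇`, where `A^* ⊗ A^*` is viewed inside `(A ⊗ A)^*`. -/
def restrictedDual : Submodule K (Module.Dual K A) :=
  (LinearMap.range (TensorProduct.dualDistrib K A A)).comap (LinearMap.mul' K A).dualMap

/-- The restricted dual `A^o`, as a type. -/
def RestrictedDual : Type (max u v) := ↥(restrictedDual K A)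

instance : AddCommGroup (RestrictedDual K A) :=
  inferInstanceAs (AddCommGroup ↥(restrictedDual K A))

instance : Module K (RestrictedDual K A) :=
  inferInstanceAs (Module K ↥(restrictedDual K A))

/-- The inclusion `A^o → A^*`. -/
def RestrictedDual.toDual : RestrictedDual K A →ₗ[K] Module.Dual K A :=
  (restrictedDual K A).subtype

/-- Elements of `A^o` are functions on `A`. -/
instance : CoeFun (RestrictedDual K A) (fun _ => A → K) := ⟨fun f => RestrictedDual.toDual K A f⟩

variable {K A}

/-- A functional satisfying the finiteness condition, as an element of `A^o`. -/
def RestrictedDual.mk (f : Module.Dual K A) (hf : f ∈ restrictedDual K A) : RestrictedDual K A :=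
  ⟨f, hf⟩

@[simp] theorem RestrictedDual.toDual_mk (f : Module.Dual K A) (hf : f ∈ restrictedDual K A) :
    RestrictedDual.toDual K A (RestrictedDual.mk f hf) = f := rfl

theorem RestrictedDual.toDual_mem (f : RestrictedDual K A) :
    RestrictedDual.toDual K A f ∈ restrictedDual K A := f.2

theorem RestrictedDual.ext {f g : RestrictedDual K A} (h : ∀ x, f x = g x) : f = g :=
  Subtype.ext (LinearMap.ext h)

/-- Membership in the restricted dual in terms of finite sums. -/
theorem mem_restrictedDual_iff (f : Module.Dual K A) :
    f ∈ restrictedDual K A ↔ ∃ s : Finset (Module.Dual K A × Module.Dual K A),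
      ∀ x y, f (x * y) = ∑ p ∈ s, p.1 x * p.2 y := by
  constructor
  · rintro ⟨t, ht⟩
    obtain ⟨s, rfl⟩ := TensorProduct.exists_finset t
    refine ⟨s, fun x y => ?_⟩
    have := LinearMap.congr_fun ht (x ⊗ₜ y)
    simpa using this.symm
  · rintro ⟨s, hs⟩
    refine ⟨∑ p ∈ s, p.1 ⊗ₜ p.2, TensorProduct.ext' fun x y => ?_⟩
    simp [hs]

theorem mem_restrictedDual_of_sum {ι : Type*} (s : Finset ι) (f : Module.Dual K A)
    (g h : ι → Module.Dual K A) (H : ∀ x y, f (x * y) = ∑ i ∈ s, g i x * h i y) :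
    f ∈ restrictedDual K A := by
  refine ⟨∑ i ∈ s, g i ⊗ₜ h i, TensorProduct.ext' fun x y => ?_⟩
  simp [H]

/-- Left translates stay in the restricted dual. -/
theorem comp_mulLeft_mem (f : Module.Dual K A) (hf : f ∈ restrictedDual K A) (a : A) :
    f ∘ₗ LinearMap.mulLeft K a ∈ restrictedDual K A := by
  obtain ⟨s, hs⟩ := (mem_restrictedDual_iff f).1 hf
  refine mem_restrictedDual_of_sum s _ (fun p => p.1 ∘ₗ LinearMap.mulLeft K a) (fun p => p.2) ?_
  intro x y
  simp [← mul_assoc, hs]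

theorem comp_mulRight_mem (f : Module.Dual K A) (hf : f ∈ restrictedDual K A) (a : A) :
    f ∘ₗ LinearMap.mulRight K a ∈ restrictedDual K A := by
  obtain ⟨s, hs⟩ := (mem_restrictedDual_iff f).1 hf
  refine mem_restrictedDual_of_sum s _ (fun p => p.1) (fun p => p.2 ∘ₗ LinearMap.mulRight K a) ?_
  intro x y
  simp [mul_assoc, hs]

/-- Functionals that separate points of `M` and of `N` separate points of `M ⊗ N`. -/
theorem tensor_eq_zero_of_separating {M N X Y : Type*} [AddCommGroup M] [Module K M]
    [AddCommGroup N] [Module K N] (φ : X → Module.Dual K M) (ψ : Y → Module.Dual K N)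
    (hφ : ∀ m, (∀ x, φ x m = 0) → m = 0) (hψ : ∀ n, (∀ y, ψ y n = 0) → n = 0)
    (t : M ⊗[K] N) (ht : ∀ x y, TensorProduct.dualDistrib K M N (φ x ⊗ₜ ψ y) t = 0) : t = 0 := by
  classical
  let b := Module.Basis.ofVectorSpace K M
  apply (TensorProduct.equivFinsuppOfBasisLeft (N := N) b).injective
  rw [map_zero]
  have key : ∀ y, TensorProduct.rid K M ((ψ y).lTensor M t) = 0 := by
    intro y
    apply hφ
    intro x
    rw [← ht x y]
    clear ht
    induction t with
    | zero => simp
    | add a b ha hb => simp [ha, hb]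
    | tmul m n => simp [mul_comm]
  refine Finsupp.ext fun i => ?_
  rw [Finsupp.zero_apply]
  apply hψ
  intro y
  have h2 := congrArg (b.coord i) (key y)
  rw [map_zero] at h2
  rw [← h2]
  clear ht key h2
  induction t with
  | zero => simp
  | add a b ha hb => simp only [map_add, Finsupp.add_apply, ha, hb]
  | tmul m n => simp [mul_comm]

variable (K A)

/-- The inclusion `A^o ⊗ A^o → (A ⊗ A)^*`. -/
def tensorToDual : RestrictedDual K A ⊗[K] RestrictedDual K A →ₗ[K] Module.Dual K (A ⊗[K] A) :=
  TensorProduct.dualDistrib K A A ∘ₗ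
    TensorProduct.map (RestrictedDual.toDual K A) (RestrictedDual.toDual K A)

variable {K A}

@[simp]
theorem tensorToDual_tmul (f g : RestrictedDual K A) (x y : A) :
    tensorToDual K A (f ⊗ₜ g) (x ⊗ₜ y) = f x * g y := by
  simp [tensorToDual]

/-- Evaluation at an element, as a functional on the restricted dual. -/
def evalAt (x : A) : Module.Dual K (RestrictedDual K A) :=
  (LinearMap.applyₗ x) ∘ₗ RestrictedDual.toDual K A

@[simp] theorem evalAt_apply (x : A) (f : RestrictedDual K A) : evalAt x f = f x := rfl

theorem evalAt_separating (f : RestrictedDual K A) (h : ∀ x, evalAt x f = 0) : f = 0 :=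
  RestrictedDual.ext (by simpa using h)

theorem tensorToDual_apply (t : RestrictedDual K A ⊗[K] RestrictedDual K A) (x y : A) :
    tensorToDual K A t (x ⊗ₜ y) =
      TensorProduct.dualDistrib K _ _ (evalAt x ⊗ₜ evalAt y) t := by
  induction t with
  | zero => simp
  | add a b ha hb => simp [ha, hb]
  | tmul f g => simp

theorem tensorToDual_injective : Function.Injective (tensorToDual K A) := by
  rw [injective_iff_map_eq_zero]
  intro t ht
  refine tensor_eq_zero_of_separating (X := A) (Y := A) evalAt evalAt evalAt_separating
    evalAt_separating t fun x y => ?_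
  rw [← tensorToDual_apply, ht, LinearMap.zero_apply]

theorem tensorToDual_ext {s t : RestrictedDual K A ⊗[K] RestrictedDual K A}
    (h : ∀ x y, tensorToDual K A s (x ⊗ₜ y) = tensorToDual K A t (x ⊗ₜ y)) : s = t :=
  tensorToDual_injective (TensorProduct.ext' h)

theorem surjective_of_separating {M W : Type*} [AddCommGroup M] [Module K M] [AddCommGroup W]
    [Module K W] [FiniteDimensional K W] (ev : M →ₗ[K] Module.Dual K W)
    (h : ∀ w, (∀ m, ev m w = 0) → w = 0) : Function.Surjective ev := by
  rw [← LinearMap.range_eq_top]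
  have h0 : (LinearMap.range ev).dualCoannihilator = ⊥ := by
    rw [eq_bot_iff]
    intro w hw
    rw [Submodule.mem_dualCoannihilator] at hw
    exact h w fun m => hw _ ⟨m, rfl⟩
  rw [← Subspace.dualCoannihilator_dualAnnihilator_eq (W := LinearMap.range ev), h0,
    Submodule.dualAnnihilator_bot]

/-- For `f ∈ A^o` the functional `∇^* f` lies in `A^o ⊗ A^o`. -/
theorem dualMap_mul_mem_range (f : RestrictedDual K A) :
    (LinearMap.mul' K A).dualMap (RestrictedDual.toDual K A f) ∈ LinearMap.range (tensorToDual K A) := by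
  classical
  have hf := f.toDual_mem
  generalize RestrictedDual.toDual K A f = f at hf ⊢
  obtain ⟨s, hs⟩ := (mem_restrictedDual_iff f).1 hf
  let L : A →ₗ[K] Module.Dual K A := (LinearMap.mul K A).compr₂ f
  have hL : ∀ x y, L x y = f (x * y) := fun x y => rfl
  let ι : (A ⧸ LinearMap.ker L) →ₗ[K] Module.Dual K A := (LinearMap.ker L).liftQ L le_rfl
  have hι : ∀ x y, ι (Submodule.Quotient.mk x) y = f (x * y) := fun x y => rfl
  have hfin : FiniteDimensional K (A ⧸ LinearMap.ker L) := by
    let g : A →ₗ[K] (s → K) := LinearMap.pi fun p => p.1.1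
    have hg : LinearMap.ker g ≤ LinearMap.ker L := by
      intro x hx
      rw [LinearMap.mem_ker] at hx ⊢
      ext y
      rw [hL, hs, ← Finset.sum_coe_sort]
      exact Finset.sum_eq_zero fun p _ => by
        rw [show p.1.1 x = 0 from congrFun hx p, zero_mul]
    have h1 : FiniteDimensional K (A ⧸ LinearMap.ker g) :=
      Module.Finite.of_injective (g.quotKerEquivRange.toLinearMap) g.quotKerEquivRange.injective
    exact Module.Finite.of_surjective _ (Submodule.factor_surjective hg)
  let b := Module.finBasis K (A ⧸ LinearMap.ker L)
  -- every functional on `A ⧸ ker L` is evaluation at an element of `A`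
  have hsurj : Function.Surjective (ι.flip : A →ₗ[K] Module.Dual K (A ⧸ LinearMap.ker L)) := by
    refine surjective_of_separating _ fun w hw => ?_
    obtain ⟨x, rfl⟩ := Submodule.Quotient.mk_surjective _ w
    rw [Submodule.Quotient.mk_eq_zero, LinearMap.mem_ker]
    exact LinearMap.ext hw
  choose a ha using fun k => hsurj (b.coord k)
  have hmem : ∀ w, ι w ∈ restrictedDual K A := by
    intro w
    obtain ⟨x, rfl⟩ := Submodule.Quotient.mk_surjective _ w
    exact comp_mulLeft_mem f hf x
  have hc : ∀ k x, b.repr (Submodule.Quotient.mk x) k = f (x * a k) := by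
    intro k x
    rw [← Module.Basis.coord_apply, ← ha k]
    rfl
  refine ⟨∑ k, (RestrictedDual.mk (f ∘ₗ LinearMap.mulRight K (a k)) (comp_mulRight_mem f hf _))
    ⊗ₜ (RestrictedDual.mk (ι (b k)) (hmem _)), TensorProduct.ext' fun x y => ?_⟩
  have h1 : ι (Submodule.Quotient.mk x) = ∑ k, f (x * a k) • ι (b k) := by
    conv_lhs => rw [← b.sum_repr (Submodule.Quotient.mk x)]
    simp only [map_sum, map_smul, hc]
  have h2 := LinearMap.congr_fun h1 y
  rw [hι] at h2
  simp [h2]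

variable (K A)

/-- The comultiplication of `A^o`: the restriction of `∇^*`. -/
def restrictedComul : RestrictedDual K A →ₗ[K] RestrictedDual K A ⊗[K] RestrictedDual K A :=
  (LinearEquiv.ofInjective (tensorToDual K A) tensorToDual_injective).symm.toLinearMap ∘ₗ
    LinearMap.codRestrict _ ((LinearMap.mul' K A).dualMap ∘ₗ RestrictedDual.toDual K A)
      dualMap_mul_mem_range

variable {K A}

theorem tensorToDual_restrictedComul (f : RestrictedDual K A) (x y : A) :
    tensorToDual K A (restrictedComul K A f) (x ⊗ₜ y) = f (x * y) := by
  have h : tensorToDual K A (restrictedComul K A f) = (LinearMap.mul' K A).dualMap (RestrictedDual.toDual K A f) := by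
    have := LinearEquiv.apply_symm_apply
      (LinearEquiv.ofInjective (tensorToDual K A) tensorToDual_injective)
      (LinearMap.codRestrict _ ((LinearMap.mul' K A).dualMap ∘ₗ RestrictedDual.toDual K A)
      dualMap_mul_mem_range f)
    exact congrArg Subtype.val this
  rw [h]
  simp

instance : CoalgebraStruct K (RestrictedDual K A) where
  comul := restrictedComul K A
  counit := evalAt 1

@[simp] theorem restrictedDual_counit (f : RestrictedDual K A) :
    counit (R := K) f = f 1 := rfl

@[simp] theorem tensorToDual_comul (f : RestrictedDual K A) (x y : A) :
    tensorToDual K A (comul f) (x ⊗ₜ y) = f (x * y) := tensorToDual_restrictedComul f x y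

theorem repr_apply {ι : Type*} {f : RestrictedDual K A} (r : Coalgebra.Repr K f ι) (x y : A) :
    ∑ i ∈ r.index, r.left i x * r.right i y = f (x * y) := by
  rw [← tensorToDual_comul, ← r.eq]
  simp

/-- The restricted dual of an algebra is a coalgebra. -/
instance : Coalgebra K (RestrictedDual K A) where
  coassoc := by
    ext f
    rw [← sub_eq_zero]
    refine tensor_eq_zero_of_separating (X := A) (Y := A × A) evalAt
      (fun p => TensorProduct.dualDistrib K _ _ (evalAt p.1 ⊗ₜ evalAt p.2)) evalAt_separating
      (fun t ht => tensorToDual_ext fun x y => ?_) _ ?_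
    · rw [tensorToDual_apply, ht (x, y)]
      simp
    · rintro x ⟨y, z⟩
      rw [map_sub, sub_eq_zero]
      have h1 : ∀ t : RestrictedDual K A ⊗[K] RestrictedDual K A,
          TensorProduct.dualDistrib K _ _ (evalAt x ⊗ₜ
            TensorProduct.dualDistrib K _ _ (evalAt y ⊗ₜ evalAt z))
            (TensorProduct.assoc K _ _ _ (comul.rTensor (RestrictedDual K A) t)) =
          tensorToDual K A t ((x * y) ⊗ₜ z) := by
        intro t
        induction t with
        | zero => simp
        | add a b ha hb => simp only [map_add, LinearMap.add_apply, ha, hb]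
        | tmul g h =>
          simp only [LinearMap.rTensor_tmul, tensorToDual_tmul]
          rw [← tensorToDual_comul]
          induction (comul g : RestrictedDual K A ⊗[K] RestrictedDual K A) with
          | zero => simp
          | add a b ha hb =>
            simp only [map_add, TensorProduct.add_tmul, LinearMap.add_apply, ha, hb, add_mul]
          | tmul g1 g2 => simp [mul_assoc]
      have h2 : ∀ t : RestrictedDual K A ⊗[K] RestrictedDual K A,
          TensorProduct.dualDistrib K _ _ (evalAt x ⊗ₜ
            TensorProduct.dualDistrib K _ _ (evalAt y ⊗ₜ evalAt z))
            (comul.lTensor (RestrictedDual K A) t) =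
          tensorToDual K A t (x ⊗ₜ (y * z)) := by
        intro t
        induction t with
        | zero => simp
        | add a b ha hb => simp only [map_add, LinearMap.add_apply, ha, hb]
        | tmul g h =>
          simp only [LinearMap.lTensor_tmul, tensorToDual_tmul, TensorProduct.dualDistrib_apply]
          rw [← tensorToDual_apply, tensorToDual_comul]
          simp
      simp only [LinearMap.comp_apply, LinearEquiv.coe_coe]
      rw [h1, h2]
      simp [mul_assoc]
  rTensor_counit_comp_comul := by
    ext f
    apply (TensorProduct.lid K (RestrictedDual K A)).injective
    refine RestrictedDual.ext fun x => ?_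
    have h : ∀ t : RestrictedDual K A ⊗[K] RestrictedDual K A,
        (TensorProduct.lid K (RestrictedDual K A) (counit.rTensor _ t)) x =
          tensorToDual K A t (1 ⊗ₜ x) := by
      intro t
      induction t with
      | zero => simp
      | add a b ha hb => simp only [map_add, LinearMap.add_apply, ha, hb]
      | tmul g h => simp
    simp only [LinearMap.comp_apply]
    rw [h]
    simp
  lTensor_counit_comp_comul := by
    ext f
    apply (TensorProduct.rid K (RestrictedDual K A)).injective
    refine RestrictedDual.ext fun x => ?_
    have h : ∀ t : RestrictedDual K A ⊗[K] RestrictedDual K A,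
        (TensorProduct.rid K (RestrictedDual K A) (counit.lTensor _ t)) x =
          tensorToDual K A t (x ⊗ₜ 1) := by
      intro t
      induction t with
      | zero => simp
      | add a b ha hb => simp only [map_add, LinearMap.add_apply, ha, hb]
      | tmul g h => simp [mul_comm]
    simp only [LinearMap.comp_apply]
    rw [h]
    simp

end RestrictedDual

section RestrictedDualHopf

open WithConv

variable {K : Type u} [Field K] {A : Type v} [Ring A] [Bialgebra K A]

theorem convMul_apply_tensor (f g : Module.Dual K A) (x : A) :
    (toConv f * toConv g).ofConv x = TensorProduct.dualDistrib K A A (f ⊗ₜ g) (comul x) := by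
  rw [LinearMap.convMul_def]
  simp only [LinearMap.comp_apply]
  induction (comul x : A ⊗[K] A) with
  | zero => simp
  | add a b ha hb => simp [ha, hb]
  | tmul a b => simp

/-- The convolution product of two elements of `A^o` lies in `A^o`. -/
theorem convMul_mem (f g : RestrictedDual K A) :
    (toConv (RestrictedDual.toDual K A f) * toConv (RestrictedDual.toDual K A g)).ofConv ∈
      restrictedDual K A := by
  obtain ⟨s, hs⟩ := (mem_restrictedDual_iff _).1 f.toDual_mem
  obtain ⟨t, ht⟩ := (mem_restrictedDual_iff _).1 g.toDual_mem
  refine mem_restrictedDual_of_sum (s ×ˢ t) _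
    (fun p => (toConv p.1.1 * toConv p.2.1).ofConv)
    (fun p => (toConv p.1.2 * toConv p.2.2).ofConv) fun x y => ?_
  simp only [convMul_apply_tensor, Bialgebra.comul_mul]
  induction (comul x : A ⊗[K] A) with
  | zero => simp
  | add a b ha hb => simp only [add_mul, map_add, ha, hb, Finset.sum_add_distrib]
  | tmul a b =>
    induction (comul y : A ⊗[K] A) with
    | zero => simp
    | add c d hc hd => simp only [mul_add, map_add, hc, hd, Finset.sum_add_distrib]
    | tmul c d =>
      simp only [Algebra.TensorProduct.tmul_mul_tmul, TensorProduct.dualDistrib_apply, hs, ht,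
        Finset.sum_mul_sum, Finset.sum_product]
      exact Finset.sum_congr rfl fun _ _ => Finset.sum_congr rfl fun _ _ => by ring

theorem counit_mem : (counit : A →ₗ[K] K) ∈ restrictedDual K A :=
  mem_restrictedDual_of_sum (Finset.univ : Finset Unit) _ (fun _ => counit) (fun _ => counit)
    (by simp)

/-- The product of `A^o` is the convolution product `(f g)(x) = f(x₍₁₎) g(x₍₂₎)`. -/
instance : Mul (RestrictedDual K A) := ⟨fun f g => RestrictedDual.mk _ (convMul_mem f g)⟩

/-- The unit of `A^o` is the counit of `A`. -/
instance : One (RestrictedDual K A) := ⟨RestrictedDual.mk counit counit_mem⟩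

theorem RestrictedDual.toDual_mul (f g : RestrictedDual K A) :
    RestrictedDual.toDual K A (f * g) =
      (toConv (RestrictedDual.toDual K A f) * toConv (RestrictedDual.toDual K A g)).ofConv := rfl

@[simp] theorem RestrictedDual.one_apply (x : A) :
    (1 : RestrictedDual K A) x = counit (R := K) x := rfl

theorem RestrictedDual.mul_apply (f g : RestrictedDual K A) (x : A) :
    (f * g) x = tensorToDual K A (f ⊗ₜ g) (comul x) :=
  convMul_apply_tensor _ _ x

theorem RestrictedDual.mul_apply_repr {ι : Type*} (f g : RestrictedDual K A) {x : A}
    (r : Coalgebra.Repr K x ι) :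
    (f * g) x = ∑ i ∈ r.index, f (r.left i) * g (r.right i) := by
  rw [RestrictedDual.mul_apply, ← r.eq]
  simp

theorem RestrictedDual.toConv_injective : Function.Injective
    (fun f : RestrictedDual K A => toConv (RestrictedDual.toDual K A f)) := fun _ _ h =>
  Subtype.ext (congrArg ofConv h)

instance : Ring (RestrictedDual K A) where
  __ := (inferInstance : AddCommGroup (RestrictedDual K A))
  mul_assoc f g h := RestrictedDual.toConv_injective (mul_assoc (toConv f.1) (toConv g.1) (toConv h.1))
  one_mul f := RestrictedDual.toConv_injective (one_mul (toConv f.1))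
  mul_one f := RestrictedDual.toConv_injective (mul_one (toConv f.1))
  zero_mul f := RestrictedDual.toConv_injective (zero_mul (toConv f.1))
  mul_zero f := RestrictedDual.toConv_injective (mul_zero (toConv f.1))
  left_distrib f g h :=
    RestrictedDual.toConv_injective (mul_add (toConv f.1) (toConv g.1) (toConv h.1))
  right_distrib f g h :=
    RestrictedDual.toConv_injective (add_mul (toConv f.1) (toConv g.1) (toConv h.1))

instance : Algebra K (RestrictedDual K A) :=
  Algebra.ofModule
    (fun r f g => RestrictedDual.toConv_injective (smul_mul_assoc r (toConv f.1) (toConv g.1)))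
    (fun r f g => RestrictedDual.toConv_injective (mul_smul_comm r (toConv f.1) (toConv g.1)))

theorem tensorToDual_mul (s t : RestrictedDual K A ⊗[K] RestrictedDual K A) {ι κ : Type*}
    {x y : A} (rx : Coalgebra.Repr K x ι) (ry : Coalgebra.Repr K y κ) :
    tensorToDual K A (s * t) (x ⊗ₜ y) = ∑ i ∈ rx.index, ∑ j ∈ ry.index,
      tensorToDual K A s (rx.left i ⊗ₜ ry.left j) *
        tensorToDual K A t (rx.right i ⊗ₜ ry.right j) := by
  induction s with
  | zero => simp
  | add a b ha hb => simp only [add_mul, map_add, LinearMap.add_apply, ha, hb,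
      Finset.sum_add_distrib]
  | tmul f f' =>
    induction t with
    | zero => simp
    | add a b ha hb => simp only [mul_add, map_add, LinearMap.add_apply, ha, hb,
        Finset.sum_add_distrib]
    | tmul g g' =>
      simp only [Algebra.TensorProduct.tmul_mul_tmul, tensorToDual_tmul,
        RestrictedDual.mul_apply_repr _ _ rx, RestrictedDual.mul_apply_repr _ _ ry,
        Finset.sum_mul_sum]
      exact Finset.sum_congr rfl fun _ _ => Finset.sum_congr rfl fun _ _ => by ring

/-- The restricted dual of a bialgebra is a bialgebra. -/
instance : Bialgebra K (RestrictedDual K A) :=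
  Bialgebra.mk' K (RestrictedDual K A)
    (by simp)
    (by
      intro f g
      simp [RestrictedDual.mul_apply, Algebra.TensorProduct.one_def])
    (by
      refine tensorToDual_ext fun x y => ?_
      simp [Algebra.TensorProduct.one_def])
    (by
      intro f g
      refine tensorToDual_ext fun x y => ?_
      rw [tensorToDual_comul, tensorToDual_mul _ _ (ℛ K x) (ℛ K y),
        RestrictedDual.mul_apply_repr _ _ ((ℛ K x).mul (ℛ K y))]
      simp [Coalgebra.Repr.mul, Finset.sum_product])

end RestrictedDualHopf

section RestrictedDualAntipode

variable {K : Type u} [Field K] {A : Type v} [Ring A]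

/-- Precomposition with an algebra anti-endomorphism preserves `A^o`. -/
theorem comp_anti_mem [Algebra K A] (T : A →ₗ[K] A) (hT : ∀ x y, T (x * y) = T y * T x)
    (f : RestrictedDual K A) : RestrictedDual.toDual K A f ∘ₗ T ∈ restrictedDual K A := by
  obtain ⟨s, hs⟩ := (mem_restrictedDual_iff _).1 f.toDual_mem
  refine mem_restrictedDual_of_sum s _ (fun p => p.2 ∘ₗ T) (fun p => p.1 ∘ₗ T) fun x y => ?_
  simp only [LinearMap.comp_apply, hT, hs]
  exact Finset.sum_congr rfl fun _ _ => mul_comm _ _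

/-- Precomposition with an algebra anti-endomorphism, `f ↦ f ∘ T`, as an endomorphism of `A^o`. -/
def RestrictedDual.compAnti [Algebra K A] (T : A →ₗ[K] A) (hT : ∀ x y, T (x * y) = T y * T x) :
    RestrictedDual K A →ₗ[K] RestrictedDual K A where
  toFun f := RestrictedDual.mk (RestrictedDual.toDual K A f ∘ₗ T) (comp_anti_mem T hT f)
  map_add' f g := RestrictedDual.ext fun x => by simp
  map_smul' r f := RestrictedDual.ext fun x => by simp

@[simp] theorem RestrictedDual.compAnti_apply [Algebra K A] (T : A →ₗ[K] A)
    (hT : ∀ x y, T (x * y) = T y * T x) (f : RestrictedDual K A) (x : A) :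
    (RestrictedDual.compAnti T hT f) x = f (T x) := rfl

/-- Precomposition with an algebra homomorphism, `φ^o : B^o → A^o`, `f ↦ f ∘ φ`. -/
def RestrictedDual.comap [Algebra K A] {B : Type w} [Ring B] [Algebra K B] (φ : A →ₐ[K] B) :
    RestrictedDual K B →ₗ[K] RestrictedDual K A where
  toFun f := RestrictedDual.mk (RestrictedDual.toDual K B f ∘ₗ φ.toLinearMap) (by
    obtain ⟨s, hs⟩ := (mem_restrictedDual_iff _).1 f.toDual_mem
    refine mem_restrictedDual_of_sum s _ (fun p => p.1 ∘ₗ φ.toLinearMap)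
      (fun p => p.2 ∘ₗ φ.toLinearMap) fun x y => ?_
    simp [hs])
  map_add' f g := RestrictedDual.ext fun x => by simp
  map_smul' r f := RestrictedDual.ext fun x => by simp

@[simp] theorem RestrictedDual.comap_apply [Algebra K A] {B : Type w} [Ring B] [Algebra K B]
    (φ : A →ₐ[K] B) (f : RestrictedDual K B) (x : A) :
    (RestrictedDual.comap φ f) x = f (φ x) := rfl

variable [HopfAlgebra K A]

/-- The restricted dual of a Hopf algebra is a Hopf algebra, with antipode `f ↦ f ∘ S`. -/
instance : HopfAlgebra K (RestrictedDual K A) where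
  antipode := RestrictedDual.compAnti (HopfAlgebra.antipode K)
    HopfAlgebra.antipode_mul_antidistrib
  mul_antipode_rTensor_comul := by
    ext f
    refine RestrictedDual.ext fun x => ?_
    have h : ∀ t : RestrictedDual K A ⊗[K] RestrictedDual K A,
        (LinearMap.mul' K _ ((RestrictedDual.compAnti (HopfAlgebra.antipode K)
          HopfAlgebra.antipode_mul_antidistrib).rTensor _ t)) x =
        tensorToDual K A t ((HopfAlgebra.antipode K).rTensor A (comul x)) := by
      intro t
      induction t with
      | zero => simp
      | add a b ha hb => simp only [map_add, LinearMap.add_apply, ha, hb]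
      | tmul f g =>
        simp only [LinearMap.rTensor_tmul, LinearMap.mul'_apply]
        rw [RestrictedDual.mul_apply]
        induction (comul x : A ⊗[K] A) with
        | zero => simp
        | add a b ha hb => simp only [map_add, ha, hb]
        | tmul a b => simp
    have h' : ∀ u : A ⊗[K] A, tensorToDual K A (comul f) u = f (LinearMap.mul' K A u) := by
      intro u
      induction u with
      | zero => simp
      | add a b ha hb => simp only [map_add, ha, hb]
      | tmul a b => simp
    simp only [LinearMap.comp_apply]
    rw [h, h', HopfAlgebra.mul_antipode_rTensor_comul_apply]
    simp [Algebra.algebraMap_eq_smul_one, mul_comm]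
  mul_antipode_lTensor_comul := by
    ext f
    refine RestrictedDual.ext fun x => ?_
    have h : ∀ t : RestrictedDual K A ⊗[K] RestrictedDual K A,
        (LinearMap.mul' K _ ((RestrictedDual.compAnti (HopfAlgebra.antipode K)
          HopfAlgebra.antipode_mul_antidistrib).lTensor _ t)) x =
        tensorToDual K A t ((HopfAlgebra.antipode K).lTensor A (comul x)) := by
      intro t
      induction t with
      | zero => simp
      | add a b ha hb => simp only [map_add, LinearMap.add_apply, ha, hb]
      | tmul f g =>
        simp only [LinearMap.lTensor_tmul, LinearMap.mul'_apply]
        rw [RestrictedDual.mul_apply]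
        induction (comul x : A ⊗[K] A) with
        | zero => simp
        | add a b ha hb => simp only [map_add, ha, hb]
        | tmul a b => simp
    have h' : ∀ u : A ⊗[K] A, tensorToDual K A (comul f) u = f (LinearMap.mul' K A u) := by
      intro u
      induction u with
      | zero => simp
      | add a b ha hb => simp only [map_add, ha, hb]
      | tmul a b => simp
    simp only [LinearMap.comp_apply]
    rw [h, h', HopfAlgebra.mul_antipode_lTensor_comul_apply]
    simp [Algebra.algebraMap_eq_smul_one, mul_comm]

end RestrictedDualAntipode

section QuantumDouble

open MulOpposite WithConv

variable (K : Type u) [Field K] (H : Type v) [Ring H]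

/-- The antipode of `H` is invertible. -/
class InvertibleAntipode [HopfAlgebra K H] : Prop where
  bijective : Function.Bijective (HopfAlgebra.antipode K : H →ₗ[K] H)

variable [HopfAlgebra K H]

variable {K H} in
/-- The right-hand side
`⟨f₍₁₎, x₍₁₎⟩ ⟨f₍₃₎, S(x₍₃₎)⟩ i(x₍₂₎) j(f₍₂₎)`
of the commutation relation of the quantum double. The Sweedler components are computed from
arbitrarily chosen representations `x₍₁₎ ⊗ (x₍₂₎ ⊗ x₍₃₎)` and `f₍₁₎ ⊗ (f₍₂₎ ⊗ f₍₃₎)`. -/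
def crossTerm {E : Type w} [Ring E] [Algebra K E] (i : H →ₗ[K] E) (j : RestrictedDual K H →ₗ[K] E)
    (f : RestrictedDual K H) (x : H) : E :=
  ∑ a ∈ (ℛ K f).index, ∑ b ∈ (ℛ K x).index,
    ∑ c ∈ (ℛ K ((ℛ K f).right a)).index, ∑ d ∈ (ℛ K ((ℛ K x).right b)).index,
      ((ℛ K f).left a ((ℛ K x).left b) *
        (ℛ K ((ℛ K f).right a)).right c
          (HopfAlgebra.antipode K ((ℛ K ((ℛ K x).right b)).right d))) •
        (i ((ℛ K ((ℛ K x).right b)).left d) * j ((ℛ K ((ℛ K f).right a)).left c))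

/-- The free algebra on the vector space `H ⊕ H^o`. -/
abbrev DoubleFree : Type (max u v) := TensorAlgebra K (H × RestrictedDual K H)

/-- The inclusion of `H` in the free algebra. -/
def freeI : H →ₗ[K] DoubleFree K H := TensorAlgebra.ι K ∘ₗ LinearMap.inl K _ _

/-- The inclusion of `H^o` in the free algebra. -/
def freeJ : RestrictedDual K H →ₗ[K] DoubleFree K H := TensorAlgebra.ι K ∘ₗ LinearMap.inr K _ _

/-- The defining relations of the quantum double: the inclusion of `H` is an algebra map, the
inclusion of `H^o` is an algebra antihomomorphism, and the commutation relation
`j(f) i(x) = ⟨f₍₁₎, x₍₁₎⟩ ⟨f₍₃₎, S(x₍₃₎)⟩ i(x₍₂₎) j(f₍₂₎)` holds. -/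
inductive DoubleRel : DoubleFree K H → DoubleFree K H → Prop
  | i_one : DoubleRel (freeI K H 1) 1
  | i_mul (x y : H) : DoubleRel (freeI K H (x * y)) (freeI K H x * freeI K H y)
  | j_one : DoubleRel (freeJ K H 1) 1
  | j_mul (f g : RestrictedDual K H) :
      DoubleRel (freeJ K H (f * g)) (freeJ K H g * freeJ K H f)
  | cross (f : RestrictedDual K H) (x : H) :
      DoubleRel (freeJ K H f * freeI K H x) (crossTerm (freeI K H) (freeJ K H) f x)

/-- Drinfeld's quantum double `D(H)`: the algebra generated by `H` and `H^{o,op}` subject to the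
commutation relations. -/
def QuantumDouble : Type (max u v) := RingQuot (DoubleRel K H)

instance : Ring (QuantumDouble K H) := inferInstanceAs (Ring (RingQuot (DoubleRel K H)))

instance : Algebra K (QuantumDouble K H) :=
  inferInstanceAs (Algebra K (RingQuot (DoubleRel K H)))

namespace QuantumDouble

/-- The quotient map from the free algebra. -/
def quot : DoubleFree K H →ₐ[K] QuantumDouble K H := RingQuot.mkAlgHom K (DoubleRel K H)

variable {K H}

theorem quot_rel {a b : DoubleFree K H} (h : DoubleRel K H a b) : quot K H a = quot K H b :=
  RingQuot.mkAlgHom_rel K h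

theorem quot_surjective : Function.Surjective (quot K H) :=
  RingQuot.mkAlgHom_surjective K (DoubleRel K H)

variable (K H)

/-- The algebra map `ι : H → D(H)`. -/
def incl : H →ₐ[K] QuantumDouble K H :=
  AlgHom.ofLinearMap ((quot K H).toLinearMap ∘ₗ freeI K H)
    (by simpa using quot_rel DoubleRel.i_one)
    (fun x y => by simpa using quot_rel (DoubleRel.i_mul x y))

/-- The algebra map `j : H^{o,op} → D(H)`. -/
def inclDual : (RestrictedDual K H)ᵐᵒᵖ →ₐ[K] QuantumDouble K H :=
  AlgHom.ofLinearMap ((quot K H).toLinearMap ∘ₗ freeJ K H ∘ₗ (opLinearEquiv K).symm.toLinearMap)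
    (by simpa using quot_rel DoubleRel.j_one)
    (fun f g => by simpa using quot_rel (DoubleRel.j_mul g.unop f.unop))

/-- `j` as a linear map on `H^o`. -/
def inclDualₗ : RestrictedDual K H →ₗ[K] QuantumDouble K H :=
  (inclDual K H).toLinearMap ∘ₗ (opLinearEquiv K).toLinearMap

variable {K H}

theorem inclDualₗ_apply (f : RestrictedDual K H) :
    inclDualₗ K H f = inclDual K H (op f) := rfl

theorem quot_freeI (x : H) : quot K H (freeI K H x) = incl K H x := rfl

theorem quot_freeJ (f : RestrictedDual K H) : quot K H (freeJ K H f) = inclDualₗ K H f := rfl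

@[simp] theorem inclDualₗ_one : inclDualₗ K H 1 = 1 := map_one (inclDual K H)

theorem inclDualₗ_mul (f g : RestrictedDual K H) :
    inclDualₗ K H (f * g) = inclDualₗ K H g * inclDualₗ K H f :=
  map_mul (inclDual K H) (op g) (op f)

theorem map_crossTerm {E F : Type*} [Ring E] [Algebra K E] [Ring F] [Algebra K F]
    (φ : E →ₐ[K] F) (i : H →ₗ[K] E) (j : RestrictedDual K H →ₗ[K] E)
    (f : RestrictedDual K H) (x : H) :
    φ (crossTerm i j f x) = crossTerm (φ.toLinearMap ∘ₗ i) (φ.toLinearMap ∘ₗ j) f x := by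
  simp [crossTerm]

/-- The commutation relation in the quantum double. -/
theorem inclDual_mul_incl (f : RestrictedDual K H) (x : H) :
    inclDualₗ K H f * incl K H x = crossTerm (incl K H).toLinearMap (inclDualₗ K H) f x := by
  have := quot_rel (DoubleRel.cross f x)
  rw [map_mul, map_crossTerm] at this
  exact this

/-- The universal property of the quantum double. -/
def lift {E : Type w} [Ring E] [Algebra K E] (i : H →ₗ[K] E) (j : RestrictedDual K H →ₗ[K] E)
    (i_one : i 1 = 1) (i_mul : ∀ x y, i (x * y) = i x * i y)
    (j_one : j 1 = 1) (j_mul : ∀ f g, j (f * g) = j g * j f)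
    (hc : ∀ f x, j f * i x = crossTerm i j f x) : QuantumDouble K H →ₐ[K] E :=
  RingQuot.liftAlgHom K ⟨TensorAlgebra.lift K (i.coprod j), by
    have hi : ∀ x, TensorAlgebra.lift K (i.coprod j) (freeI K H x) = i x := by
      intro x; simp [freeI]
    have hj : ∀ f, TensorAlgebra.lift K (i.coprod j) (freeJ K H f) = j f := by
      intro f; simp [freeJ]
    intro a b h
    cases h with
    | i_one => rw [hi, i_one, map_one]
    | i_mul x y => rw [hi, i_mul, map_mul, hi, hi]
    | j_one => rw [hj, j_one, map_one]
    | j_mul f g => rw [hj, j_mul, map_mul, hj, hj]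
    | cross f x =>
      rw [map_mul, hi, hj, map_crossTerm, hc]
      congr 1
      · ext x; simp [hi]
      · ext f; simp [hj]⟩

theorem lift_incl {E : Type w} [Ring E] [Algebra K E] (i : H →ₗ[K] E)
    (j : RestrictedDual K H →ₗ[K] E) (h1 h2 h3 h4 h5) (x : H) :
    lift i j h1 h2 h3 h4 h5 (incl K H x) = i x := by
  rw [← quot_freeI]
  refine (RingQuot.liftAlgHom_mkAlgHom_apply K _ _ _).trans ?_
  simp [freeI]

theorem lift_inclDualₗ {E : Type w} [Ring E] [Algebra K E] (i : H →ₗ[K] E)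
    (j : RestrictedDual K H →ₗ[K] E) (h1 h2 h3 h4 h5) (f : RestrictedDual K H) :
    lift i j h1 h2 h3 h4 h5 (inclDualₗ K H f) = j f := by
  rw [← quot_freeJ]
  refine (RingQuot.liftAlgHom_mkAlgHom_apply K _ _ _).trans ?_
  simp [freeJ]

/-- `D(H)` is generated by the images of `H` and `H^o`. -/
theorem induction {P : QuantumDouble K H → Prop} (algebraMap : ∀ r, P (algebraMap K _ r))
    (incl : ∀ x, P (incl K H x)) (inclDual : ∀ f, P (inclDualₗ K H f))
    (mul : ∀ a b, P a → P b → P (a * b)) (add : ∀ a b, P a → P b → P (a + b))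
    (a : QuantumDouble K H) : P a := by
  obtain ⟨a, rfl⟩ := quot_surjective a
  induction a using TensorAlgebra.induction with
  | algebraMap r => simpa using algebraMap r
  | ι p =>
    have : TensorAlgebra.ι K p = freeI K H p.1 + freeJ K H p.2 := by
      simp [freeI, freeJ, ← map_add]
    rw [this, map_add]
    exact add _ _ (incl _) (inclDual _)
  | mul a b ha hb => rw [map_mul]; exact mul _ _ ha hb
  | add a b ha hb => rw [map_add]; exact add _ _ ha hb

theorem algHom_ext {E : Type*} [Ring E] [Algebra K E] {φ ψ : QuantumDouble K H →ₐ[K] E}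
    (hi : ∀ x, φ (incl K H x) = ψ (incl K H x))
    (hj : ∀ f, φ (inclDualₗ K H f) = ψ (inclDualₗ K H f)) : φ = ψ := by
  refine AlgHom.ext fun a => ?_
  induction a using QuantumDouble.induction with
  | algebraMap r => simp
  | incl x => exact hi x
  | inclDual f => exact hj f
  | mul a b ha hb => simp [ha, hb]
  | add a b ha hb => simp [ha, hb]

/-! The commutation relation as an identity in a convolution algebra. -/

variable (K H) in
/-- The pairing `f ⊗ x ↦ ⟨f, x⟩ 1`. -/
def pair (E : Type w) [Ring E] [Algebra K E] : WithConv (RestrictedDual K H ⊗[K] H →ₗ[K] E) :=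
  toConv (Algebra.linearMap K E ∘ₗ TensorProduct.lift (RestrictedDual.toDual K H))

variable (K H) in
/-- The pairing `f ⊗ x ↦ ⟨f, S x⟩ 1`. -/
def pairInv (E : Type w) [Ring E] [Algebra K E] : WithConv (RestrictedDual K H ⊗[K] H →ₗ[K] E) :=
  toConv (Algebra.linearMap K E ∘ₗ TensorProduct.lift
    ((RestrictedDual.toDual K H).compl₂ (HopfAlgebra.antipode K)))

/-- `f ⊗ x ↦ j(f) i(x)`. -/
def prodJI {E : Type w} [Ring E] [Algebra K E] (i : H →ₗ[K] E)
    (j : RestrictedDual K H →ₗ[K] E) : WithConv (RestrictedDual K H ⊗[K] H →ₗ[K] E) :=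
  toConv (LinearMap.mul' K E ∘ₗ TensorProduct.map j i)

/-- `f ⊗ x ↦ i(x) j(f)`. -/
def prodIJ {E : Type w} [Ring E] [Algebra K E] (i : H →ₗ[K] E)
    (j : RestrictedDual K H →ₗ[K] E) : WithConv (RestrictedDual K H ⊗[K] H →ₗ[K] E) :=
  toConv (LinearMap.mul' K E ∘ₗ TensorProduct.map i j ∘ₗ
    (TensorProduct.comm K (RestrictedDual K H) H).toLinearMap)

section

variable {E : Type w} [Ring E] [Algebra K E]

@[simp] theorem pair_tmul (f : RestrictedDual K H) (x : H) :
    pair K H E (f ⊗ₜ x) = algebraMap K E (f x) := rfl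

@[simp] theorem pairInv_tmul (f : RestrictedDual K H) (x : H) :
    pairInv K H E (f ⊗ₜ x) = algebraMap K E (f (HopfAlgebra.antipode K x)) := rfl

@[simp] theorem prodJI_tmul (i : H →ₗ[K] E) (j : RestrictedDual K H →ₗ[K] E)
    (f : RestrictedDual K H) (x : H) : prodJI i j (f ⊗ₜ x) = j f * i x := rfl

@[simp] theorem prodIJ_tmul (i : H →ₗ[K] E) (j : RestrictedDual K H →ₗ[K] E)
    (f : RestrictedDual K H) (x : H) : prodIJ i j (f ⊗ₜ x) = i x * j f := rfl

theorem conv_apply {ι κ : Type*} (u v : WithConv (RestrictedDual K H ⊗[K] H →ₗ[K] E))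
    {f : RestrictedDual K H} {x : H} (rf : Coalgebra.Repr K f ι) (rx : Coalgebra.Repr K x κ) :
    (u * v) (f ⊗ₜ x) = ∑ a ∈ rf.index, ∑ b ∈ rx.index,
      u (rf.left a ⊗ₜ rx.left b) * v (rf.right a ⊗ₜ rx.right b) := by
  rw [(rf.tmul rx).convMul_apply]
  simp [Coalgebra.Repr.tmul, Finset.sum_product]

theorem conv_ext {u v : WithConv (RestrictedDual K H ⊗[K] H →ₗ[K] E)}
    (h : ∀ f x, u (f ⊗ₜ x) = v (f ⊗ₜ x)) : u = v :=
  WithConv.ext (TensorProduct.ext' h)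

theorem pair_mul_pairInv : pair K H E * pairInv K H E = 1 := by
  refine conv_ext fun f x => ?_
  rw [conv_apply _ _ (ℛ K f) (ℛ K x), Finset.sum_comm]
  simp only [pair_tmul, pairInv_tmul, ← map_mul, ← map_sum, repr_apply]
  rw [HopfAlgebra.sum_mul_antipode_eq_smul]
  simp

theorem pairInv_mul_pair : pairInv K H E * pair K H E = 1 := by
  refine conv_ext fun f x => ?_
  rw [conv_apply _ _ (ℛ K f) (ℛ K x), Finset.sum_comm]
  simp only [pair_tmul, pairInv_tmul, ← map_mul, ← map_sum, repr_apply]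
  rw [HopfAlgebra.sum_antipode_mul_eq_smul]
  simp

theorem crossTerm_eq (i : H →ₗ[K] E) (j : RestrictedDual K H →ₗ[K] E)
    (f : RestrictedDual K H) (x : H) :
    crossTerm i j f x = (pair K H E * (prodIJ i j * pairInv K H E)) (f ⊗ₜ x) := by
  rw [conv_apply _ _ (ℛ K f) (ℛ K x), crossTerm]
  refine Finset.sum_congr rfl fun a _ => Finset.sum_congr rfl fun b _ => ?_
  rw [conv_apply _ _ (ℛ K ((ℛ K f).right a)) (ℛ K ((ℛ K x).right b)), Finset.mul_sum]
  refine Finset.sum_congr rfl fun c _ => ?_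
  rw [Finset.mul_sum]
  refine Finset.sum_congr rfl fun d _ => ?_
  simp only [pair_tmul, pairInv_tmul, prodIJ_tmul]
  rw [Algebra.smul_def, map_mul, mul_assoc, ← Algebra.commutes _ (i _ * j _)]

theorem cross_iff (i : H →ₗ[K] E) (j : RestrictedDual K H →ₗ[K] E) :
    (∀ f x, j f * i x = crossTerm i j f x) ↔
      prodJI i j * pair K H E = pair K H E * prodIJ i j := by
  have h0 : (∀ f x, j f * i x = crossTerm i j f x) ↔
      prodJI i j = pair K H E * (prodIJ i j * pairInv K H E) := by
    constructor
    · intro h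
      exact conv_ext fun f x => by rw [prodJI_tmul, h, crossTerm_eq]
    · intro h f x
      rw [crossTerm_eq, ← h, prodJI_tmul]
  rw [h0]
  constructor
  · intro h
    rw [h, mul_assoc, mul_assoc, pairInv_mul_pair, mul_one]
  · intro h
    rw [← mul_assoc, ← h, mul_assoc, pair_mul_pairInv, mul_one]

end

section Antipode

variable {A : Type w} [Ring A] [HopfAlgebra K A]

theorem algHom_conv_antipode {E : Type*} [Ring E] [Algebra K E] (φ : A →ₐ[K] E) :
    toConv φ.toLinearMap * toConv (φ.toLinearMap ∘ₗ HopfAlgebra.antipode K) = 1 := by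
  ext x
  rw [(ℛ K x).convMul_apply]
  simp only [LinearMap.comp_apply, AlgHom.toLinearMap_apply]
  simp only [← map_mul, ← map_sum]
  rw [HopfAlgebra.sum_mul_antipode_eq_algebraMap_counit]
  simp

theorem antipode_conv_algHom {E : Type*} [Ring E] [Algebra K E] (φ : A →ₐ[K] E) :
    toConv (φ.toLinearMap ∘ₗ HopfAlgebra.antipode K) * toConv φ.toLinearMap = 1 := by
  ext x
  rw [(ℛ K x).convMul_apply]
  simp only [LinearMap.comp_apply, AlgHom.toLinearMap_apply]
  simp only [← map_mul, ← map_sum]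
  rw [HopfAlgebra.sum_antipode_mul_eq_algebraMap_counit]
  simp

/-- The antipode is a coalgebra antihomomorphism. -/
theorem comul_antipode {ι : Type*} {x : A} (r : Coalgebra.Repr K x ι) :
    comul (R := K) (HopfAlgebra.antipode K x) =
      ∑ i ∈ r.index, HopfAlgebra.antipode K (r.right i) ⊗ₜ HopfAlgebra.antipode K (r.left i) := by
  let l : A →ₐ[K] A ⊗[K] A := Algebra.TensorProduct.includeLeft
  let rr : A →ₐ[K] A ⊗[K] A := Algebra.TensorProduct.includeRight
  have hlr : toConv (Bialgebra.comulAlgHom K A).toLinearMap =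
      toConv l.toLinearMap * toConv rr.toLinearMap := by
    ext x
    rw [(ℛ K x).convMul_apply]
    simp [l, rr, (ℛ K x).eq]
  have h1 := antipode_conv_algHom (K := K) (Bialgebra.comulAlgHom K A)
  have h2 : toConv (Bialgebra.comulAlgHom K A).toLinearMap *
      (toConv (rr.toLinearMap ∘ₗ HopfAlgebra.antipode K) *
        toConv (l.toLinearMap ∘ₗ HopfAlgebra.antipode K)) = 1 := by
    rw [hlr, mul_assoc, ← mul_assoc (toConv rr.toLinearMap), algHom_conv_antipode, one_mul,
      algHom_conv_antipode]
  have h3 := left_inv_eq_right_inv h1 h2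
  have h4 := congrArg (fun u : WithConv (A →ₗ[K] A ⊗[K] A) => u x) h3
  simp only at h4
  rw [r.convMul_apply] at h4
  simpa [l, rr] using h4

end Antipode

section Hopf

/-- The comultiplication on the generators from `H`. -/
def comulI : H →ₗ[K] QuantumDouble K H ⊗[K] QuantumDouble K H :=
  TensorProduct.map (incl K H).toLinearMap (incl K H).toLinearMap ∘ₗ comul

/-- The comultiplication on the generators from `H^o`. -/
def comulJ : RestrictedDual K H →ₗ[K] QuantumDouble K H ⊗[K] QuantumDouble K H :=
  TensorProduct.map (inclDualₗ K H) (inclDualₗ K H) ∘ₗ comul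

theorem comulI_repr {ι : Type*} {x : H} (r : Coalgebra.Repr K x ι) :
    comulI (K := K) x = ∑ a ∈ r.index, incl K H (r.left a) ⊗ₜ incl K H (r.right a) := by
  simp [comulI, ← r.eq]

theorem comulJ_repr {ι : Type*} {f : RestrictedDual K H} (r : Coalgebra.Repr K f ι) :
    comulJ f = ∑ a ∈ r.index, inclDualₗ K H (r.left a) ⊗ₜ inclDualₗ K H (r.right a) := by
  simp [comulJ, ← r.eq]

theorem comulI_mul (x y : H) : comulI (K := K) (x * y) = comulI (K := K) x * comulI y := by
  rw [comulI_repr ((ℛ K x).mul (ℛ K y)), comulI_repr (ℛ K x), comulI_repr (ℛ K y),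
    Finset.sum_mul_sum]
  simp [Coalgebra.Repr.mul, Finset.sum_product]

theorem comulJ_mul (f g : RestrictedDual K H) : comulJ (f * g) = comulJ g * comulJ f := by
  rw [comulJ_repr ((ℛ K f).mul (ℛ K g)), comulJ_repr (ℛ K f), comulJ_repr (ℛ K g),
    Finset.sum_mul_sum, Finset.sum_comm]
  simp [Coalgebra.Repr.mul, Finset.sum_product, inclDualₗ_mul]

theorem cross_algHom {E : Type w} [Ring E] [Algebra K E] (φ : QuantumDouble K H →ₐ[K] E) :
    prodJI (φ.toLinearMap ∘ₗ (incl K H).toLinearMap) (φ.toLinearMap ∘ₗ inclDualₗ K H) *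
      pair K H E = pair K H E *
      prodIJ (φ.toLinearMap ∘ₗ (incl K H).toLinearMap) (φ.toLinearMap ∘ₗ inclDualₗ K H) := by
  refine (cross_iff _ _).1 fun f x => ?_
  rw [← map_crossTerm, ← inclDual_mul_incl]
  simp

theorem cross_comul (f : RestrictedDual K H) (x : H) :
    comulJ f * comulI x = crossTerm (comulI (K := K)) comulJ f x := by
  revert f x
  rw [cross_iff]
  let l : QuantumDouble K H →ₐ[K] QuantumDouble K H ⊗[K] QuantumDouble K H :=
    Algebra.TensorProduct.includeLeft
  let r : QuantumDouble K H →ₐ[K] QuantumDouble K H ⊗[K] QuantumDouble K H :=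
    Algebra.TensorProduct.includeRight
  have h1 : prodJI (comulI (K := K) (H := H)) comulJ =
      prodJI (l.toLinearMap ∘ₗ (incl K H).toLinearMap) (l.toLinearMap ∘ₗ inclDualₗ K H) *
      prodJI (r.toLinearMap ∘ₗ (incl K H).toLinearMap) (r.toLinearMap ∘ₗ inclDualₗ K H) := by
    refine conv_ext fun f x => ?_
    rw [conv_apply _ _ (ℛ K f) (ℛ K x), prodJI_tmul, comulJ_repr (ℛ K f), comulI_repr (ℛ K x),
      Finset.sum_mul_sum]
    simp [l, r]
  have h2 : prodIJ (comulI (K := K) (H := H)) comulJ =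
      prodIJ (l.toLinearMap ∘ₗ (incl K H).toLinearMap) (l.toLinearMap ∘ₗ inclDualₗ K H) *
      prodIJ (r.toLinearMap ∘ₗ (incl K H).toLinearMap) (r.toLinearMap ∘ₗ inclDualₗ K H) := by
    refine conv_ext fun f x => ?_
    rw [conv_apply _ _ (ℛ K f) (ℛ K x), prodIJ_tmul, comulJ_repr (ℛ K f), comulI_repr (ℛ K x),
      Finset.sum_mul_sum, Finset.sum_comm]
    simp [l, r]
  rw [h1, h2, mul_assoc, cross_algHom r, ← mul_assoc, cross_algHom l, mul_assoc]

variable (K H)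

/-- The comultiplication of the quantum double, determined by `ι` and `j` being coalgebra maps. -/
def comulAlg : QuantumDouble K H →ₐ[K] QuantumDouble K H ⊗[K] QuantumDouble K H :=
  lift comulI comulJ (by simp [comulI, Algebra.TensorProduct.one_def]) comulI_mul
    (by simp [comulJ, Algebra.TensorProduct.one_def]) comulJ_mul cross_comul

/-- The counit of the quantum double, determined by `ι` and `j` being coalgebra maps. -/
def counitAlg : QuantumDouble K H →ₐ[K] K :=
  lift (counit : H →ₗ[K] K) (counit : RestrictedDual K H →ₗ[K] K)
    Bialgebra.counit_one Bialgebra.counit_mul Bialgebra.counit_one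
    (fun f g => by rw [Bialgebra.counit_mul, mul_comm]) (by
      rw [cross_iff]
      have h1 : prodJI (counit : H →ₗ[K] K) (counit : RestrictedDual K H →ₗ[K] K) = 1 :=
        conv_ext fun f x => by simp [mul_comm]
      have h2 : prodIJ (counit : H →ₗ[K] K) (counit : RestrictedDual K H →ₗ[K] K) = 1 :=
        conv_ext fun f x => by simp
      rw [h1, h2, one_mul, mul_one])

variable {K H}

theorem comulAlg_incl (x : H) : comulAlg K H (incl K H x) =
    TensorProduct.map (incl K H).toLinearMap (incl K H).toLinearMap (comul x) :=
  lift_incl _ _ _ _ _ _ _ x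

theorem comulAlg_inclDualₗ (f : RestrictedDual K H) : comulAlg K H (inclDualₗ K H f) =
    TensorProduct.map (inclDualₗ K H) (inclDualₗ K H) (comul f) :=
  lift_inclDualₗ _ _ _ _ _ _ _ f

theorem counitAlg_incl (x : H) : counitAlg K H (incl K H x) = counit x :=
  lift_incl _ _ _ _ _ _ _ x

theorem counitAlg_inclDualₗ (f : RestrictedDual K H) :
    counitAlg K H (inclDualₗ K H f) = counit f :=
  lift_inclDualₗ _ _ _ _ _ _ _ f

section

variable {C : Type w} [AddCommGroup C] [Module K C] [Coalgebra K C]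
  (k : C →ₗ[K] QuantumDouble K H)

theorem coassoc_aux (hk : ∀ c, comulAlg K H (k c) = TensorProduct.map k k (comul c)) (c : C) :
    Algebra.TensorProduct.assoc K K K _ _ _
      (Algebra.TensorProduct.map (comulAlg K H) (.id K _) (comulAlg K H (k c))) =
    Algebra.TensorProduct.map (.id K _) (comulAlg K H) (comulAlg K H (k c)) := by
  have h1 : ∀ t : C ⊗[K] C, Algebra.TensorProduct.assoc K K K _ _ _
      (Algebra.TensorProduct.map (comulAlg K H) (.id K _) (TensorProduct.map k k t)) =
      TensorProduct.map k (TensorProduct.map k k)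
        (TensorProduct.assoc K C C C (comul.rTensor C t)) := by
    intro t
    induction t with
    | zero => simp
    | add a b ha hb => simp only [map_add, ha, hb]
    | tmul a b =>
      simp only [TensorProduct.map_tmul, Algebra.TensorProduct.map_tmul, hk, LinearMap.rTensor_tmul]
      induction (comul a : C ⊗[K] C) with
      | zero => simp
      | add a b ha hb => simp only [map_add, TensorProduct.add_tmul, ha, hb]
      | tmul c d => simp
  have h2 : ∀ t : C ⊗[K] C,
      Algebra.TensorProduct.map (.id K _) (comulAlg K H) (TensorProduct.map k k t) =
      TensorProduct.map k (TensorProduct.map k k) (comul.lTensor C t) := by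
    intro t
    induction t with
    | zero => simp
    | add a b ha hb => simp only [map_add, ha, hb]
    | tmul a b => simp [hk]
  rw [hk, h1, h2, Coalgebra.coassoc_apply]

theorem counit_left_aux (hk : ∀ c, comulAlg K H (k c) = TensorProduct.map k k (comul c))
    (hε : ∀ c, counitAlg K H (k c) = counit c) (c : C) :
    Algebra.TensorProduct.map (counitAlg K H) (.id K _) (comulAlg K H (k c)) = 1 ⊗ₜ k c := by
  have h1 : ∀ t : C ⊗[K] C,
      Algebra.TensorProduct.map (counitAlg K H) (.id K _) (TensorProduct.map k k t) =
      LinearMap.lTensor K k (counit.rTensor C t) := by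
    intro t
    induction t with
    | zero => simp
    | add a b ha hb => simp only [map_add, ha, hb]
    | tmul a b => simp [hε]
  rw [hk, h1]
  simp

theorem counit_right_aux (hk : ∀ c, comulAlg K H (k c) = TensorProduct.map k k (comul c))
    (hε : ∀ c, counitAlg K H (k c) = counit c) (c : C) :
    Algebra.TensorProduct.map (.id K _) (counitAlg K H) (comulAlg K H (k c)) = k c ⊗ₜ 1 := by
  have h1 : ∀ t : C ⊗[K] C,
      Algebra.TensorProduct.map (.id K _) (counitAlg K H) (TensorProduct.map k k t) =
      LinearMap.rTensor K k (counit.lTensor C t) := by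
    intro t
    induction t with
    | zero => simp
    | add a b ha hb => simp only [map_add, ha, hb]
    | tmul a b => simp [hε]
  rw [hk, h1]
  simp

end

/-- The quantum double is a bialgebra. -/
instance : Bialgebra K (QuantumDouble K H) :=
  Bialgebra.ofAlgHom (comulAlg K H) (counitAlg K H)
    (algHom_ext (coassoc_aux (incl K H).toLinearMap comulAlg_incl)
      (coassoc_aux (inclDualₗ K H) comulAlg_inclDualₗ))
    (algHom_ext (counit_left_aux (incl K H).toLinearMap comulAlg_incl counitAlg_incl)
      (counit_left_aux (inclDualₗ K H) comulAlg_inclDualₗ counitAlg_inclDualₗ))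
    (algHom_ext (counit_right_aux (incl K H).toLinearMap comulAlg_incl counitAlg_incl)
      (counit_right_aux (inclDualₗ K H) comulAlg_inclDualₗ counitAlg_inclDualₗ))

theorem comul_incl (x : H) : comul (R := K) (incl K H x) =
    TensorProduct.map (incl K H).toLinearMap (incl K H).toLinearMap (comul x) := comulAlg_incl x

theorem comul_inclDualₗ (f : RestrictedDual K H) : comul (R := K) (inclDualₗ K H f) =
    TensorProduct.map (inclDualₗ K H) (inclDualₗ K H) (comul f) := comulAlg_inclDualₗ f

theorem counit_incl (x : H) : counit (R := K) (incl K H x) = counit (R := K) x := counitAlg_incl x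

theorem counit_inclDualₗ (f : RestrictedDual K H) :
    counit (R := K) (inclDualₗ K H f) = counit (R := K) f := counitAlg_inclDualₗ f

variable [InvertibleAntipode K H]

variable (K H)

/-- The inverse antipode of `H`. -/
def antipodeInv : H →ₗ[K] H :=
  (LinearEquiv.ofBijective (HopfAlgebra.antipode K : H →ₗ[K] H)
    InvertibleAntipode.bijective).symm.toLinearMap

variable {K H}

@[simp] theorem antipodeInv_antipode (x : H) :
    antipodeInv K H (HopfAlgebra.antipode K x) = x :=
  (LinearEquiv.ofBijective (HopfAlgebra.antipode K : H →ₗ[K] H)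
    InvertibleAntipode.bijective).symm_apply_apply x

@[simp] theorem antipode_antipodeInv (x : H) :
    HopfAlgebra.antipode K (antipodeInv K H x) = x :=
  (LinearEquiv.ofBijective (HopfAlgebra.antipode K : H →ₗ[K] H)
    InvertibleAntipode.bijective).apply_symm_apply x

theorem antipodeInv_mul (x y : H) :
    antipodeInv K H (x * y) = antipodeInv K H y * antipodeInv K H x := by
  apply (InvertibleAntipode.bijective (K := K) (H := H)).1
  rw [HopfAlgebra.antipode_mul_antidistrib]
  simp

theorem antipodeInv_one : antipodeInv K H 1 = 1 := by
  apply (InvertibleAntipode.bijective (K := K) (H := H)).1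
  simp

variable (K H)

/-- The inverse antipode `f ↦ f ∘ S⁻¹` of `H^o`. -/
def dualAntipodeInv : RestrictedDual K H →ₗ[K] RestrictedDual K H :=
  RestrictedDual.compAnti (antipodeInv K H) antipodeInv_mul

variable {K H}

@[simp] theorem dualAntipodeInv_apply (f : RestrictedDual K H) (x : H) :
    (dualAntipodeInv K H f) x = f (antipodeInv K H x) := rfl

/-- The components of `Δ(S x)`. -/
def reprAntipode {ι : Type*} {x : H} (r : Coalgebra.Repr K x ι) :
    Coalgebra.Repr K (HopfAlgebra.antipode K x) ι where
  index := r.index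
  left i := HopfAlgebra.antipode K (r.right i)
  right i := HopfAlgebra.antipode K (r.left i)
  eq := (comul_antipode r).symm

/-- The components of `Δ(S⁻¹ f)`. -/
def reprDualAntipodeInv {ι : Type*} {f : RestrictedDual K H} (r : Coalgebra.Repr K f ι) :
    Coalgebra.Repr K (dualAntipodeInv K H f) ι where
  index := r.index
  left i := dualAntipodeInv K H (r.right i)
  right i := dualAntipodeInv K H (r.left i)
  eq := tensorToDual_ext fun x y => by
    simp only [map_sum, LinearMap.sum_apply, tensorToDual_tmul, tensorToDual_comul,
      dualAntipodeInv_apply, antipodeInv_mul]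
    rw [← repr_apply r]
    exact Finset.sum_congr rfl fun _ _ => mul_comm _ _

theorem dualAntipodeInv_mul (f g : RestrictedDual K H) :
    dualAntipodeInv K H (f * g) = dualAntipodeInv K H g * dualAntipodeInv K H f := by
  refine RestrictedDual.ext fun x => ?_
  obtain ⟨y, rfl⟩ := (InvertibleAntipode.bijective (K := K) (H := H)).2 x
  rw [dualAntipodeInv_apply, antipodeInv_antipode, RestrictedDual.mul_apply_repr _ _ (ℛ K y),
    RestrictedDual.mul_apply_repr _ _ (reprAntipode (ℛ K y))]
  simp [reprAntipode, mul_comm]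

theorem dualAntipodeInv_one : dualAntipodeInv K H 1 = 1 := by
  refine RestrictedDual.ext fun x => ?_
  obtain ⟨y, rfl⟩ := (InvertibleAntipode.bijective (K := K) (H := H)).2 x
  simp

theorem dualAntipodeInv_sum_right_left {ι : Type*} {f : RestrictedDual K H}
    (r : Coalgebra.Repr K f ι) :
    ∑ i ∈ r.index, r.right i * dualAntipodeInv K H (r.left i) = counit (R := K) f • 1 := by
  have h := HopfAlgebra.sum_antipode_mul_eq_smul (R := K) (reprDualAntipodeInv r)
  have hS : ∀ g : RestrictedDual K H,
      HopfAlgebra.antipode K (dualAntipodeInv K H g) = g := fun g =>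
    RestrictedDual.ext fun x => by
      change g (antipodeInv K H (HopfAlgebra.antipode K x)) = g x
      rw [antipodeInv_antipode]
  simp only [reprDualAntipodeInv, hS] at h
  rw [h]
  simp [antipodeInv_one]

theorem dualAntipodeInv_sum_right_left' {ι : Type*} {f : RestrictedDual K H}
    (r : Coalgebra.Repr K f ι) :
    ∑ i ∈ r.index, dualAntipodeInv K H (r.right i) * r.left i = counit (R := K) f • 1 := by
  have h := HopfAlgebra.sum_mul_antipode_eq_smul (R := K) (reprDualAntipodeInv r)
  have hS : ∀ g : RestrictedDual K H,
      HopfAlgebra.antipode K (dualAntipodeInv K H g) = g := fun g =>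
    RestrictedDual.ext fun x => by
      change g (antipodeInv K H (HopfAlgebra.antipode K x)) = g x
      rw [antipodeInv_antipode]
  simp only [reprDualAntipodeInv, hS] at h
  rw [h]
  simp [antipodeInv_one]

/-- The antipode on the generators from `H`. -/
def antipodeI : H →ₗ[K] (QuantumDouble K H)ᵐᵒᵖ :=
  (opLinearEquiv K).toLinearMap ∘ₗ (incl K H).toLinearMap ∘ₗ HopfAlgebra.antipode K

/-- The antipode on the generators from `H^o`. -/
def antipodeJ : RestrictedDual K H →ₗ[K] (QuantumDouble K H)ᵐᵒᵖ :=
  (opLinearEquiv K).toLinearMap ∘ₗ inclDualₗ K H ∘ₗ dualAntipodeInv K H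

theorem cross_antipode (f : RestrictedDual K H) (x : H) :
    antipodeJ f * antipodeI x = crossTerm (antipodeI (K := K)) antipodeJ f x := by
  revert f x
  rw [cross_iff]
  refine conv_ext fun f x => ?_
  have h := congrArg (fun u : WithConv (RestrictedDual K H ⊗[K] H →ₗ[K] QuantumDouble K H) =>
    u (dualAntipodeInv K H f ⊗ₜ HopfAlgebra.antipode K x)) (cross_algHom (AlgHom.id K _))
  rw [conv_apply _ _ (reprDualAntipodeInv (ℛ K f)) (reprAntipode (ℛ K x)),
    conv_apply _ _ (reprDualAntipodeInv (ℛ K f)) (reprAntipode (ℛ K x))] at h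
  rw [conv_apply _ _ (ℛ K f) (ℛ K x), conv_apply _ _ (ℛ K f) (ℛ K x)]
  apply unop_injective
  simp only [reprDualAntipodeInv, reprAntipode, prodJI_tmul, prodIJ_tmul, pair_tmul,
    dualAntipodeInv_apply, antipodeInv_antipode, LinearMap.comp_apply, AlgHom.toLinearMap_apply,
    AlgHom.id_apply] at h
  simp only [antipodeI, antipodeJ, prodJI_tmul, prodIJ_tmul, pair_tmul, LinearMap.comp_apply,
    AlgHom.toLinearMap_apply, LinearEquiv.coe_coe, coe_opLinearEquiv, Finset.unop_sum, unop_mul, unop_op,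
    MulOpposite.algebraMap_apply]
  exact h.symm

variable (K H)

/-- The antipode of the quantum double as an algebra antihomomorphism, determined by
`S(ι(x)) = ι(S(x))` and `S(j(f)) = j(f ∘ S⁻¹)`. -/
def antipodeAlg : QuantumDouble K H →ₐ[K] (QuantumDouble K H)ᵐᵒᵖ :=
  lift antipodeI antipodeJ (by simp [antipodeI])
    (fun x y => by simp [antipodeI, HopfAlgebra.antipode_mul_antidistrib])
    (by simp [antipodeJ, dualAntipodeInv_one])
    (fun f g => by simp [antipodeJ, dualAntipodeInv_mul, inclDualₗ_mul]) cross_antipode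

/-- The antipode of the quantum double. -/
def antipodeLin : QuantumDouble K H →ₗ[K] QuantumDouble K H :=
  (opLinearEquiv K).symm.toLinearMap ∘ₗ (antipodeAlg K H).toLinearMap

variable {K H}

theorem antipodeAlg_incl (x : H) : antipodeAlg K H (incl K H x) = antipodeI x :=
  lift_incl _ _ _ _ _ _ _ x

theorem antipodeAlg_inclDualₗ (f : RestrictedDual K H) :
    antipodeAlg K H (inclDualₗ K H f) = antipodeJ f :=
  lift_inclDualₗ _ _ _ _ _ _ _ f

theorem antipodeLin_incl (x : H) :
    antipodeLin K H (incl K H x) = incl K H (HopfAlgebra.antipode K x) := by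
  simp [antipodeLin, antipodeAlg_incl, antipodeI]

theorem antipodeLin_inclDualₗ (f : RestrictedDual K H) :
    antipodeLin K H (inclDualₗ K H f) = inclDualₗ K H (dualAntipodeInv K H f) := by
  simp [antipodeLin, antipodeAlg_inclDualₗ, antipodeJ]

theorem antipodeLin_mul (a b : QuantumDouble K H) :
    antipodeLin K H (a * b) = antipodeLin K H b * antipodeLin K H a := by
  simp [antipodeLin]

theorem antipodeLin_algebraMap (r : K) :
    antipodeLin K H (algebraMap K _ r) = algebraMap K _ r := by
  simp [antipodeLin]

/-- The quantum double of a Hopf algebra with invertible antipode is a Hopf algebra. -/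
instance : HopfAlgebra K (QuantumDouble K H) where
  antipode := antipodeLin K H
  mul_antipode_rTensor_comul := by
    ext a
    simp only [LinearMap.comp_apply]
    induction a using QuantumDouble.induction with
    | algebraMap r =>
      rw [Bialgebra.comul_algebraMap, Algebra.TensorProduct.algebraMap_apply]
      simp [antipodeLin_algebraMap]
    | incl x =>
      rw [comul_incl, counit_incl, ← (ℛ K x).eq]
      simp only [map_sum, TensorProduct.map_tmul, AlgHom.toLinearMap_apply,
        LinearMap.rTensor_tmul, LinearMap.mul'_apply, antipodeLin_incl]
      simp only [← map_mul, ← map_sum]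
      rw [HopfAlgebra.sum_antipode_mul_eq_algebraMap_counit]
      simp
    | inclDual f =>
      rw [comul_inclDualₗ, counit_inclDualₗ, ← (ℛ K f).eq]
      simp only [map_sum, TensorProduct.map_tmul, LinearMap.rTensor_tmul, LinearMap.mul'_apply,
        antipodeLin_inclDualₗ]
      simp only [← inclDualₗ_mul, ← map_sum]
      rw [dualAntipodeInv_sum_right_left, map_smul, inclDualₗ_one,
        Algebra.linearMap_apply, Algebra.algebraMap_eq_smul_one]
    | mul a b ha hb =>
      rw [Bialgebra.comul_mul, Bialgebra.counit_mul]
      rw [← (ℛ K a).eq] at ha ⊢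
      rw [← (ℛ K b).eq] at hb ⊢
      rw [Finset.sum_mul_sum]
      simp only [map_sum, LinearMap.rTensor_tmul, LinearMap.mul'_apply,
        Algebra.TensorProduct.tmul_mul_tmul, antipodeLin_mul, Algebra.linearMap_apply] at ha hb ⊢
      rw [Finset.sum_comm, map_mul, ← hb, Finset.mul_sum]
      refine Finset.sum_congr rfl fun d _ => ?_
      rw [← mul_assoc, Algebra.commutes, ← ha, Finset.mul_sum, Finset.sum_mul]
      exact Finset.sum_congr rfl fun c _ => by simp only [mul_assoc]
    | add a b ha hb => simp only [map_add, ha, hb]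
  mul_antipode_lTensor_comul := by
    ext a
    simp only [LinearMap.comp_apply]
    induction a using QuantumDouble.induction with
    | algebraMap r =>
      rw [Bialgebra.comul_algebraMap, Algebra.TensorProduct.algebraMap_apply]
      simp [show antipodeLin K H 1 = 1 by simp [antipodeLin]]
    | incl x =>
      rw [comul_incl, counit_incl, ← (ℛ K x).eq]
      simp only [map_sum, TensorProduct.map_tmul, AlgHom.toLinearMap_apply,
        LinearMap.lTensor_tmul, LinearMap.mul'_apply, antipodeLin_incl]
      simp only [← map_mul, ← map_sum]
      rw [HopfAlgebra.sum_mul_antipode_eq_algebraMap_counit]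
      simp
    | inclDual f =>
      rw [comul_inclDualₗ, counit_inclDualₗ, ← (ℛ K f).eq]
      simp only [map_sum, TensorProduct.map_tmul, LinearMap.lTensor_tmul, LinearMap.mul'_apply,
        antipodeLin_inclDualₗ]
      simp only [← inclDualₗ_mul, ← map_sum]
      rw [dualAntipodeInv_sum_right_left', map_smul, inclDualₗ_one,
        Algebra.linearMap_apply, Algebra.algebraMap_eq_smul_one]
    | mul a b ha hb =>
      rw [Bialgebra.comul_mul, Bialgebra.counit_mul]
      rw [← (ℛ K a).eq] at ha ⊢
      rw [← (ℛ K b).eq] at hb ⊢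
      rw [Finset.sum_mul_sum]
      simp only [map_sum, LinearMap.lTensor_tmul, LinearMap.mul'_apply,
        Algebra.TensorProduct.tmul_mul_tmul, antipodeLin_mul, Algebra.linearMap_apply] at ha hb ⊢
      rw [map_mul, ← ha, Finset.sum_mul]
      refine Finset.sum_congr rfl fun c _ => ?_
      rw [mul_assoc, ← Algebra.commutes, ← hb, Finset.sum_mul, Finset.mul_sum]
      exact Finset.sum_congr rfl fun d _ => by simp only [mul_assoc]
    | add a b ha hb => simp only [map_add, ha, hb]

end Hopf

end QuantumDouble

end QuantumDouble

section DualQuasitriangular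

open WithConv

variable (K : Type u) [Field K]

/-- A bialgebra `A` with a linear form `ϱ : A ⊗ A → K` is dual quasitriangular (coquasitriangular),
with dual universal R-matrix `ϱ`, if `ϱ` is invertible in the convolution algebra `(A ⊗ A)^*` and
* `ϱ(ab, c) = ϱ(a, c₍₁₎) ϱ(b, c₍₂₎)`,
* `ϱ(a, bc) = ϱ(a₍₁₎, c) ϱ(a₍₂₎, b)`,
* `ϱ(a₍₁₎, b₍₁₎) a₍₂₎ b₍₂₎ = b₍₁₎ a₍₁₎ ϱ(a₍₂₎, b₍₂₎)`. -/
structure IsDualQuasitriangular (A : Type w) [Ring A] [Bialgebra K A] (ϱ : A ⊗[K] A →ₗ[K] K) :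
    Prop where
  isUnit : IsUnit (toConv ϱ)
  mul_left (a b c : A) : ϱ ((a * b) ⊗ₜ c) =
    ∑ i ∈ (ℛ K c).index, ϱ (a ⊗ₜ (ℛ K c).left i) * ϱ (b ⊗ₜ (ℛ K c).right i)
  mul_right (a b c : A) : ϱ (a ⊗ₜ (b * c)) =
    ∑ i ∈ (ℛ K a).index, ϱ ((ℛ K a).left i ⊗ₜ c) * ϱ ((ℛ K a).right i ⊗ₜ b)
  comm (a b : A) :
    ∑ i ∈ (ℛ K a).index, ∑ j ∈ (ℛ K b).index,
      ϱ ((ℛ K a).left i ⊗ₜ (ℛ K b).left j) • ((ℛ K a).right i * (ℛ K b).right j) =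
    ∑ i ∈ (ℛ K a).index, ∑ j ∈ (ℛ K b).index,
      ϱ ((ℛ K a).right i ⊗ₜ (ℛ K b).right j) • ((ℛ K b).left j * (ℛ K a).left i)

section Legs

variable {K} {A : Type w} [Ring A] [Bialgebra K A] (ϱ : A ⊗[K] A →ₗ[K] K)

/-- `ϱ₁₂ : a ⊗ b ⊗ c ↦ ϱ(a, b) ε(c)` in the convolution algebra `(A^{⊗3})^*`. -/
def leg12 : WithConv (A ⊗[K] (A ⊗[K] A) →ₗ[K] K) :=
  toConv (LinearMap.mul' K K ∘ₗ TensorProduct.map ϱ counit ∘ₗ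
    (TensorProduct.assoc K A A A).symm.toLinearMap)

/-- `ϱ₁₃ : a ⊗ b ⊗ c ↦ ϱ(a, c) ε(b)`. -/
def leg13 : WithConv (A ⊗[K] (A ⊗[K] A) →ₗ[K] K) :=
  toConv (LinearMap.mul' K K ∘ₗ TensorProduct.map counit ϱ ∘ₗ
    (TensorProduct.leftComm K A A A).toLinearMap)

/-- `ϱ₂₃ : a ⊗ b ⊗ c ↦ ϱ(b, c) ε(a)`. -/
def leg23 : WithConv (A ⊗[K] (A ⊗[K] A) →ₗ[K] K) :=
  toConv (LinearMap.mul' K K ∘ₗ TensorProduct.map counit ϱ)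

end Legs

/-- The linear form `ϱ(x ⊗ y) = ⟨x, j(ι^o(y))⟩` on `D(H)^o ⊗ D(H)^o`. -/
def dualRMatrix (H : Type v) [Ring H] [HopfAlgebra K H] :
    RestrictedDual K (QuantumDouble K H) ⊗[K] RestrictedDual K (QuantumDouble K H) →ₗ[K] K :=
  TensorProduct.lift ((RestrictedDual.toDual K (QuantumDouble K H)).compl₂
    (QuantumDouble.inclDualₗ K H ∘ₗ RestrictedDual.comap (QuantumDouble.incl K H)))

/-- A right comodule structure `v ↦ v₍₀₎ ⊗ v₍₁₎` on `V` over a coalgebra `C`. -/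
structure RightComodule (C : Type w) [AddCommGroup C] [Module K C] [Coalgebra K C]
    (V : Type*) [AddCommGroup V] [Module K V] where
  /-- The coaction. -/
  coact : V →ₗ[K] V ⊗[K] C
  coassoc : (TensorProduct.assoc K V C C).toLinearMap ∘ₗ coact.rTensor C ∘ₗ coact =
    comul.lTensor V ∘ₗ coact
  lTensor_counit : counit.lTensor V ∘ₗ coact = (TensorProduct.mk K V K).flip 1

variable {K}

/-- The linear map `u ⊗ v ↦ v₍₀₎ ⊗ u₍₀₎ ϱ(u₍₁₎ ⊗ v₍₁₎)` on `V ⊗ V`. -/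
def RightComodule.rMatrix {C : Type w} [AddCommGroup C] [Module K C] [Coalgebra K C]
    {V : Type*} [AddCommGroup V] [Module K V] (δ : RightComodule K C V)
    (ϱ : C ⊗[K] C →ₗ[K] K) : V ⊗[K] V →ₗ[K] V ⊗[K] V :=
  (TensorProduct.rid K (V ⊗[K] V)).toLinearMap ∘ₗ
    TensorProduct.map (TensorProduct.comm K V V).toLinearMap ϱ ∘ₗ
    (TensorProduct.tensorTensorTensorComm K V C V C).toLinearMap ∘ₗ
    TensorProduct.map δ.coact δ.coact

end DualQuasitriangular

section Tangles

/-- The direction of a strand at a horizontal level. -/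
inductive Strand
  | up
  | down

open Strand

/-- The sign of the vertical component of the direction. -/
def Strand.sign : Strand → ℤ
  | up => 1
  | down => -1

/-- A horizontal slice of an oriented tangle diagram in generic position containing exactly one
local extremum or crossing. It is indexed by the directions of the strands at its bottom and at its
top, read from left to right. The last argument of the first five constructors lists the vertical
strands to the right, and `skip` adds a vertical strand on the left.

* `capL`, `capR` : a local maximum traversed from right to left, from left to right;
* `cupL`, `cupR` : a local minimum traversed from right to left, from left to right;
* `cross o s t` : a crossing, where the strand from the bottom left to the top right has direction
  `s`, the strand from the bottom right to the top left has direction `t`, and the former passes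
  over the latter if and only if `o = true`. -/
inductive Layer : List Strand → List Strand → Type
  | capL (r : List Strand) : Layer (down :: up :: r) r
  | capR (r : List Strand) : Layer (up :: down :: r) r
  | cupL (r : List Strand) : Layer r (up :: down :: r)
  | cupR (r : List Strand) : Layer r (down :: up :: r)
  | cross (o : Bool) (s t : Strand) (r : List Strand) : Layer (s :: t :: r) (t :: s :: r)
  | skip (s : Strand) {a b : List Strand} (L : Layer a b) : Layer (s :: a) (s :: b)

/-- An oriented tangle diagram in generic position: a finite sequence of slices, from bottom to
top. -/
inductive Diagram : List Strand → List Strand → Type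
  | nil (a : List Strand) : Diagram a a
  | cons {a b c : List Strand} (L : Layer a b) (D : Diagram b c) : Diagram a c

namespace Layer

/-- Adding vertical strands on the left. -/
def whiskerLeft : (l : List Strand) → {a b : List Strand} → Layer a b → Layer (l ++ a) (l ++ b)
  | [], _, _, L => L
  | s :: l, _, _, L => skip s (whiskerLeft l L)

/-- Adding vertical strands on the right. -/
def whiskerRight : {a b : List Strand} → Layer a b → (t : List Strand) → Layer (a ++ t) (b ++ t)
  | _, _, capL r, t => capL (r ++ t)
  | _, _, capR r, t => capR (r ++ t)
  | _, _, cupL r, t => cupL (r ++ t)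
  | _, _, cupR r, t => cupR (r ++ t)
  | _, _, cross o s s' r, t => cross o s s' (r ++ t)
  | _, _, skip s L, t => skip s (whiskerRight L t)

/-- The sign of the crossing in a slice (`0` if there is none). A crossing is positive if the
ordered pair (overpass, underpass) of tangent vectors is positively oriented. -/
def writhe : {a b : List Strand} → Layer a b → ℤ
  | _, _, cross true s t _ => s.sign * t.sign
  | _, _, cross false s t _ => -(s.sign * t.sign)
  | _, _, skip _ L => writhe L
  | _, _, _ => 0

/-- The arcs of a slice between the heights `h` and `h + 1`, as pairs of endpoints. The point `(h, i)`
is the `i`-th intersection point, from left to right, of the diagram with the level `h`. -/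
def arcs (h : ℕ) : {a b : List Strand} → Layer a b → List ((ℕ × ℕ) × (ℕ × ℕ))
  | _, _, capL r => ((h, 0), (h, 1)) ::
      (List.range r.length).map fun i => ((h, i + 2), (h + 1, i))
  | _, _, capR r => ((h, 0), (h, 1)) ::
      (List.range r.length).map fun i => ((h, i + 2), (h + 1, i))
  | _, _, cupL r => ((h + 1, 0), (h + 1, 1)) ::
      (List.range r.length).map fun i => ((h, i), (h + 1, i + 2))
  | _, _, cupR r => ((h + 1, 0), (h + 1, 1)) ::
      (List.range r.length).map fun i => ((h, i), (h + 1, i + 2))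
  | _, _, cross _ _ _ r => ((h, 0), (h + 1, 1)) :: ((h, 1), (h + 1, 0)) ::
      (List.range r.length).map fun i => ((h, i + 2), (h + 1, i + 2))
  | _, _, skip _ L => ((h, 0), (h + 1, 0)) ::
      (arcs h L).map fun e => ((e.1.1, e.1.2 + 1), (e.2.1, e.2.2 + 1))

end Layer

namespace Diagram

/-- Stacking of diagrams: `D.comp E` is `D` with `E` on top of it. -/
def comp : {a b c : List Strand} → Diagram a b → Diagram b c → Diagram a c
  | _, _, _, nil _, E => E
  | _, _, _, cons L D, E => cons L (comp D E)

/-- Adding vertical strands on the left. -/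
def whiskerLeft (l : List Strand) :
    {a b : List Strand} → Diagram a b → Diagram (l ++ a) (l ++ b)
  | _, _, nil a => nil (l ++ a)
  | _, _, cons L D => cons (L.whiskerLeft l) (whiskerLeft l D)

/-- A diagram with one slice. -/
def one {a b : List Strand} (L : Layer a b) : Diagram a b := cons L (nil b)

/-- A diagram with two slices. -/
def two {a b c : List Strand} (L : Layer a b) (M : Layer b c) : Diagram a c := cons L (one M)

/-- A diagram with three slices. -/
def three {a b c d : List Strand} (L : Layer a b) (M : Layer b c) (N : Layer c d) : Diagram a d :=
  cons L (two M N)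

/-- The writhe. -/
def writhe : {a b : List Strand} → Diagram a b → ℤ
  | _, _, nil _ => 0
  | _, _, cons L D => L.writhe + writhe D

/-- The arcs of a diagram whose bottom is at height `h`. -/
def arcs (h : ℕ) : {a b : List Strand} → Diagram a b → List ((ℕ × ℕ) × (ℕ × ℕ))
  | _, _, nil _ => []
  | _, _, cons L D => L.arcs h ++ arcs (h + 1) D

/-- A diagram with one strand at the bottom and one at the top has no closed components: each arc
is connected to the bottom endpoint. -/
def IsConnected (D : Diagram [up] [up]) : Prop :=
  ∀ e ∈ D.arcs 0, Relation.EqvGen (fun p q => (p, q) ∈ D.arcs 0) (0, 0) e.1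

end Diagram

open Layer Diagram

/-- The normalization of a slice: the local extrema oriented from left to right are replaced. -/
def Layer.normalize : {a b : List Strand} → Layer a b → Diagram a b
  | _, _, capR r => two (cross true up down r) (capL r)
  | _, _, cupR r => two (cupL r) (cross false up down r)
  | _, _, capL r => one (capL r)
  | _, _, cupL r => one (cupL r)
  | _, _, cross o s t r => one (cross o s t r)
  | _, _, skip s L => (normalize L).whiskerLeft [s]

/-- The normalization `Ḋ` of a diagram `D`, which has no local extrema oriented from left to
right. -/
def Diagram.normalize : {a b : List Strand} → Diagram a b → Diagram a b
  | _, _, .nil a => .nil a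
  | _, _, .cons L D => L.normalize.comp (Diagram.normalize D)

/-- The normal long knot diagram `ξ⁺`, of writhe `2`. -/
def xiPos : Diagram [up] [up] :=
  .cons (skip up (cupL [])) (.cons (skip up (cross false up down []))
    (.cons (cross false up down [up]) (.cons (capL [up]) (.nil [up]))))

/-- The normal long knot diagram `ξ⁻`, of writhe `-2`. -/
def xiNeg : Diagram [up] [up] :=
  .cons (skip up (cupL [])) (.cons (skip up (cross true up down []))
    (.cons (cross true up down [up]) (.cons (capL [up]) (.nil [up]))))

/-- Iterated composition. -/
def Diagram.iterate (D : Diagram [up] [up]) : ℕ → Diagram [up] [up]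
  | 0 => .nil [up]
  | n + 1 => D.comp (Diagram.iterate D n)

/-- The diagram `ξⁿ`, of writhe `2n`. -/
def xi : ℤ → Diagram [up] [up]
  | Int.ofNat n => xiPos.iterate n
  | Int.negSucc n => xiNeg.iterate (n + 1)

/-- The local moves. The first five kinds generate the planar isotopies between diagrams in generic
position: exchange of the heights of distant pieces, straightening of zigzags, and passage of a strand
through a local extremum. The remaining ones are the oriented Reidemeister moves. -/
inductive Move : {a b : List Strand} → Diagram a b → Diagram a b → Prop
  | interchange {a b c d : List Strand} (f : Layer a b) (g : Layer c d) :
      Move (two (f.whiskerRight c) (g.whiskerLeft b)) (two (g.whiskerLeft a) (f.whiskerRight d))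
  | zigzagUpR (r : List Strand) : Move (two (skip up (cupR r)) (capR (up :: r))) (nil (up :: r))
  | zigzagUpL (r : List Strand) : Move (two (cupL (up :: r)) (skip up (capL r))) (nil (up :: r))
  | zigzagDownR (r : List Strand) :
      Move (two (skip down (cupL r)) (capL (down :: r))) (nil (down :: r))
  | zigzagDownL (r : List Strand) :
      Move (two (cupR (down :: r)) (skip down (capR r))) (nil (down :: r))
  | slideCapL (o : Bool) (s : Strand) (r : List Strand) :
      Move (two (cross o down s (up :: r)) (skip s (capL r)))
        (two (skip down (cross (!o) s up r)) (capL (s :: r)))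
  | slideCapR (o : Bool) (s : Strand) (r : List Strand) :
      Move (two (cross o up s (down :: r)) (skip s (capR r)))
        (two (skip up (cross (!o) s down r)) (capR (s :: r)))
  | slideCupL (o : Bool) (s : Strand) (r : List Strand) :
      Move (two (skip s (cupL r)) (cross o s up (down :: r)))
        (two (cupL (s :: r)) (skip up (cross (!o) down s r)))
  | slideCupR (o : Bool) (s : Strand) (r : List Strand) :
      Move (two (skip s (cupR r)) (cross o s down (up :: r)))
        (two (cupR (s :: r)) (skip down (cross (!o) up s r)))
  | reidOneCapR (o : Bool) (r : List Strand) :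
      Move (two (cross o up down r) (capL r)) (one (capR r))
  | reidOneCapL (o : Bool) (r : List Strand) :
      Move (two (cross o down up r) (capR r)) (one (capL r))
  | reidOneCupR (o : Bool) (r : List Strand) :
      Move (two (cupL r) (cross o up down r)) (one (cupR r))
  | reidOneCupL (o : Bool) (r : List Strand) :
      Move (two (cupR r) (cross o down up r)) (one (cupL r))
  | reidTwo (o : Bool) (s t : Strand) (r : List Strand) :
      Move (two (cross o s t r) (cross (!o) t s r)) (nil (s :: t :: r))
  /-- Here `o₁₂`, `o₁₃`, `o₂₃` tell whether the first of the two strands passes over the second one;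
  the hypothesis says that the three strands can be ordered by height. -/
  | reidThree (o₁₂ o₁₃ o₂₃ : Bool) (h : o₁₂ = o₂₃ → o₁₃ = o₁₂) (s₁ s₂ s₃ : Strand)
      (r : List Strand) :
      Move (three (cross o₁₂ s₁ s₂ (s₃ :: r)) (skip s₂ (cross o₁₃ s₁ s₃ r))
          (cross o₂₃ s₂ s₃ (s₁ :: r)))
        (three (skip s₁ (cross o₂₃ s₂ s₃ r)) (cross o₁₃ s₁ s₃ (s₂ :: r))
          (skip s₃ (cross o₁₂ s₁ s₂ r)))

/-- Two diagrams differ by a local move inside a larger diagram. -/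
inductive Step {a b : List Strand} : Diagram a b → Diagram a b → Prop
  | mk {c d : List Strand} (l : List Strand) (P : Diagram a (l ++ c)) {X Y : Diagram c d}
      (m : Move X Y) (Q : Diagram (l ++ d) b) :
      Step (P.comp ((X.whiskerLeft l).comp Q)) (P.comp ((Y.whiskerLeft l).comp Q))

/-- Long knot diagrams in generic position: one-component `(1,1)`-tangle diagrams directed upwards
at both ends. -/
def LongKnotDiagram : Type := {D : Diagram [up] [up] // D.IsConnected}

/-- A long knot: a Reidemeister equivalence class of long knot diagrams, that is a class for the
equivalence relation generated by planar isotopies and Reidemeister moves. -/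
def LongKnot : Type := Quot fun D E : LongKnotDiagram => Step D.1 E.1

/-- The long knot represented by a diagram. -/
def LongKnotDiagram.toLongKnot (D : LongKnotDiagram) : LongKnot := Quot.mk _ D

end Tangles

section RT

open CategoryTheory MonoidalCategory

variable {C : Type w} [Category.{v} C] [MonoidalCategory C] {G : C} (F : C) [ExactPairing G F]

/-- For an adjunction `(F, G, ε, η)` and `f : X ⊗ G ⟶ G ⊗ Y` the morphism
`(ε ⊗ id) ∘ (id ⊗ f ⊗ id) ∘ (id ⊗ η) : F ⊗ X ⟶ Y ⊗ F`. For `X = Y = G` and `f = r^{±1}` this is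
the morphism `r^{±1}` with one tilde, and applying it once more (`X = Y = F`) gives two tildes. -/
def rotate {X Y : C} (f : X ⊗ G ⟶ G ⊗ Y) : F ⊗ X ⟶ Y ⊗ F :=
  (ρ_ (F ⊗ X)).inv ≫ (F ⊗ X) ◁ ExactPairing.coevaluation G F ⊗≫ F ◁ f ▷ F ⊗≫
    ExactPairing.evaluation G F ▷ (Y ⊗ F) ≫ (λ_ (Y ⊗ F)).hom

/-- A rigid R-matrix over `G` with respect to an adjunction `(F, G, ε, η)`: an automorphism of
`G ⊗ G` satisfying the Yang–Baxter relation such that the morphisms `rotate F r` and `rotate F r⁻¹`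
are invertible. -/
structure IsRigidRMatrix (r : G ⊗ G ⟶ G ⊗ G) : Prop where
  isIso : IsIso r
  yangBaxter :
    r ▷ G ≫ (α_ G G G).hom ≫ G ◁ r ≫ (α_ G G G).inv ≫ r ▷ G ≫ (α_ G G G).hom =
      (α_ G G G).hom ≫ G ◁ r ≫ (α_ G G G).inv ≫ r ▷ G ≫ (α_ G G G).hom ≫ G ◁ r
  isIso_rotate : IsIso (rotate F r)
  isIso_rotate_inv : IsIso (rotate F (inv r))

open Strand

/-- The object associated to a strand: `G` if directed upwards, and `F` if directed downwards. -/
def strandObj (G F : C) : Strand → C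
  | up => G
  | down => F

/-- The tensor product of the objects associated to a sequence of strands. -/
def tensorObjs (G F : C) : List Strand → C
  | [] => 𝟙_ C
  | s :: a => strandObj G F s ⊗ tensorObjs G F a

section

variable {F} {r : G ⊗ G ⟶ G ⊗ G} (h : IsRigidRMatrix F r)

/-- The inverse of `r`. -/
def rInv : G ⊗ G ⟶ G ⊗ G :=
  haveI := h.isIso
  inv r

/-- The inverse of `rotate F r`. -/
def rotateInv : G ⊗ F ⟶ F ⊗ G :=
  haveI := h.isIso_rotate
  inv (rotate F r)

/-- The inverse of `rotate F r⁻¹`. -/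
def rotateRInvInv : G ⊗ F ⟶ F ⊗ G :=
  haveI := h.isIso
  haveI := h.isIso_rotate_inv
  inv (rotate F (inv r))

/-- The morphisms associated to the eight types of crossings. -/
def crossingMap : (o : Bool) → (s t : Strand) →
    (strandObj G F s ⊗ strandObj G F t ⟶ strandObj G F t ⊗ strandObj G F s)
  | true, up, up => r
  | false, up, up => rInv (G := G) (F := F) h
  | false, down, up => rotate (G := G) (X := G) (Y := G) F r
  | true, down, up => rotate (G := G) (X := G) (Y := G) F (rInv h)
  | true, down, down => rotate (G := G) (X := F) (Y := F) F (rotate (G := G) (X := G) (Y := G) F r)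
  | false, down, down =>
    rotate (G := G) (X := F) (Y := F) F (rotate (G := G) (X := G) (Y := G) F (rInv h))
  | false, up, down => rotateRInvInv (G := G) (F := F) h
  | true, up, down => rotateInv (G := G) (F := F) h

/-- The morphism associated to a slice. Only normal slices are used below;
those which are not normal (`capR` and `cupR`) are evaluated through their normalization. -/
def layerMap : {a b : List Strand} → Layer a b → (tensorObjs G F a ⟶ tensorObjs G F b)
  | _, _, .capL a => (α_ F G (tensorObjs G F a)).inv ≫
      ExactPairing.evaluation G F ▷ tensorObjs G F a ≫ (λ_ (tensorObjs G F a)).hom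
  | _, _, .cupL a => (λ_ (tensorObjs G F a)).inv ≫
      ExactPairing.coevaluation G F ▷ tensorObjs G F a ≫ (α_ G F (tensorObjs G F a)).hom
  | _, _, .cross o s t a => (α_ (strandObj G F s) (strandObj G F t) (tensorObjs G F a)).inv ≫
      crossingMap h o s t ▷ tensorObjs G F a ≫
      (α_ (strandObj G F t) (strandObj G F s) (tensorObjs G F a)).hom
  | _, _, .skip s L => strandObj G F s ◁ layerMap L
  | _, _, .capR a => (α_ G F (tensorObjs G F a)).inv ≫
      (crossingMap h true up down ≫ ExactPairing.evaluation G F) ▷ tensorObjs G F a ≫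
      (λ_ (tensorObjs G F a)).hom
  | _, _, .cupR a => (λ_ (tensorObjs G F a)).inv ≫
      (ExactPairing.coevaluation G F ≫ crossingMap h false up down) ▷ tensorObjs G F a ≫
      (α_ F G (tensorObjs G F a)).hom

/-- The Reshetikhin–Turaev functor on (normal) diagrams: the composition, from bottom to top, of
the morphisms associated to the slices. -/
def diagramMap : {a b : List Strand} → Diagram a b → (tensorObjs G F a ⟶ tensorObjs G F b)
  | _, _, .nil a => 𝟙 (tensorObjs G F a)
  | _, _, .cons L D => layerMap h L ≫ diagramMap D

/-- The Reshetikhin–Turaev functor `RT_r` on `(1,1)`-tangle diagrams, with values in `End(G)`. -/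
def RT (D : Diagram [up] [up]) : G ⟶ G :=
  (ρ_ G).inv ≫ diagramMap h D ≫ (ρ_ G).hom

/-- The invariant `J_r(D) = RT_r(Ḋ ∘ ξ^{-w(Ḋ)/2})` (the writhe of a normal long knot diagram is
even). -/
def invariantJ (D : LongKnotDiagram) : G ⟶ G :=
  RT h ((xi (-(D.1.normalize.writhe / 2))).comp D.1.normalize)

end

end RT

section Comodules

open CategoryTheory MonoidalCategory

/-- The R-matrix of a finite-dimensional comodule as a morphism of the monoidal category of
finite-dimensional vector spaces. -/
def RightComodule.rMatrixHom {K : Type u} [Field K] {C : Type w} [AddCommGroup C] [Module K C]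
    [Coalgebra K C] {V : Type u} [AddCommGroup V] [Module K V] [FiniteDimensional K V]
    (δ : RightComodule K C V) (ϱ : C ⊗[K] C →ₗ[K] K) :
    FGModuleCat.of K V ⊗ FGModuleCat.of K V ⟶ FGModuleCat.of K V ⊗ FGModuleCat.of K V :=
  ObjectProperty.homMk (ModuleCat.ofHom (δ.rMatrix ϱ))

end Comodules

end LongKnotInvariant

end

open LongKnotInvariant

attribute [reducible] LongKnotInvariant.strandObj LongKnotInvariant.tensorObjs

noncomputable section

namespace LongKnotInvariant

open CategoryTheory MonoidalCategory BraidedCategory Strand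

universe v₁ u₁

/-! ### Rotating the braiding: it is a rigid R-matrix. -/

section Rotate

variable {B : Type u₁} [Category.{v₁} B] [MonoidalCategory B] [BraidedCategory B]
  {G : B} (F : B) [ExactPairing G F]

/-! Finite-dimensional right comodules over a dual quasitriangular Hopf algebra form a braided
monoidal category in which every linear duality lifts to comodules, and `r_V` is the braiding of `V`
with itself. So only the quasitriangularity of D(H)^o concerns the double; the rest is proved for
arbitrary braided categories, or for an arbitrary pair (C, ϱ).

Quasitriangularity. Put J = j ∘ ι^o, so that ϱ(x ⊗ y) = ⟨x, J(y)⟩. As J preserves coproducts and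
reverses products, ϱ is multiplicative in each variable, and composing the first variable with the
antipode inverts it. Evaluated at z in D(H), the commutation axiom says that J intertwines b ↦
z₍₁₎⟨b, z₍₂₎⟩ and b ↦ ⟨b, z₍₁₎⟩z₍₂₎ under convolution (`dualToDouble_mul_rightAct`). Both maps are
multiplicative in z, so it is enough to take z in H or in H^o, where the claim is the cross relation
of the double. The Yang–Baxter relation is the commutation axiom paired with a third element.

Rigidity. Rotating a braiding gives an inverse braiding with the dual object, hence an isomorphism
(`isRigidRMatrix_braiding`). Consequently all eight kinds of crossings are braidings or inverse
braidings (`crossingMap_braiding`).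

Invariance. All moves except Reidemeister I preserve the value by the axioms of a braided category.
A move of type I either preserves it or inserts a curl, and a curl comes with a change of the
normalized writhe by ±2 (`Move.effect`); the power of ξ compensates for this once the curl is at the
bottom. To bring it there it is treated as a bead: an endomorphism of `G` on upward strands, its
mate on downward ones. Beads slide along arcs, so in a diagram with a single component they all
reach the bottom (`beaded_eq_bottom`). This gives `invariantJ_step`.

Universality. Beads also show that the value of a long knot diagram commutes with End(G), and, with
an idempotent at every point, that it is compatible with direct summands (`comp_RT_of_retract`). The
two facts applied to X ⊕ Y give naturality in all comodule maps (`knotHom_naturality`). A natural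
endomorphism of the forgetful functor on finite-dimensional comodules is the action of a unique
functional on C: every c is a coefficient ⟨f, v₍₀₎⟩v₍₁₎ (`exists_coeffMap_eq`), and Z(c) = ⟨f, J(v)⟩
depends only on c (`knotMap_congr`). -/

theorem rotate_braiding (X : B) : rotate F (β_ X G).hom = (β_ X F).inv := by
  -- After composing with β_{X,F} the hexagon merges both crossings into one of `X` with `G ⊗ F`.
  -- The coevaluation slides through it, leaving the trivial crossing with the unit and a zigzag.
  rw [← cancel_mono (β_ X F).hom, Iso.inv_hom_id]
  calc rotate F (β_ X G).hom ≫ (β_ X F).hom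
      = 𝟙 _ ⊗≫ F ◁ (X ◁ η_ G F ⊗≫ (β_ X G).hom ▷ F) ⊗≫
          (ε_ G F ▷ (X ⊗ F) ≫ 𝟙_ B ◁ (β_ X F).hom) ⊗≫ 𝟙 _ := by
        dsimp only [rotate]; monoidal
    _ = 𝟙 _ ⊗≫ F ◁ (X ◁ η_ G F ≫ (β_ X (G ⊗ F)).hom) ⊗≫ ε_ G F ▷ (F ⊗ X) ⊗≫ 𝟙 _ := by
        rw [← whisker_exchange, braiding_tensor_right_hom]; monoidal
    _ = 𝟙 _ ⊗≫ (F ◁ η_ G F ⊗≫ ε_ G F ▷ F) ▷ X ⊗≫ 𝟙 _ := by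
        rw [braiding_naturality_right, braiding_tensorUnit_right]; monoidal
    _ = 𝟙 (F ⊗ X) := by
        rw [ExactPairing.coevaluation_evaluation'']; monoidal

/-- Mirror image of `rotate_braiding`. Together they show that a second rotation returns to a
braiding, which settles crossings of two downward strands. -/
theorem rotate_braiding_inv (X : B) : rotate F (β_ G X).inv = (β_ F X).hom := by
  rw [← cancel_mono (β_ F X).inv, Iso.hom_inv_id]
  calc rotate F (β_ G X).inv ≫ (β_ F X).inv
      = 𝟙 _ ⊗≫ F ◁ (X ◁ η_ G F ⊗≫ (β_ G X).inv ▷ F) ⊗≫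
          (ε_ G F ▷ (X ⊗ F) ≫ 𝟙_ B ◁ (β_ F X).inv) ⊗≫ 𝟙 _ := by
        dsimp only [rotate]; monoidal
    _ = 𝟙 _ ⊗≫ F ◁ (X ◁ η_ G F ≫ (β_ (G ⊗ F) X).inv) ⊗≫ ε_ G F ▷ (F ⊗ X) ⊗≫ 𝟙 _ := by
        rw [← whisker_exchange, braiding_tensor_left_inv]; monoidal
    _ = 𝟙 _ ⊗≫ (F ◁ η_ G F ⊗≫ ε_ G F ▷ F) ▷ X ⊗≫ 𝟙 _ := by
        rw [braiding_inv_naturality_right, braiding_inv_tensorUnit_left]; monoidal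
    _ = 𝟙 (F ⊗ X) := by
        rw [ExactPairing.coevaluation_evaluation'']; monoidal

theorem rotate_inv_braiding (X : B) : rotate F (inv (β_ G X).hom) = (β_ F X).hom := by
  rw [IsIso.Iso.inv_hom, rotate_braiding_inv]

/-- The braiding of `G ⊗ G` is a rigid R-matrix. -/
theorem isRigidRMatrix_braiding : IsRigidRMatrix F (β_ G G).hom where
  isIso := inferInstance
  yangBaxter := by
    rw [← cancel_epi (α_ G G G).inv, yang_baxter, Iso.inv_hom_id_assoc]
  isIso_rotate := by rw [rotate_braiding]; infer_instance
  isIso_rotate_inv := by rw [rotate_inv_braiding]; infer_instance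

variable {F}

/-- The crossings of strands `s` and `t` are given by the braiding and its inverse. -/
theorem crossingMap_braiding (h : IsRigidRMatrix F (β_ G G).hom) (o : Bool) (s t : Strand) :
    crossingMap h o s t = bif o then (β_ (strandObj G F s) (strandObj G F t)).hom else
      (β_ (strandObj G F t) (strandObj G F s)).inv := by
  cases o <;> cases s <;> cases t
  · simp [crossingMap, rInv, strandObj]
  · simp [crossingMap, rotateRInvInv, strandObj, rotate_braiding_inv]
  · simp [crossingMap, strandObj, rotate_braiding]
  · simp only [crossingMap, strandObj, rInv, rotate_inv_braiding, rotate_braiding]; rfl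
  · rfl
  · simp [crossingMap, rotateInv, strandObj, rotate_braiding]
  · simp [crossingMap, strandObj, rInv, rotate_braiding_inv]
  · simp only [crossingMap, strandObj, rotate_braiding, rotate_braiding_inv]; rfl

end Rotate

end LongKnotInvariant

end

noncomputable section

namespace LongKnotInvariant

open CategoryTheory MonoidalCategory BraidedCategory Strand

universe v₁ u₁

/-! ### Crossings of either sign, twisted extrema and curls. -/

section Crossing

variable {B : Type u₁} [Category.{v₁} B] [MonoidalCategory B] [BraidedCategory B]

/-- The braiding if `o = true` and the inverse braiding if `o = false`. -/
def crossing (o : Bool) (X Y : B) : X ⊗ Y ⟶ Y ⊗ X :=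
  bif o then (β_ X Y).hom else (β_ Y X).inv

@[simp]
theorem crossing_comp_crossing (o : Bool) (X Y : B) :
    crossing o X Y ≫ crossing (!o) Y X = 𝟙 (X ⊗ Y) := by
  cases o <;> simp [crossing]

@[simp]
theorem crossing_not_comp_crossing (o : Bool) (X Y : B) :
    crossing (!o) X Y ≫ crossing o Y X = 𝟙 (X ⊗ Y) := by
  cases o <;> simp [crossing]

theorem crossing_naturality_left (o : Bool) {X X' : B} (f : X ⟶ X') (Y : B) :
    f ▷ Y ≫ crossing o X' Y = crossing o X Y ≫ Y ◁ f := by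
  cases o <;> simp [crossing]

theorem crossing_naturality_right (o : Bool) (X : B) {Y Y' : B} (f : Y ⟶ Y') :
    X ◁ f ≫ crossing o X Y' = crossing o X Y ≫ f ▷ X := by
  cases o <;> simp [crossing]

theorem crossing_tensor_left (o : Bool) (X Y Z : B) :
    crossing o (X ⊗ Y) Z = (α_ X Y Z).hom ≫ X ◁ crossing o Y Z ≫ (α_ X Z Y).inv ≫
      crossing o X Z ▷ Y ≫ (α_ Z X Y).hom := by
  cases o <;> simp [crossing]

theorem crossing_tensor_right (o : Bool) (X Y Z : B) :
    crossing o X (Y ⊗ Z) = (α_ X Y Z).inv ≫ crossing o X Y ▷ Z ≫ (α_ Y X Z).hom ≫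
      Y ◁ crossing o X Z ≫ (α_ Y Z X).inv := by
  cases o <;> simp [crossing]

theorem crossing_unit_left (o : Bool) (X : B) :
    crossing o (𝟙_ B) X = (λ_ X).hom ≫ (ρ_ X).inv := by
  cases o <;> simp [crossing]

theorem crossing_unit_right (o : Bool) (X : B) :
    crossing o X (𝟙_ B) = (ρ_ X).hom ≫ (λ_ X).inv := by
  cases o <;> simp [crossing]

/-- The ordering hypothesis forces `o₁₃` to equal `o₂₃` or `o₁₂`. In the first case `Z` lies on one
side of both `X` and `Y`, in the second `X` lies on one side of both `Y` and `Z`. The relation is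
then naturality of the crossings with that strand, applied to the crossing of the other two. -/
theorem crossing_yangBaxter (o₁₂ o₁₃ o₂₃ : Bool) (h : o₁₂ = o₂₃ → o₁₃ = o₁₂) (X Y Z : B) :
    crossing o₁₂ X Y ▷ Z ⊗≫ Y ◁ crossing o₁₃ X Z ⊗≫ crossing o₂₃ Y Z ▷ X =
      𝟙 _ ⊗≫ X ◁ crossing o₂₃ Y Z ⊗≫ crossing o₁₃ X Z ▷ Y ⊗≫ Z ◁ crossing o₁₂ X Y ⊗≫ 𝟙 _ := by
  by_cases h' : o₁₃ = o₂₃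
  · subst h'
    have := crossing_naturality_left o₁₃ (crossing o₁₂ X Y) Z
    rw [crossing_tensor_left, crossing_tensor_left] at this
    calc _ = 𝟙 _ ⊗≫ (crossing o₁₂ X Y ▷ Z ≫ (α_ Y X Z).hom ≫ Y ◁ crossing o₁₃ X Z ≫
          (α_ Y Z X).inv ≫ crossing o₁₃ Y Z ▷ X ≫ (α_ Z Y X).hom) ⊗≫ 𝟙 _ := by monoidal
      _ = _ := by rw [this]; monoidal
  · have h'' : o₁₃ = o₁₂ := by
      cases o₁₂ <;> cases o₁₃ <;> cases o₂₃ <;> simp_all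
    subst h''
    have := crossing_naturality_right o₁₃ X (crossing o₂₃ Y Z)
    rw [crossing_tensor_right, crossing_tensor_right] at this
    calc _ = 𝟙 _ ⊗≫ (((α_ X Y Z).inv ≫ crossing o₁₃ X Y ▷ Z ≫ (α_ Y X Z).hom ≫
          Y ◁ crossing o₁₃ X Z ≫ (α_ Y Z X).inv) ≫ crossing o₂₃ Y Z ▷ X) ⊗≫ 𝟙 _ := by monoidal
      _ = _ := by rw [← this]; monoidal

/-- Naturality at `e` and the hexagon say that crossing both legs of the maximum is the same as
crossing nothing. Cancelling the crossing with `Q` moves it to the other side with the opposite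
flag. -/
theorem crossing_slide_to_unit (o : Bool) {P Q : B} (e : P ⊗ Q ⟶ 𝟙_ B) (S : B) :
    crossing o P S ▷ Q ⊗≫ S ◁ e =
      𝟙 _ ⊗≫ P ◁ crossing (!o) S Q ⊗≫ e ▷ S ⊗≫ 𝟙 _ := by
  have := crossing_naturality_left o e S
  rw [crossing_tensor_left, crossing_unit_left] at this
  symm
  calc _ = 𝟙 _ ⊗≫ P ◁ crossing (!o) S Q ⊗≫ (e ▷ S ≫ (λ_ S).hom ≫ (ρ_ S).inv) ⊗≫ 𝟙 _ := by
        monoidal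
    _ = 𝟙 _ ⊗≫ P ◁ (crossing (!o) S Q ≫ crossing o Q S) ⊗≫
          crossing o P S ▷ Q ⊗≫ S ◁ e ⊗≫ 𝟙 _ := by
        rw [this]; monoidal
    _ = _ := by rw [crossing_not_comp_crossing]; monoidal

theorem crossing_slide_from_unit (o : Bool) {P Q : B} (n : 𝟙_ B ⟶ P ⊗ Q) (S : B) :
    S ◁ n ⊗≫ crossing o S P ▷ Q =
      𝟙 _ ⊗≫ n ▷ S ⊗≫ P ◁ crossing (!o) Q S ⊗≫ 𝟙 _ := by
  have := crossing_naturality_right o S n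
  rw [crossing_tensor_right, crossing_unit_right] at this
  symm
  calc _ = 𝟙 _ ⊗≫ (((ρ_ S).hom ≫ (λ_ S).inv) ≫ n ▷ S) ⊗≫ P ◁ crossing (!o) Q S ⊗≫ 𝟙 _ := by
        monoidal
    _ = 𝟙 _ ⊗≫ S ◁ n ⊗≫ crossing o S P ▷ Q ⊗≫
          P ◁ (crossing o S Q ≫ crossing (!o) Q S) ⊗≫ 𝟙 _ := by
        rw [← this]; monoidal
    _ = _ := by rw [crossing_comp_crossing]; monoidal

variable (G F : B) [ExactPairing G F]

/-- The maximum oriented from left to right whose ends cross as prescribed by `o`. -/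
def twistedCap (o : Bool) : G ⊗ F ⟶ 𝟙_ B := crossing o G F ≫ ε_ G F

/-- The minimum oriented from left to right whose ends cross as prescribed by `o`. -/
def twistedCup (o : Bool) : 𝟙_ B ⟶ F ⊗ G := η_ G F ≫ crossing o G F

/-- Composing with the braiding exchanges the roles of `G` and `F` in the pairing
(`exactPairing_swap`). The new coevaluation carries the inverse of the crossing in the new
evaluation, hence the opposite flags; the other sign is the same fact for the reverse braiding. -/
theorem twisted_zigzag_left (o : Bool) :
    G ◁ twistedCup G F (!o) ⊗≫ twistedCap G F o ▷ G = ⊗𝟙.hom := by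
  cases o
  · let _ := reverseBraiding B
    exact @ExactPairing.coevaluation_evaluation'' B _ _ F G (exactPairing_swap G F)
  · exact @ExactPairing.coevaluation_evaluation'' B _ _ F G (exactPairing_swap G F)

theorem twisted_zigzag_right (o : Bool) :
    twistedCup G F (!o) ▷ F ⊗≫ F ◁ twistedCap G F o = ⊗𝟙.hom := by
  cases o
  · let _ := reverseBraiding B
    exact @ExactPairing.evaluation_coevaluation'' B _ _ F G (exactPairing_swap G F)
  · exact @ExactPairing.evaluation_coevaluation'' B _ _ F G (exactPairing_swap G F)

/-- The curl with one maximum and one minimum, both of whose crossings are prescribed by `o`. -/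
def curl (o : Bool) : G ⟶ G :=
  𝟙 G ⊗≫ G ◁ twistedCup G F o ⊗≫ twistedCap G F o ▷ G ⊗≫ 𝟙 G

variable {G F}

/-- The minimum inside the curl and the outer maximum have opposite flags, so they form a zigzag;
straightening it leaves the maximum of the curl. Thus a curl is exactly the price for changing the
sign of a twisted maximum. -/
theorem curl_whiskerRight_comp_twistedCap (o : Bool) :
    curl G F o ▷ F ≫ twistedCap G F (!o) = twistedCap G F o := by
  calc _ = 𝟙 _ ⊗≫ G ◁ twistedCup G F o ▷ F ⊗≫
          (twistedCap G F o ▷ (G ⊗ F) ≫ 𝟙_ B ◁ twistedCap G F (!o)) ⊗≫ 𝟙 _ := by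
        dsimp only [curl]; monoidal
    _ = 𝟙 _ ⊗≫ G ◁ (twistedCup G F (!!o) ▷ F ⊗≫ F ◁ twistedCap G F (!o)) ⊗≫
          twistedCap G F o ⊗≫ 𝟙 _ := by
        rw [← whisker_exchange, Bool.not_not]; monoidal
    _ = _ := by rw [twisted_zigzag_right]; monoidal

theorem twistedCup_comp_whiskerLeft_curl (o : Bool) :
    twistedCup G F (!o) ≫ F ◁ curl G F o = twistedCup G F o := by
  calc _ = 𝟙 _ ⊗≫ (twistedCup G F (!o) ▷ 𝟙_ B ≫ (F ⊗ G) ◁ twistedCup G F o) ⊗≫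
          F ◁ twistedCap G F o ▷ G ⊗≫ 𝟙 _ := by
        dsimp only [curl]; monoidal
    _ = 𝟙 _ ⊗≫ twistedCup G F o ⊗≫
          (twistedCup G F (!o) ▷ F ⊗≫ F ◁ twistedCap G F o) ▷ G ⊗≫ 𝟙 _ := by
        rw [← whisker_exchange]; monoidal
    _ = _ := by rw [twisted_zigzag_right]; monoidal

/-- The first curl is absorbed by the maximum of the second one and changes its flag. The remaining
maximum and minimum then have opposite flags and form a zigzag. -/
theorem curl_comp_curl (o : Bool) : curl G F o ≫ curl G F (!o) = 𝟙 G := by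
  calc _ = 𝟙 _ ⊗≫ (curl G F o ▷ 𝟙_ B ≫ G ◁ twistedCup G F (!o)) ⊗≫
          twistedCap G F (!o) ▷ G ⊗≫ 𝟙 _ := by
        rw [curl.eq_1 G F (!o)]; monoidal
    _ = 𝟙 _ ⊗≫ G ◁ twistedCup G F (!o) ⊗≫ (curl G F o ▷ F ≫ twistedCap G F (!o)) ▷ G ⊗≫
          𝟙 _ := by
        rw [← whisker_exchange]; monoidal
    _ = 𝟙 _ ⊗≫ (G ◁ twistedCup G F (!o) ⊗≫ twistedCap G F o ▷ G) ⊗≫ 𝟙 _ := by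
        rw [curl_whiskerRight_comp_twistedCap]; monoidal
    _ = _ := by rw [twisted_zigzag_left]; monoidal

variable (G F) in
/-- The positive curl is invertible, and the negative curl is its inverse. -/
@[simps]
def curlIso : Aut G where
  hom := curl G F false
  inv := curl G F true
  hom_inv_id := curl_comp_curl false
  inv_hom_id := curl_comp_curl true

end Crossing

/-! ### Mates with respect to given exact pairings. -/

section Mate

variable {B : Type u₁} [Category.{v₁} B] [MonoidalCategory B]
  {G F G' F' G'' F'' : B} [ExactPairing G F] [ExactPairing G' F'] [ExactPairing G'' F'']

variable (F F') in
/-- The mate of a morphism with respect to two exact pairings. -/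
def mate (f : G ⟶ G') : F' ⟶ F := @rightAdjointMate B _ _ G G' ⟨F⟩ ⟨F'⟩ f

theorem mate_comp_evaluation (f : G ⟶ G') : mate F F' f ▷ G ≫ ε_ G F = F' ◁ f ≫ ε_ G' F' :=
  @rightAdjointMate_comp_evaluation B _ _ G G' ⟨F⟩ ⟨F'⟩ f

theorem coevaluation_comp_mate (f : G ⟶ G') : η_ G' F' ≫ G' ◁ mate F F' f = η_ G F ≫ f ▷ F :=
  @coevaluation_comp_rightAdjointMate B _ _ G G' ⟨F⟩ ⟨F'⟩ f

theorem mate_id : mate F F (𝟙 G) = 𝟙 F := @rightAdjointMate_id B _ _ G ⟨F⟩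

theorem mate_comp (f : G ⟶ G') (g : G' ⟶ G'') :
    mate F F'' (f ≫ g) = mate F' F'' g ≫ mate F F' f :=
  @comp_rightAdjointMate B _ _ G G' G'' ⟨F⟩ ⟨F'⟩ ⟨F''⟩ f g

end Mate

end LongKnotInvariant

end

noncomputable section

namespace LongKnotInvariant

open CategoryTheory MonoidalCategory BraidedCategory Strand

universe v₁ u₁

/-! ### Maps acting on the two leftmost tensor factors. -/

section TailMaps

variable {B : Type u₁} [Category.{v₁} B] [MonoidalCategory B]

/-- A morphism `P ⊗ Q ⟶ 𝟙` applied to the first two factors. -/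
def capAt {P Q : B} (e : P ⊗ Q ⟶ 𝟙_ B) (Y : B) : P ⊗ Q ⊗ Y ⟶ Y :=
  (α_ P Q Y).inv ≫ e ▷ Y ≫ (λ_ Y).hom

/-- A morphism `𝟙 ⟶ P ⊗ Q` creating two factors. -/
def cupAt {P Q : B} (n : 𝟙_ B ⟶ P ⊗ Q) (Y : B) : Y ⟶ P ⊗ Q ⊗ Y :=
  (λ_ Y).inv ≫ n ▷ Y ≫ (α_ P Q Y).hom

/-- A morphism `P ⊗ Q ⟶ P' ⊗ Q'` applied to the first two factors. -/
def crossAt {P Q P' Q' : B} (c : P ⊗ Q ⟶ P' ⊗ Q') (Y : B) : P ⊗ Q ⊗ Y ⟶ P' ⊗ Q' ⊗ Y :=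
  (α_ P Q Y).inv ≫ c ▷ Y ≫ (α_ P' Q' Y).hom

theorem tensor_comp_capAt {P Q P' Q' Y Y' : B} (f : P ⟶ P') (g : Q ⟶ Q') (y : Y ⟶ Y')
    (e : P' ⊗ Q' ⟶ 𝟙_ B) :
    (f ⊗ₘ g ⊗ₘ y) ≫ capAt e Y' = capAt ((f ⊗ₘ g) ≫ e) Y ≫ y := by
  have : e ▷ Y ≫ 𝟙_ B ◁ y = (P' ⊗ Q') ◁ y ≫ e ▷ Y' := (whisker_exchange _ _).symm
  calc _ = 𝟙 _ ⊗≫ (f ⊗ₘ g) ▷ Y ⊗≫ ((P' ⊗ Q') ◁ y ≫ e ▷ Y') ⊗≫ 𝟙 _ := by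
        dsimp only [capAt]; simp only [MonoidalCategory.tensorHom_def]; monoidal
    _ = _ := by rw [← this]; dsimp only [capAt]; monoidal

theorem cupAt_comp_tensor {P Q P' Q' Y Y' : B} (f : P ⟶ P') (g : Q ⟶ Q') (y : Y ⟶ Y')
    (n : 𝟙_ B ⟶ P ⊗ Q) :
    cupAt n Y ≫ (f ⊗ₘ g ⊗ₘ y) = y ≫ cupAt (n ≫ (f ⊗ₘ g)) Y' := by
  have : 𝟙_ B ◁ y ≫ n ▷ Y' = n ▷ Y ≫ (P ⊗ Q) ◁ y := whisker_exchange _ _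
  calc _ = 𝟙 _ ⊗≫ (n ▷ Y ≫ (P ⊗ Q) ◁ y) ⊗≫ (f ⊗ₘ g) ▷ Y' ⊗≫ 𝟙 _ := by
        dsimp only [cupAt]; simp only [tensorHom_def']; monoidal
    _ = _ := by rw [← this]; dsimp only [cupAt]; monoidal

theorem tensor_comp_crossAt {P Q P' Q' R S Y Y' : B} (f : P ⟶ P') (g : Q ⟶ Q') (y : Y ⟶ Y')
    (c : P' ⊗ Q' ⟶ R ⊗ S) :
    (f ⊗ₘ g ⊗ₘ y) ≫ crossAt c Y' = crossAt ((f ⊗ₘ g) ≫ c) Y ≫ R ◁ S ◁ y := by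
  have : c ▷ Y ≫ (R ⊗ S) ◁ y = (P' ⊗ Q') ◁ y ≫ c ▷ Y' := (whisker_exchange _ _).symm
  calc _ = 𝟙 _ ⊗≫ (f ⊗ₘ g) ▷ Y ⊗≫ ((P' ⊗ Q') ◁ y ≫ c ▷ Y') ⊗≫ 𝟙 _ := by
        dsimp only [crossAt]; simp only [MonoidalCategory.tensorHom_def]; monoidal
    _ = _ := by rw [← this]; dsimp only [crossAt]; monoidal

theorem crossAt_comp_tensor {P Q P' Q' R S Y Y' : B} (f : P ⟶ P') (g : Q ⟶ Q') (y : Y ⟶ Y')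
    (c : R ⊗ S ⟶ P ⊗ Q) :
    crossAt c Y ≫ (f ⊗ₘ g ⊗ₘ y) = R ◁ S ◁ y ≫ crossAt (c ≫ (f ⊗ₘ g)) Y' := by
  have : (R ⊗ S) ◁ y ≫ c ▷ Y' = c ▷ Y ≫ (P ⊗ Q) ◁ y := whisker_exchange _ _
  calc _ = 𝟙 _ ⊗≫ (c ▷ Y ≫ (P ⊗ Q) ◁ y) ⊗≫ (f ⊗ₘ g) ▷ Y' ⊗≫ 𝟙 _ := by
        dsimp only [crossAt]; simp only [tensorHom_def']; monoidal
    _ = _ := by rw [← this]; dsimp only [crossAt]; monoidal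

end TailMaps

/-! ### Morphisms and beads on sequences of strands. -/

section Strands

variable {B : Type u₁} [Category.{v₁} B] [MonoidalCategory B]
  {G F G' F' G'' F'' : B} [ExactPairing G F] [ExactPairing G' F'] [ExactPairing G'' F'']

/-- The morphism induced on a strand by `i : G ⟶ G'` if the strand is directed upwards, and by
`j : G' ⟶ G` if it is directed downwards. -/
def strandHom (i : G ⟶ G') (j : G' ⟶ G) : (s : Strand) → (strandObj G F s ⟶ strandObj G' F' s)
  | up => i
  | down => mate F' F j

theorem strandHom_id (s : Strand) : strandHom (F := F) (F' := F) (𝟙 G) (𝟙 G) s = 𝟙 _ := by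
  cases s
  · rfl
  · exact mate_id

theorem strandHom_comp (i : G ⟶ G') (j : G' ⟶ G) (i' : G' ⟶ G'') (j' : G'' ⟶ G') (s : Strand) :
    strandHom (F := F) (F' := F') i j s ≫ strandHom (F' := F'') i' j' s =
      strandHom (i ≫ i') (j' ≫ j) s := by
  cases s
  · rfl
  · exact (mate_comp (F := F'') (F' := F') (F'' := F) _ _).symm

/-- The mate on `F` crosses the evaluation and composes with the map on the other leg. This is how a
bead passes over a maximum. -/
theorem strandHom_comp_evaluation (i : G ⟶ G') (j : G' ⟶ G) (i' : G ⟶ G') (j' : G' ⟶ G) :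
    ((strandHom (F := F) (F' := F') i j down : F ⟶ F') ⊗ₘ
      (strandHom (F := F) (F' := F') i' j' up : G ⟶ G')) ≫ ε_ G' F' = F ◁ (i' ≫ j) ≫ ε_ G F := by
  rw [MonoidalCategory.tensorHom_def', Category.assoc, MonoidalCategory.whiskerLeft_comp, Category.assoc]
  exact congrArg _ (mate_comp_evaluation j)

theorem coevaluation_comp_strandHom (i : G ⟶ G') (j : G' ⟶ G) (i' : G ⟶ G') (j' : G' ⟶ G) :
    η_ G F ≫ ((strandHom (F := F) (F' := F') i j up : G ⟶ G') ⊗ₘ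
      (strandHom (F := F) (F' := F') i' j' down : F ⟶ F')) =
      η_ G' F' ≫ (j' ≫ i) ▷ F' := by
  have h : (strandHom (F := F) (F' := F') i' j' down : F ⟶ F') = mate F' F j' := rfl
  rw [MonoidalCategory.tensorHom_def', h, ← Category.assoc, coevaluation_comp_mate, comp_whiskerRight,
    Category.assoc]
  rfl

/-- The morphism of tensor products induced by morphisms of the strands. -/
def tensorHoms (i : G ⟶ G') (j : G' ⟶ G) : (a : List Strand) →
    (tensorObjs G F a ⟶ tensorObjs G' F' a)
  | [] => 𝟙 _
  | s :: a => strandHom i j s ⊗ₘ tensorHoms i j a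

/-- The powers `T ^ n k` inserted in the strands. -/
def beads (T : End G) : (ℕ → ℕ) → (a : List Strand) → (tensorObjs G F a ⟶ tensorObjs G F a)
  | _, [] => 𝟙 _
  | n, s :: a => strandHom (T ^ n 0) (T ^ n 0) s ⊗ₘ beads T (fun k => n (k + 1)) a

theorem strandHom_pow_comp (T : End G) (m n : ℕ) (s : Strand) :
    strandHom (F := F) (F' := F) (T ^ m) (T ^ m) s ≫ strandHom (F' := F) (T ^ n) (T ^ n) s =
      strandHom (T ^ (m + n)) (T ^ (m + n)) s := by
  rw [strandHom_comp]
  congr 1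
  · rw [add_comm, pow_add]; rfl
  · rw [pow_add]; rfl

theorem beads_comp (T : End G) (m n : ℕ → ℕ) (a : List Strand) :
    beads (F := F) T m a ≫ beads T n a = beads T (fun k => m k + n k) a := by
  induction a generalizing m n with
  | nil => exact Category.comp_id _
  | cons s a ih =>
    simp only [beads]
    rw [tensorHom_comp_tensorHom, strandHom_pow_comp, ih]

theorem beads_congr (T : End G) {m n : ℕ → ℕ} {a : List Strand} (h : ∀ k < a.length, m k = n k) :
    beads (F := F) T m a = beads (F := F) T n a := by
  induction a generalizing m n with
  | nil => rfl
  | cons s a ih =>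
    simp only [beads]
    rw [h 0 (by simp), ih fun k hk => h (k + 1) (by simpa using hk)]

theorem beads_zero (T : End G) (a : List Strand) : beads (F := F) T (fun _ => 0) a = 𝟙 _ := by
  induction a with
  | nil => rfl
  | cons s a ih =>
    simp only [beads]
    rw [ih, pow_zero, End.one_def, strandHom_id, id_tensorHom_id]

/-- A bead `j ≫ i` factors through `G` on an upward strand, and its mate factors through `F` on a
downward one. Cutting there recolours the part of a diagram between two levels from `G'` to `G`. -/
theorem beads_one (i : G ⟶ G') (j : G' ⟶ G) (a : List Strand) :
    beads (F := F') (j ≫ i : End G') (fun _ => 1) a =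
      tensorHoms (F := F') (F' := F) j i a ≫ tensorHoms i j a := by
  induction a with
  | nil => exact (Category.comp_id _).symm
  | cons s a ih =>
    simp only [beads, tensorHoms]
    rw [tensorHom_comp_tensorHom, ih, strandHom_comp, pow_one]

end Strands

/-! ### Values of slices when the R-matrix is a braiding. -/

section Layers

variable {B : Type u₁} [Category.{v₁} B] [MonoidalCategory B] [BraidedCategory B]
  {G F G' F' : B} [ExactPairing G F] [ExactPairing G' F'] (h : IsRigidRMatrix F (β_ G G).hom)
  (h' : IsRigidRMatrix F' (β_ G' G').hom)

theorem layerMap_capL (r : List Strand) :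
    layerMap h (.capL r) = capAt (ε_ G F) (tensorObjs G F r) := rfl

theorem layerMap_cupL (r : List Strand) :
    layerMap h (.cupL r) = cupAt (η_ G F) (tensorObjs G F r) := rfl

theorem layerMap_cross (o : Bool) (s t : Strand) (r : List Strand) :
    layerMap h (.cross o s t r) =
      crossAt (crossing o (strandObj G F s) (strandObj G F t)) (tensorObjs G F r) := by
  rw [layerMap, crossingMap_braiding]
  rfl

theorem layerMap_capR (r : List Strand) :
    layerMap h (.capR r) = capAt (twistedCap G F true) (tensorObjs G F r) := by
  rw [layerMap, crossingMap_braiding]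
  rfl

theorem layerMap_cupR (r : List Strand) :
    layerMap h (.cupR r) = cupAt (twistedCup G F false) (tensorObjs G F r) := by
  rw [layerMap, crossingMap_braiding]
  rfl

theorem layerMap_skip (s : Strand) {a b : List Strand} (L : Layer a b) :
    layerMap h (.skip s L) = strandObj G F s ◁ layerMap h L := rfl

theorem tensorHom_comp_crossing (o : Bool) {X X' Y Y' : B} (f : X ⟶ X') (g : Y ⟶ Y') :
    (f ⊗ₘ g) ≫ crossing o X' Y' = crossing o X Y ≫ (g ⊗ₘ f) := by
  rw [MonoidalCategory.tensorHom_def, Category.assoc, crossing_naturality_right, reassoc_of% @crossing_naturality_left,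
    MonoidalCategory.tensorHom_def']

theorem strandHom_comp_twistedCap (o : Bool) (i : G ⟶ G') (j : G' ⟶ G) (i' : G ⟶ G')
    (j' : G' ⟶ G) :
    ((strandHom (F := F) (F' := F') i' j' up : G ⟶ G') ⊗ₘ
      (strandHom (F := F) (F' := F') i j down : F ⟶ F')) ≫ twistedCap G' F' o =
      (i' ≫ j) ▷ F ≫ twistedCap G F o := by
  rw [twistedCap, ← Category.assoc, tensorHom_comp_crossing, Category.assoc,
    strandHom_comp_evaluation, twistedCap, reassoc_of% @crossing_naturality_left]

theorem twistedCup_comp_strandHom (o : Bool) (i : G ⟶ G') (j : G' ⟶ G) (i' : G ⟶ G')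
    (j' : G' ⟶ G) :
    twistedCup G F o ≫ ((strandHom (F := F) (F' := F') i' j' down : F ⟶ F') ⊗ₘ
      (strandHom (F := F) (F' := F') i j up : G ⟶ G')) =
      twistedCup G' F' o ≫ F' ◁ (j' ≫ i) := by
  rw [twistedCup, Category.assoc, ← tensorHom_comp_crossing, ← Category.assoc,
    coevaluation_comp_strandHom, twistedCup, Category.assoc, Category.assoc,
    crossing_naturality_left]

/-- Slices are compatible with the inclusion and the projection of a direct summand. -/
theorem tensorHoms_comp_layerMap_comp (i : G ⟶ G') (j : G' ⟶ G) (hij : i ≫ j = 𝟙 G)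
    {a b : List Strand} (L : Layer a b) :
    tensorHoms (F := F) (F' := F') i j a ≫ layerMap h' L ≫ tensorHoms j i b = layerMap h L := by
  -- On a downward strand the composite is the mate of `i ≫ j`, again an identity. In each slice
  -- below, the maps from the two levels are moved together until they cancel in this way.
  have hid : ∀ a : List Strand,
      tensorHoms (F := F) (F' := F') i j a ≫ tensorHoms (F' := F) j i a = 𝟙 _ := by
    intro a
    induction a with
    | nil => exact Category.comp_id _
    | cons s a ih =>
      simp only [tensorHoms]
      rw [tensorHom_comp_tensorHom, ih, strandHom_comp, hij, strandHom_id, id_tensorHom_id]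
  have hs : ∀ s : Strand, strandHom (F := F) (F' := F') i j s ≫ strandHom (F' := F) j i s = 𝟙 _ := by
    intro s
    rw [strandHom_comp, hij, strandHom_id]
  induction L with
  | capL r =>
    rw [layerMap_capL, layerMap_capL]
    simp only [tensorHoms]
    rw [reassoc_of% @tensor_comp_capAt]
    rw [hid, Category.comp_id, strandHom_comp_evaluation, hij]
    simp
  | capR r =>
    rw [layerMap_capR, layerMap_capR]
    simp only [tensorHoms]
    rw [reassoc_of% @tensor_comp_capAt]
    rw [hid, Category.comp_id, strandHom_comp_twistedCap, hij]
    simp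
  | cupL r =>
    rw [layerMap_cupL, layerMap_cupL]
    refine (congrArg _ (cupAt_comp_tensor _ _ _ _)).trans ?_
    rw [← Category.assoc, hid, Category.id_comp, coevaluation_comp_strandHom, hij]
    simp
  | cupR r =>
    rw [layerMap_cupR, layerMap_cupR]
    refine (congrArg _ (cupAt_comp_tensor _ _ _ _)).trans ?_
    rw [← Category.assoc, hid, Category.id_comp, twistedCup_comp_strandHom, hij]
    simp
  | cross o s t r =>
    rw [layerMap_cross, layerMap_cross]
    simp only [tensorHoms]
    rw [reassoc_of% @tensor_comp_crossAt]
    rw [tensorHom_comp_crossing]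
    rw [← id_tensorHom, ← id_tensorHom, tensorHom_comp_tensorHom, tensorHom_comp_tensorHom, hid,
      crossAt_comp_tensor]
    simp only [Category.id_comp, Category.assoc, tensorHom_comp_tensorHom, hs]
    simp
  | skip s L ih =>
    rw [layerMap_skip, layerMap_skip]
    simp only [tensorHoms]
    rw [← id_tensorHom, tensorHom_comp_tensorHom, tensorHom_comp_tensorHom, ih, Category.id_comp,
      hs, id_tensorHom]

end Layers

end LongKnotInvariant

end

noncomputable section

namespace LongKnotInvariant

open CategoryTheory MonoidalCategory BraidedCategory Strand

universe v₁ u₁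

/-! ### Beads slide along the strand. -/

section Beads

variable {B : Type u₁} [Category.{v₁} B] [MonoidalCategory B] [BraidedCategory B]
  {G F : B} [ExactPairing G F] (h : IsRigidRMatrix F (β_ G G).hom) (T : End G)

/-- One more bead at the point `p`. -/
def addBead (n : ℕ × ℕ → ℕ) (p : ℕ × ℕ) : ℕ × ℕ → ℕ := fun q => n q + if q = p then 1 else 0

omit [MonoidalCategory B] [BraidedCategory B] in
theorem pow_comp_pow (m n : ℕ) : (T ^ n : End G) ≫ (T ^ m : End G) = (T ^ (m + n) : End G) :=
  (pow_add T m n).symm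

/-- In this normal form, and in the ones for the other slices, bead counts enter only through their
sum over the two endpoints of each arc. Sliding a bead along an arc is then visibly harmless. -/
theorem beads_capL (f g : ℕ → ℕ) (r : List Strand) :
    beads (F := F) T f (down :: up :: r) ≫ layerMap h (.capL r) ≫ beads T g r =
      capAt (F ◁ (T ^ (f 0 + f 1) : End G) ≫ ε_ G F) (tensorObjs G F r) ≫
        beads T (fun k => f (k + 2) + g k) r := by
  simp only [beads]
  rw [layerMap_capL, reassoc_of% @tensor_comp_capAt, beads_comp, strandHom_comp_evaluation,
    pow_comp_pow]

theorem beads_capR (f g : ℕ → ℕ) (r : List Strand) :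
    beads (F := F) T f (up :: down :: r) ≫ layerMap h (.capR r) ≫ beads T g r =
      capAt ((T ^ (f 0 + f 1) : End G) ▷ F ≫ twistedCap G F true) (tensorObjs G F r) ≫
        beads T (fun k => f (k + 2) + g k) r := by
  simp only [beads]
  rw [layerMap_capR, reassoc_of% @tensor_comp_capAt, beads_comp, strandHom_comp_twistedCap,
    pow_comp_pow, add_comm]

theorem beads_cupL (f g : ℕ → ℕ) (r : List Strand) :
    beads (F := F) T f r ≫ layerMap h (.cupL r) ≫ beads T g (up :: down :: r) =
      beads T (fun k => f k + g (k + 2)) r ≫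
        cupAt (η_ G F ≫ (T ^ (g 0 + g 1) : End G) ▷ F) (tensorObjs G F r) := by
  simp only [beads]
  rw [layerMap_cupL, cupAt_comp_tensor, reassoc_of% @beads_comp, coevaluation_comp_strandHom,
    pow_comp_pow]

theorem beads_cupR (f g : ℕ → ℕ) (r : List Strand) :
    beads (F := F) T f r ≫ layerMap h (.cupR r) ≫ beads T g (down :: up :: r) =
      beads T (fun k => f k + g (k + 2)) r ≫
        cupAt (twistedCup G F false ≫ F ◁ (T ^ (g 0 + g 1) : End G)) (tensorObjs G F r) := by
  simp only [beads]
  rw [layerMap_cupR, cupAt_comp_tensor, reassoc_of% @beads_comp, twistedCup_comp_strandHom,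
    pow_comp_pow, add_comm]

theorem beads_cross (o : Bool) (s t : Strand) (f g : ℕ → ℕ) (r : List Strand) :
    beads (F := F) T f (s :: t :: r) ≫ layerMap h (.cross o s t r) ≫ beads T g (t :: s :: r) =
      crossAt (crossing o (strandObj G F s) (strandObj G F t)) (tensorObjs G F r) ≫
        (strandHom (T ^ (f 1 + g 0)) (T ^ (f 1 + g 0)) t ⊗ₘ
          strandHom (T ^ (f 0 + g 1)) (T ^ (f 0 + g 1)) s ⊗ₘ
            beads T (fun k => f (k + 2) + g (k + 2)) r) := by
  simp only [beads]
  rw [layerMap_cross, reassoc_of% @tensor_comp_crossAt, tensorHom_comp_crossing,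
    ← id_tensorHom, ← id_tensorHom, tensorHom_comp_tensorHom, tensorHom_comp_tensorHom, beads_comp,
    Category.id_comp, Category.id_comp, crossAt_comp_tensor, crossAt_comp_tensor, Category.assoc,
    tensorHom_comp_tensorHom, strandHom_pow_comp, strandHom_pow_comp]

theorem beads_skip (s : Strand) {a b : List Strand} (L : Layer a b) (f g : ℕ → ℕ) :
    beads (F := F) T f (s :: a) ≫ layerMap h (.skip s L) ≫ beads T g (s :: b) =
      strandHom (T ^ (f 0 + g 0)) (T ^ (f 0 + g 0)) s ⊗ₘ
        (beads T (fun k => f (k + 1)) a ≫ layerMap h L ≫ beads T (fun k => g (k + 1)) b) := by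
  simp only [beads]
  rw [layerMap_skip, ← id_tensorHom, tensorHom_comp_tensorHom, tensorHom_comp_tensorHom,
    Category.id_comp, strandHom_pow_comp]

/-- Beads slide along the arcs of a slice. -/
theorem layer_slide {a b : List Strand} (L : Layer a b) (k : ℕ) (n : ℕ × ℕ → ℕ)
    (e : (ℕ × ℕ) × (ℕ × ℕ)) (he : e ∈ L.arcs k) :
    beads (F := F) T (fun i => addBead n e.1 (k, i)) a ≫ layerMap h L ≫
        beads T (fun i => addBead n e.1 (k + 1, i)) b =
      beads T (fun i => addBead n e.2 (k, i)) a ≫ layerMap h L ≫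
        beads T (fun i => addBead n e.2 (k + 1, i)) b := by
  induction L generalizing n e with
  | capL r =>
    rw [beads_capL, beads_capL]
    simp only [Layer.arcs, List.mem_cons, List.mem_map, List.mem_range] at he
    congr 5
    · rcases he with rfl | ⟨i, hi, rfl⟩ <;> simp [addBead] <;> omega
    · funext j
      rcases he with rfl | ⟨i, hi, rfl⟩ <;> simp [addBead]; omega
  | capR r =>
    rw [beads_capR, beads_capR]
    simp only [Layer.arcs, List.mem_cons, List.mem_map, List.mem_range] at he
    congr 5
    · rcases he with rfl | ⟨i, hi, rfl⟩ <;> simp [addBead] <;> omega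
    · funext j
      rcases he with rfl | ⟨i, hi, rfl⟩ <;> simp [addBead]; omega
  | cupL r =>
    rw [beads_cupL, beads_cupL]
    simp only [Layer.arcs, List.mem_cons, List.mem_map, List.mem_range] at he
    congr 5
    · funext j
      rcases he with rfl | ⟨i, hi, rfl⟩ <;> simp [addBead]; omega
    · rcases he with rfl | ⟨i, hi, rfl⟩ <;> simp [addBead] <;> omega
  | cupR r =>
    rw [beads_cupR, beads_cupR]
    simp only [Layer.arcs, List.mem_cons, List.mem_map, List.mem_range] at he
    congr 5
    · funext j
      rcases he with rfl | ⟨i, hi, rfl⟩ <;> simp [addBead]; omega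
    · rcases he with rfl | ⟨i, hi, rfl⟩ <;> simp [addBead] <;> omega
  | cross o s t r =>
    rw [beads_cross, beads_cross]
    simp only [Layer.arcs, List.mem_cons, List.mem_map, List.mem_range] at he
    have h1 : addBead n e.1 (k, 1) + addBead n e.1 (k + 1, 0) =
        addBead n e.2 (k, 1) + addBead n e.2 (k + 1, 0) := by
      rcases he with rfl | rfl | ⟨i, hi, rfl⟩ <;> simp [addBead]; omega
    have h2 : addBead n e.1 (k, 0) + addBead n e.1 (k + 1, 1) =
        addBead n e.2 (k, 0) + addBead n e.2 (k + 1, 1) := by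
      rcases he with rfl | rfl | ⟨i, hi, rfl⟩ <;> simp [addBead]; omega
    have h3 : (fun j => addBead n e.1 (k, j + 2) + addBead n e.1 (k + 1, j + 2)) =
        fun j => addBead n e.2 (k, j + 2) + addBead n e.2 (k + 1, j + 2) := by
      funext j
      rcases he with rfl | rfl | ⟨i, hi, rfl⟩ <;> simp [addBead]; omega
    rw [h1, h2, h3]
  | skip s L ih =>
    rw [beads_skip, beads_skip]
    simp only [Layer.arcs, List.mem_cons, List.mem_map] at he
    rcases he with rfl | ⟨e, he, rfl⟩
    · have h1 : addBead n (k, 0) (k, 0) + addBead n (k, 0) (k + 1, 0) =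
        addBead n (k + 1, 0) (k, 0) + addBead n (k + 1, 0) (k + 1, 0) := by
        simp [addBead]; omega
      have h2 : ∀ l j, addBead n (k, 0) (l, j + 1) = addBead n (k + 1, 0) (l, j + 1) := by
        simp [addBead]
      simp only [h1, h2]
    -- The slice under `skip` sees the bead counts shifted by one column; its arcs never meet column
    -- 0.
    · have h2 : ∀ (p : ℕ × ℕ) l j, addBead n (p.1, p.2 + 1) (l, j + 1) =
          addBead (fun q => n (q.1, q.2 + 1)) p (l, j) := by
        simp [addBead, Prod.ext_iff]
      have h0 : ∀ (p : ℕ × ℕ) l, addBead n (p.1, p.2 + 1) (l, 0) = n (l, 0) := by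
        simp [addBead]
      simp only [h2, h0, ih _ e he]

/-- The part above the bottom level of a diagram with the powers `T ^ n p` inserted at the
points `p`. -/
def beadedTail : ℕ → (ℕ × ℕ → ℕ) → {a b : List Strand} → Diagram a b →
    (tensorObjs G F a ⟶ tensorObjs G F b)
  | _, _, _, _, .nil a => 𝟙 (tensorObjs G F a)
  | k, n, _, _, .cons (b := b) L D =>
    layerMap h L ≫ beads T (fun i => n (k + 1, i)) b ≫ beadedTail (k + 1) n D

/-- The value of a diagram whose bottom is at height `k`, with the powers `T ^ n p` inserted at the
points `p`. -/
def beaded (k : ℕ) (n : ℕ × ℕ → ℕ) {a b : List Strand} (D : Diagram a b) :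
    tensorObjs G F a ⟶ tensorObjs G F b :=
  beads T (fun i => n (k, i)) a ≫ beadedTail h T k n D

/-- The points of a diagram. -/
def Diagram.points (k : ℕ) : {a b : List Strand} → Diagram a b → Finset (ℕ × ℕ)
  | _, _, .nil a => (Finset.range a.length).image (fun i => (k, i))
  | a, _, .cons _ D => (Finset.range a.length).image (fun i => (k, i)) ∪ Diagram.points (k + 1) D

theorem beadedTail_congr {a b : List Strand} (D : Diagram a b) (k : ℕ) {m n : ℕ × ℕ → ℕ}
    (hmn : ∀ l i, k < l → m (l, i) = n (l, i)) :
    beadedTail h T k m D = beadedTail h T k n D := by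
  induction D generalizing k with
  | nil a => rfl
  | cons L D ih =>
    simp only [beadedTail]
    rw [ih (k + 1) fun l i hl => hmn l i (by omega), funext fun i => hmn (k + 1) i (by omega)]

theorem beaded_congr {a b : List Strand} (D : Diagram a b) (k : ℕ) {m n : ℕ × ℕ → ℕ}
    (hmn : ∀ p ∈ D.points k, m p = n p) : beaded h T k m D = beaded h T k n D := by
  induction D generalizing k with
  | nil a =>
    simp only [beaded, beadedTail]
    rw [beads_congr (n := fun i => n (k, i)) _ fun i hi => hmn _ (by simpa [Diagram.points] using hi)]
  | cons L D ih =>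
    have := ih (k + 1) fun p hp => hmn p (by simp [Diagram.points, hp])
    simp only [beaded, beadedTail] at this ⊢
    rw [this, beads_congr (n := fun i => n (k, i)) _ fun i hi => hmn _ (by simp [Diagram.points, hi])]

/-- Locality: a slide inside one slice changes the bead counts on its two boundary levels only. -/
theorem Layer.arcs_level {a b : List Strand} (L : Layer a b) (k : ℕ) (e) (he : e ∈ L.arcs k) :
    (e.1.1 = k ∨ e.1.1 = k + 1) ∧ (e.2.1 = k ∨ e.2.1 = k + 1) := by
  induction L generalizing e with
  | skip s L ih =>
    simp only [Layer.arcs, List.mem_cons, List.mem_map] at he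
    rcases he with rfl | ⟨e, he, rfl⟩
    · simp
    · exact ih e he
  | cross o s t r =>
    simp only [Layer.arcs, List.mem_cons, List.mem_map] at he
    rcases he with rfl | rfl | ⟨i, hi, rfl⟩ <;> simp
  | _ r =>
    simp only [Layer.arcs, List.mem_cons, List.mem_map] at he
    rcases he with rfl | ⟨i, hi, rfl⟩ <;> simp

theorem Diagram.arcs_level {a b : List Strand} (D : Diagram a b) (k : ℕ) (e) (he : e ∈ D.arcs k) :
    k ≤ e.1.1 ∧ k ≤ e.2.1 := by
  induction D generalizing k with
  | nil a => simp [Diagram.arcs] at he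
  | cons L D ih =>
    simp only [Diagram.arcs, List.mem_append] at he
    rcases he with he | he
    · have := L.arcs_level k e he
      omega
    · have := ih (k + 1) he
      omega

/-- Beads slide along the arcs of a diagram. -/
theorem beaded_slide {a b : List Strand} (D : Diagram a b) (k : ℕ) (n : ℕ × ℕ → ℕ)
    (e : (ℕ × ℕ) × (ℕ × ℕ)) (he : e ∈ D.arcs k) :
    beaded h T k (addBead n e.1) D = beaded h T k (addBead n e.2) D := by
  induction D generalizing k with
  | nil a => simp [Diagram.arcs] at he
  | cons L D ih =>
    simp only [Diagram.arcs, List.mem_append] at he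
    simp only [beaded, beadedTail] at ih ⊢
    rcases he with he | he
    -- The arc lies in the bottom slice. Levels `k` and `k + 1` are treated by `layer_slide`; the
    -- tail sees only levels above `k + 1`, where nothing changes.
    · have h1 := reassoc_of% (layer_slide h T L k n e he)
      rw [h1, beadedTail_congr (m := addBead n e.1) (n := addBead n e.2)]
      have := L.arcs_level k e he
      intro l i hl
      rw [addBead, addBead, if_neg, if_neg]
      · rintro h; rw [← h] at this; simp at this; omega
      · rintro h; rw [← h] at this; simp at this; omega
    -- The arc lies above level `k`, so the beads at the bottom are the same on both sides.
    · have := D.arcs_level _ e he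
      rw [ih (k + 1) he]
      congr 2
      funext i
      rw [addBead, addBead, if_neg, if_neg]
      · rintro h; rw [← h] at this; simp at this
      · rintro h; rw [← h] at this; simp at this

theorem beaded_slide_eqvGen {a b : List Strand} (D : Diagram a b) (k : ℕ) (p q : ℕ × ℕ)
    (hpq : Relation.EqvGen (fun p q => (p, q) ∈ D.arcs k) p q) (n : ℕ × ℕ → ℕ) :
    beaded h T k (addBead n p) D = beaded h T k (addBead n q) D := by
  induction hpq with
  | rel p q hpq => exact beaded_slide h T D k n (p, q) hpq
  | refl p => rfl
  | symm p q _ ih => exact ih.symm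
  | trans p q r _ _ ih1 ih2 => exact ih1.trans ih2

theorem Layer.exists_arc {a b : List Strand} (L : Layer a b) (k : ℕ) :
    (∀ i < a.length, ∃ e ∈ L.arcs k, e.1 = (k, i) ∨ e.2 = (k, i)) ∧
      ∀ i < b.length, ∃ e ∈ L.arcs k, e.1 = (k + 1, i) ∨ e.2 = (k + 1, i) := by
  induction L with
  | cross o s t r =>
    constructor
    · rintro (_ | _ | i) hi
      · exact ⟨_, List.mem_cons_self, Or.inl rfl⟩
      · exact ⟨_, List.mem_cons_of_mem _ List.mem_cons_self, Or.inl rfl⟩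
      · exact ⟨_, List.mem_cons_of_mem _ (List.mem_cons_of_mem _
          (List.mem_map_of_mem (List.mem_range.2 (by simpa using hi)))), Or.inl rfl⟩
    · rintro (_ | _ | i) hi
      · exact ⟨_, List.mem_cons_of_mem _ List.mem_cons_self, Or.inr rfl⟩
      · exact ⟨_, List.mem_cons_self, Or.inr rfl⟩
      · exact ⟨_, List.mem_cons_of_mem _ (List.mem_cons_of_mem _
          (List.mem_map_of_mem (List.mem_range.2 (by simpa using hi)))), Or.inr rfl⟩
  | skip s L ih =>
    constructor
    · rintro (_ | i) hi
      · exact ⟨_, List.mem_cons_self, Or.inl rfl⟩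
      · obtain ⟨e, he, h⟩ := ih.1 i (by simpa using hi)
        refine ⟨_, List.mem_cons_of_mem _ (List.mem_map_of_mem he), ?_⟩
        exact h.imp (fun h => by rw [h]) (fun h => by rw [h])
    · rintro (_ | i) hi
      · exact ⟨_, List.mem_cons_self, Or.inr rfl⟩
      · obtain ⟨e, he, h⟩ := ih.2 i (by simpa using hi)
        refine ⟨_, List.mem_cons_of_mem _ (List.mem_map_of_mem he), ?_⟩
        exact h.imp (fun h => by rw [h]) (fun h => by rw [h])
  | capL r | capR r =>
    constructor
    · rintro (_ | _ | i) hi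
      · exact ⟨_, List.mem_cons_self, Or.inl rfl⟩
      · exact ⟨_, List.mem_cons_self, Or.inr rfl⟩
      · exact ⟨_, List.mem_cons_of_mem _
          (List.mem_map_of_mem (List.mem_range.2 (by simpa using hi))), Or.inl rfl⟩
    · intro i hi
      exact ⟨_, List.mem_cons_of_mem _ (List.mem_map_of_mem (List.mem_range.2 hi)), Or.inr rfl⟩
  | cupL r | cupR r =>
    constructor
    · intro i hi
      exact ⟨_, List.mem_cons_of_mem _ (List.mem_map_of_mem (List.mem_range.2 hi)), Or.inl rfl⟩
    · rintro (_ | _ | i) hi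
      · exact ⟨_, List.mem_cons_self, Or.inl rfl⟩
      · exact ⟨_, List.mem_cons_self, Or.inr rfl⟩
      · exact ⟨_, List.mem_cons_of_mem _
          (List.mem_map_of_mem (List.mem_range.2 (by simpa using hi))), Or.inr rfl⟩

/-- The bottom level is excepted because a diagram without slices has points but no arcs. -/
theorem Diagram.exists_arc {a b : List Strand} (D : Diagram a b) (k : ℕ) (p : ℕ × ℕ)
    (hp : p ∈ D.points k) : (p.1 = k ∧ p.2 < a.length) ∨ ∃ e ∈ D.arcs k, e.1 = p ∨ e.2 = p := by
  induction D generalizing k with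
  | nil a =>
    simp only [Diagram.points, Finset.mem_image, Finset.mem_range] at hp
    obtain ⟨i, hi, rfl⟩ := hp
    exact Or.inl ⟨rfl, hi⟩
  | cons L D ih =>
    simp only [Diagram.points, Finset.mem_union, Finset.mem_image, Finset.mem_range] at hp
    simp only [Diagram.arcs, List.mem_append]
    rcases hp with ⟨i, hi, rfl⟩ | hp
    · exact Or.inl ⟨rfl, hi⟩
    · rcases ih (k + 1) hp with ⟨h1, h2⟩ | ⟨e, he, h1⟩
      · obtain ⟨e, he, h3⟩ := (L.exists_arc k).2 p.2 h2
        have : p = (k + 1, p.2) := Prod.ext h1 rfl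
        rw [← this] at h3
        exact Or.inr ⟨e, Or.inl he, h3⟩
      · exact Or.inr ⟨e, Or.inr he, h1⟩

/-- `IsConnected` mentions only first endpoints of arcs. A second endpoint is linked to the first by
its arc, and the only point at the bottom level is `(0, 0)` itself. -/
theorem Diagram.IsConnected.eqvGen {D : Diagram [up] [up]} (hD : D.IsConnected) {p : ℕ × ℕ}
    (hp : p ∈ D.points 0) : Relation.EqvGen (fun p q => (p, q) ∈ D.arcs 0) (0, 0) p := by
  rcases D.exists_arc 0 p hp with ⟨h1, h2⟩ | ⟨e, he, rfl | rfl⟩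
  · have : p = (0, 0) := Prod.ext h1 (by simpa using h2)
    rw [this]
    exact .refl _
  · exact hD e he
  · exact .trans _ _ _ (hD e he) (.rel _ _ he)

/-- In a connected diagram all beads slide to the bottom. -/
theorem beaded_eq_bottom {D : Diagram [up] [up]} (hD : D.IsConnected) {p : ℕ × ℕ}
    (hp : p ∈ D.points 0) (n : ℕ × ℕ → ℕ) :
    beaded h T 0 (addBead n p) D = beaded h T 0 (addBead n (0, 0)) D :=
  (beaded_slide_eqvGen h T D 0 _ _ (hD.eqvGen hp) n).symm

theorem beadedTail_zero {a b : List Strand} (D : Diagram a b) (k : ℕ) :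
    beadedTail h T k (fun _ => 0) D = diagramMap h D := by
  induction D generalizing k with
  | nil a => rfl
  | cons L D ih =>
    simp only [beadedTail, diagramMap]
    rw [beads_zero, ih, Category.id_comp]

omit [BraidedCategory B] in
theorem beads_single_up (r : List Strand) :
    beads (F := F) T (fun i => if i = 0 then 1 else 0) (up :: r) = T ▷ tensorObjs G F r := by
  simp only [beads]
  rw [← tensorHom_id, show (fun k => if k + 1 = 0 then 1 else 0) = fun _ => 0 from by simp,
    beads_zero]
  simp
  rfl

theorem beaded_bottom (D : Diagram [up] [up]) (m : ℕ) :
    beaded h T 0 (fun p => if p = (0, 0) then m else 0) D =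
      (T ^ m : End G) ▷ 𝟙_ B ≫ diagramMap h D := by
  rw [beaded, ← beadedTail_zero h T D 0, beadedTail_congr (n := fun _ => 0)]
  · congr 1
    simp [beads, tensorObjs]
    rfl
  · intro l i hl
    rw [if_neg]
    simp; omega

-- Diagrams take values on `G ⊗ 𝟙`, whereas `RT` is conjugated by the right unitor; relations are
-- proved for the former and transported by this.
omit [BraidedCategory B] in
theorem whisker_rightUnitor_conj {X Y : B} {S S' : X ⟶ Y} {f : Y ⊗ 𝟙_ B ⟶ Y ⊗ 𝟙_ B}
    {g : X ⊗ 𝟙_ B ⟶ X ⊗ 𝟙_ B} (H : S ▷ 𝟙_ B ≫ f = g ≫ S' ▷ 𝟙_ B) :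
    S ≫ (ρ_ Y).inv ≫ f ≫ (ρ_ Y).hom = ((ρ_ X).inv ≫ g ≫ (ρ_ X).hom) ≫ S' := by
  rw [Category.assoc, Category.assoc, ← rightUnitor_naturality, ← reassoc_of% H,
    rightUnitor_inv_naturality_assoc]

/-- The number of slices. -/
def Diagram.height : {a b : List Strand} → Diagram a b → ℕ
  | _, _, .nil _ => 0
  | _, _, .cons _ D => Diagram.height D + 1

theorem Diagram.comp_nil {a b : List Strand} (D : Diagram a b) : D.comp (.nil b) = D := by
  induction D with
  | nil a => rfl
  | cons L D ih => simp only [Diagram.comp, ih]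

theorem Diagram.mem_points_comp {a b c : List Strand} (P : Diagram a b) (Q : Diagram b c) (k i : ℕ)
    (hi : i < b.length) : (k + P.height, i) ∈ (P.comp Q).points k := by
  induction P generalizing k with
  | nil a => cases Q <;> simp [Diagram.comp, Diagram.points, Diagram.height, hi]
  | cons L P ih =>
    have := ih Q (k + 1) hi
    rw [show k + 1 + P.height = k + (P.height + 1) by omega] at this
    simp [Diagram.comp, Diagram.points, Diagram.height, this]

/-- A single bead at the level where `P` meets `Q` is the composite cut at that level with a bead
inserted. This links bead counts with the local changes produced by moves. -/
theorem beaded_comp {a b c : List Strand} (P : Diagram a b) (Q : Diagram b c) (k i : ℕ) :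
    beaded h T k (fun p => if p = (k + P.height, i) then 1 else 0) (P.comp Q) =
      diagramMap h P ≫ beads T (fun j => if j = i then 1 else 0) b ≫ diagramMap h Q := by
  induction P generalizing k with
  | nil a =>
    rw [← beadedTail_zero h T Q k, beaded, Diagram.comp, diagramMap, Category.id_comp,
      beadedTail_congr (n := fun _ => 0)]
    · simp [Diagram.height]
    · intro l i hl
      rw [if_neg]
      simp [Diagram.height]; omega
  | cons L P ih =>
    have := ih Q (k + 1)
    rw [show k + 1 + P.height = k + (P.height + 1) by omega] at this
    rw [show (Diagram.cons L P).height = P.height + 1 from rfl]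
    simp only [beaded, Diagram.comp, beadedTail, diagramMap, Category.assoc] at this ⊢
    rw [this, show (fun i_1 => if (k, i_1) = (k + (P.height + 1), i) then 1 else 0) = fun _ => 0
      from by simp, beads_zero, Category.id_comp]

/-- A bead at any level of a connected diagram slides to the bottom. -/
theorem diagramMap_comp_bead {b : List Strand} (P : Diagram [up] b) (Q : Diagram b [up])
    (hD : (P.comp Q).IsConnected) {i : ℕ} (hi : i < b.length) :
    diagramMap h P ≫ beads T (fun j => if j = i then 1 else 0) b ≫ diagramMap h Q =
      T ▷ 𝟙_ B ≫ diagramMap h (P.comp Q) := by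
  have h1 := beaded_eq_bottom h T hD (P.mem_points_comp Q 0 i hi) (fun _ => 0)
  have h2 := beaded_bottom h T (P.comp Q) 1
  rw [pow_one] at h2
  have h3 : ∀ p, addBead (fun _ => 0) p = fun q => if q = p then 1 else 0 := fun p =>
    funext fun q => by simp [addBead]
  rw [h3, h3] at h1
  rw [← beaded_comp h T P Q 0 i, ← h2, h1]

/-- The value of a connected diagram commutes with the endomorphisms of `G`. -/
theorem comp_RT_comm {D : Diagram [up] [up]} (hD : D.IsConnected) : T ≫ RT h D = RT h D ≫ T := by
  apply whisker_rightUnitor_conj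
  -- With an empty upper part the bead sits at the top end, so sliding it to the bottom is the
  -- claimed commutation.
  have h1 := diagramMap_comp_bead h T D (.nil [up]) (by rwa [D.comp_nil]) (i := 0) (by simp)
  rw [D.comp_nil] at h1
  rw [← h1, beads_single_up, diagramMap, Category.comp_id]

/-- One bead at every point of the diagram: all of them slide to the bottom and multiply to the
power given by the number of points. -/
theorem beaded_one {D : Diagram [up] [up]} (hD : D.IsConnected) :
    beaded h T 0 (fun _ => 1) D = (T ^ (D.points 0).card : End G) ▷ 𝟙_ B ≫ diagramMap h D := by
  have key : ∀ (S : Finset (ℕ × ℕ)), S ⊆ D.points 0 → ∀ n : ℕ × ℕ → ℕ,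
      beaded h T 0 (fun q => n q + if q ∈ S then 1 else 0) D =
        beaded h T 0 (fun q => n q + if q = (0, 0) then S.card else 0) D := by
    intro S
    induction S using Finset.induction_on with
    | empty => simp
    | insert p S hp ih =>
      intro hS n
      have h1 : (fun q => n q + if q ∈ insert p S then 1 else 0) =
          addBead (fun q => n q + if q ∈ S then 1 else 0) p := by
        funext q
        simp only [addBead, Finset.mem_insert]
        by_cases hq : q = p
        · subst hq; simp [hp]
        · simp [hq]
      have h2 : addBead (fun q => n q + if q ∈ S then 1 else 0) (0, 0) =
          fun q => addBead n (0, 0) q + if q ∈ S then 1 else 0 := by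
        funext q
        simp only [addBead]; omega
      -- The bead at `p` is sent to the bottom and then counted in `n`, which is why the induction
      -- is over all `n`.
      rw [h1, beaded_eq_bottom h T hD (hS (by simp)), h2,
        ih (fun q hq => hS (by simp [hq])), Finset.card_insert_of_notMem hp]
      congr 1
      funext q
      simp only [addBead]
      split_ifs <;> omega
  have h3 := key _ subset_rfl (fun _ => 0)
  rw [← beaded_bottom, beaded_congr h T D 0 (n := fun q => 0 + if q ∈ D.points 0 then 1 else 0), h3]
  · simp
  · intro p hp
    simp [hp]

end Beads

/-! ### Compatibility with direct summands. -/

section Summand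

variable {B : Type u₁} [Category.{v₁} B] [MonoidalCategory B] [BraidedCategory B]
  {G F G' F' : B} [ExactPairing G F] [ExactPairing G' F'] (h : IsRigidRMatrix F (β_ G G).hom)
  (h' : IsRigidRMatrix F' (β_ G' G').hom)

/-- Each level carries `j ≫ i`. Regrouping, every slice for `G'` stands between `i` below and `j`
above, so `tensorHoms_comp_layerMap_comp` turns it into the slice for `G`. -/
theorem tensorHoms_comp_beadedTail (i : G ⟶ G') (j : G' ⟶ G) (hij : i ≫ j = 𝟙 G)
    {a b : List Strand} (D : Diagram a b) (k : ℕ) :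
    tensorHoms (F := F) (F' := F') i j a ≫ beadedTail h' (j ≫ i : End G') k (fun _ => 1) D =
      diagramMap h D ≫ tensorHoms i j b := by
  induction D generalizing k with
  | nil a => simp only [beadedTail, diagramMap, Category.comp_id, Category.id_comp]
  | cons L D ih =>
    simp only [beadedTail, diagramMap]
    rw [beads_one (F := F), Category.assoc, Category.assoc, ih,
      ← tensorHoms_comp_layerMap_comp h h' i j hij L]
    simp only [Category.assoc]

/-- The value of a connected diagram is compatible with direct summands. -/
theorem comp_RT_of_retract (i : G ⟶ G') (j : G' ⟶ G) (hij : i ≫ j = 𝟙 G)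
    {D : Diagram [up] [up]} (hD : D.IsConnected) : i ≫ RT h' D = RT h D ≫ i := by
  apply whisker_rightUnitor_conj
  let S : End G' := j ≫ i
  -- `S` is the idempotent projecting `G'` onto its summand `G`.
  have hT : ∀ k : ℕ, k ≠ 0 → S ^ k = S := by
    intro k hk
    induction k with
    | zero => exact absurd rfl hk
    | succ k ih =>
      rcases Nat.eq_zero_or_pos k with rfl | hk'
      · rw [zero_add, pow_one]
      · rw [pow_succ, ih hk'.ne']
        change (j ≫ i) ≫ j ≫ i = j ≫ i
        rw [Category.assoc, reassoc_of% hij]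
  -- The exponent must not vanish, since `S ^ 0` is the identity and not `S`; the bottom endpoint is
  -- a point of every diagram.
  have hcard : (D.points 0).card ≠ 0 := by
    refine Finset.card_ne_zero_of_mem (a := (0, 0)) ?_
    have := (Diagram.nil [up]).mem_points_comp D 0 0 (by simp)
    simpa [Diagram.comp, Diagram.height] using this
  -- The diagram with `S` everywhere is computed twice: sliding all beads down gives `S` followed by
  -- the value for `G'`, while cutting each bead gives `j`, the value for `G`, then `i`. Composing
  -- with `i` cancels `j`.
  have h1 := beaded_one h' S hD
  rw [hT _ hcard, beaded, beads_one (F := F), Category.assoc, tensorHoms_comp_beadedTail h h' i j hij]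
    at h1
  have hup : ∀ {X X' Y Y' : B} [ExactPairing X Y] [ExactPairing X' Y'] (f : X ⟶ X') (g : X' ⟶ X),
      tensorHoms (F := Y) (F' := Y') f g [up] = f ▷ 𝟙_ B := by
    intros
    simp only [tensorHoms, tensorHom_id]
    rfl
  rw [hup, hup] at h1
  have h2 := congrArg (fun f => i ▷ 𝟙_ B ≫ f) h1
  simp only [← comp_whiskerRight_assoc] at h2
  rw [hij, reassoc_of% hij] at h2
  rw [← h2, MonoidalCategory.id_whiskerRight]
  exact Category.id_comp _

end Summand

end LongKnotInvariant

end

noncomputable section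

namespace LongKnotInvariant

open CategoryTheory MonoidalCategory BraidedCategory Strand

universe v₁ u₁

/-! ### The writhe of the normalization is additive and local. -/

section Writhe

theorem Diagram.writhe_comp {a b c : List Strand} (P : Diagram a b) (Q : Diagram b c) :
    (P.comp Q).writhe = P.writhe + Q.writhe := by
  induction P with
  | nil a => simp [Diagram.comp, Diagram.writhe]
  | cons L P ih => simp [Diagram.comp, Diagram.writhe, ih, add_assoc]

theorem Layer.writhe_whiskerLeft (l : List Strand) {a b : List Strand} (L : Layer a b) :
    (L.whiskerLeft l).writhe = L.writhe := by
  induction l with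
  | nil => rfl
  | cons s l ih => exact ih

theorem Diagram.writhe_whiskerLeft (l : List Strand) {a b : List Strand} (D : Diagram a b) :
    (D.whiskerLeft l).writhe = D.writhe := by
  induction D with
  | nil a => rfl
  | cons L D ih => simp [Diagram.whiskerLeft, Diagram.writhe, ih, Layer.writhe_whiskerLeft]

theorem Diagram.comp_assoc {a b c d : List Strand} (P : Diagram a b) (Q : Diagram b c)
    (R : Diagram c d) : (P.comp Q).comp R = P.comp (Q.comp R) := by
  induction P with
  | nil a => rfl
  | cons L P ih => simp only [Diagram.comp, ih]

theorem Diagram.normalize_comp {a b c : List Strand} (P : Diagram a b) (Q : Diagram b c) :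
    (P.comp Q).normalize = P.normalize.comp Q.normalize := by
  induction P with
  | nil a => rfl
  | cons L P ih => simp only [Diagram.comp, Diagram.normalize, ih, Diagram.comp_assoc]

theorem Layer.writhe_normalize_whiskerLeft (l : List Strand) {a b : List Strand} (L : Layer a b) :
    (L.whiskerLeft l).normalize.writhe = L.normalize.writhe := by
  induction l with
  | nil => rfl
  | cons s l ih => exact (Diagram.writhe_whiskerLeft [s] _).trans ih

theorem Layer.writhe_normalize_skip (s : Strand) {a b : List Strand} (L : Layer a b) :
    (Layer.skip s L).normalize.writhe = L.normalize.writhe :=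
  Layer.writhe_normalize_whiskerLeft [s] L

theorem Layer.writhe_normalize_whiskerRight (r : List Strand) {a b : List Strand} (L : Layer a b) :
    (L.whiskerRight r).normalize.writhe = L.normalize.writhe := by
  induction L with
  | skip s L ih =>
    exact ((Layer.writhe_normalize_skip s _).trans ih).trans (Layer.writhe_normalize_skip s L).symm
  | cross o s t r => cases o <;> rfl
  | _ => rfl

theorem Diagram.writhe_normalize_cons {a b c : List Strand} (L : Layer a b) (D : Diagram b c) :
    (Diagram.cons L D).normalize.writhe = L.normalize.writhe + D.normalize.writhe :=
  Diagram.writhe_comp _ _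

theorem Diagram.writhe_normalize_whiskerLeft (l : List Strand) {a b : List Strand}
    (D : Diagram a b) : (D.whiskerLeft l).normalize.writhe = D.normalize.writhe := by
  induction D with
  | nil a => rfl
  | cons L D ih =>
    rw [Diagram.whiskerLeft, Diagram.writhe_normalize_cons, Diagram.writhe_normalize_cons, ih,
      Layer.writhe_normalize_whiskerLeft]

end Writhe

/-! ### Functoriality of the evaluation, normalization, exchange of heights. -/

section Functoriality

variable {B : Type u₁} [Category.{v₁} B] [MonoidalCategory B] [BraidedCategory B]
  {G F : B} [ExactPairing G F] (h : IsRigidRMatrix F (β_ G G).hom)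

theorem diagramMap_comp {a b c : List Strand} (P : Diagram a b) (Q : Diagram b c) :
    diagramMap h (P.comp Q) = diagramMap h P ≫ diagramMap h Q := by
  induction P with
  | nil a => exact (Category.id_comp _).symm
  | cons L P ih => simp only [Diagram.comp, diagramMap, ih, Category.assoc]

variable (G F) in
/-- A morphism with vertical strands added on the left. -/
def whiskerObjs : (l : List Strand) → {a b : List Strand} →
    (tensorObjs G F a ⟶ tensorObjs G F b) → (tensorObjs G F (l ++ a) ⟶ tensorObjs G F (l ++ b))
  | [], _, _, f => f
  | s :: l, _, _, f => strandObj G F s ◁ whiskerObjs l f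

omit [MonoidalCategory B] [BraidedCategory B] [ExactPairing G F] in
theorem whiskerObjs_id [MonoidalCategory B] (l : List Strand) (a : List Strand) :
    whiskerObjs G F l (𝟙 (tensorObjs G F a)) = 𝟙 (tensorObjs G F (l ++ a)) := by
  induction l with
  | nil => rfl
  | cons s l ih => exact (congrArg _ ih).trans (whiskerLeft_id _ _)

omit [MonoidalCategory B] [BraidedCategory B] [ExactPairing G F] in
theorem whiskerObjs_comp [MonoidalCategory B] (l : List Strand) {a b c : List Strand}
    (f : tensorObjs G F a ⟶ tensorObjs G F b) (g : tensorObjs G F b ⟶ tensorObjs G F c) :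
    whiskerObjs G F l (f ≫ g) = whiskerObjs G F l f ≫ whiskerObjs G F l g := by
  induction l with
  | nil => rfl
  | cons s l ih => exact (congrArg _ ih).trans (whiskerLeft_comp _ _ _)

theorem layerMap_whiskerLeft (l : List Strand) {a b : List Strand} (L : Layer a b) :
    layerMap h (L.whiskerLeft l) = whiskerObjs G F l (layerMap h L) := by
  induction l with
  | nil => rfl
  | cons s l ih => exact congrArg _ ih

theorem diagramMap_whiskerLeft (l : List Strand) {a b : List Strand} (D : Diagram a b) :
    diagramMap h (D.whiskerLeft l) = whiskerObjs G F l (diagramMap h D) := by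
  induction D with
  | nil a => exact (whiskerObjs_id l a).symm
  | cons L D ih =>
    simp only [Diagram.whiskerLeft, diagramMap]
    rw [ih, layerMap_whiskerLeft, whiskerObjs_comp]

theorem diagramMap_one {a b : List Strand} (L : Layer a b) :
    diagramMap h (.one L) = layerMap h L := Category.comp_id _

theorem diagramMap_two {a b c : List Strand} (L : Layer a b) (M : Layer b c) :
    diagramMap h (.two L M) = layerMap h L ≫ layerMap h M :=
  congrArg _ (Category.comp_id _)

theorem diagramMap_three {a b c d : List Strand} (L : Layer a b) (M : Layer b c) (N : Layer c d) :
    diagramMap h (.three L M N) = layerMap h L ≫ layerMap h M ≫ layerMap h N :=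
  congrArg _ (diagramMap_two h M N)

/-- The normalization does not change the value of a slice. -/
theorem diagramMap_layer_normalize {a b : List Strand} (L : Layer a b) :
    diagramMap h L.normalize = layerMap h L := by
  induction L with
  | capL r => exact diagramMap_one h _
  | cupL r => exact diagramMap_one h _
  | cross o s t r => exact diagramMap_one h _
  | capR r =>
    refine (diagramMap_two h _ _).trans ?_
    rw [layerMap_cross, layerMap_capL, layerMap_capR]
    simp only [crossAt, capAt, twistedCap, Category.assoc, Iso.hom_inv_id_assoc, comp_whiskerRight]
  | cupR r =>
    refine (diagramMap_two h _ _).trans ?_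
    rw [layerMap_cross, layerMap_cupL, layerMap_cupR]
    simp only [crossAt, cupAt, twistedCup, Category.assoc, Iso.hom_inv_id_assoc, comp_whiskerRight]
  | skip s L ih => exact (diagramMap_whiskerLeft h [s] _).trans (congrArg _ ih)

/-- Extrema from left to right are evaluated by `layerMap` with the crossing already built in. Hence
the normalization affects the invariant only through the writhe. -/
theorem diagramMap_normalize {a b : List Strand} (D : Diagram a b) :
    diagramMap h D.normalize = diagramMap h D := by
  induction D with
  | nil a => rfl
  | cons L D ih =>
    rw [Diagram.normalize, diagramMap_comp, ih, diagramMap_layer_normalize, diagramMap]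

/-- Distant slices can be exchanged. -/
theorem layerMap_interchange {a b c d : List Strand} (f : Layer a b) (g : Layer c d) :
    layerMap h (f.whiskerRight c) ≫ layerMap h (g.whiskerLeft b) =
      layerMap h (g.whiskerLeft a) ≫ layerMap h (f.whiskerRight d) := by
  induction f with
  | skip s f ih =>
    exact (whiskerLeft_comp _ _ _).symm.trans
      ((congrArg _ ih).trans (whiskerLeft_comp _ _ _))
  | capL r =>
    have := tensor_comp_capAt (𝟙 F) (𝟙 G) (layerMap h (g.whiskerLeft r)) (ε_ G F)
    simp only [id_tensorHom, whiskerLeft_id, Category.id_comp] at this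
    exact this.symm
  | capR r =>
    have := tensor_comp_capAt (𝟙 G) (𝟙 F) (layerMap h (g.whiskerLeft r)) (twistedCap G F true)
    simp only [id_tensorHom, whiskerLeft_id, Category.id_comp] at this
    exact ((congrArg (· ≫ layerMap h (g.whiskerLeft r)) (layerMap_capR h (r ++ c))).trans
      this.symm).trans (congrArg _ (layerMap_capR h (r ++ d)).symm)
  | cupL r =>
    have := cupAt_comp_tensor (𝟙 G) (𝟙 F) (layerMap h (g.whiskerLeft r)) (η_ G F)
    simp only [id_tensorHom, whiskerLeft_id, Category.comp_id] at this
    exact this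
  | cupR r =>
    have := cupAt_comp_tensor (𝟙 F) (𝟙 G) (layerMap h (g.whiskerLeft r)) (twistedCup G F false)
    simp only [id_tensorHom, whiskerLeft_id, Category.comp_id] at this
    exact ((congrArg (· ≫ F ◁ G ◁ layerMap h (g.whiskerLeft r)) (layerMap_cupR h (r ++ c))).trans
      this).trans (congrArg _ (layerMap_cupR h (r ++ d)).symm)
  | cross o s t r =>
    have := tensor_comp_crossAt (𝟙 (strandObj G F s)) (𝟙 (strandObj G F t))
      (layerMap h (g.whiskerLeft r)) (crossing o (strandObj G F s) (strandObj G F t))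
    simp only [id_tensorHom, whiskerLeft_id, Category.id_comp] at this
    exact ((congrArg (· ≫ strandObj G F t ◁ strandObj G F s ◁ layerMap h (g.whiskerLeft r))
      (layerMap_cross h o s t (r ++ c))).trans this.symm).trans
      (congrArg _ (layerMap_cross h o s t (r ++ d)).symm)

end Functoriality

end LongKnotInvariant

end

noncomputable section

namespace LongKnotInvariant

open CategoryTheory MonoidalCategory BraidedCategory Strand

universe v₁ u₁

/-! ### Local identities with further strands to the right. -/

section TailIdentities

variable {B : Type u₁} [Category.{v₁} B] [MonoidalCategory B]

theorem crossAt_comp_crossAt {P Q P' Q' P'' Q'' : B} (c : P ⊗ Q ⟶ P' ⊗ Q')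
    (d : P' ⊗ Q' ⟶ P'' ⊗ Q'') (Y : B) : crossAt c Y ≫ crossAt d Y = crossAt (c ≫ d) Y := by
  simp [crossAt]

theorem crossAt_comp_capAt {P Q P' Q' : B} (c : P ⊗ Q ⟶ P' ⊗ Q') (e : P' ⊗ Q' ⟶ 𝟙_ B) (Y : B) :
    crossAt c Y ≫ capAt e Y = capAt (c ≫ e) Y := by
  simp [crossAt, capAt]

theorem cupAt_comp_crossAt {P Q P' Q' : B} (n : 𝟙_ B ⟶ P ⊗ Q) (c : P ⊗ Q ⟶ P' ⊗ Q') (Y : B) :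
    cupAt n Y ≫ crossAt c Y = cupAt (n ≫ c) Y := by
  simp [crossAt, cupAt]

theorem zigzag_left_at {P Q : B} {n : 𝟙_ B ⟶ Q ⊗ P} {e : P ⊗ Q ⟶ 𝟙_ B}
    (hz : P ◁ n ⊗≫ e ▷ P = ⊗𝟙.hom) (Y : B) : P ◁ cupAt n Y ≫ capAt e (P ⊗ Y) = 𝟙 (P ⊗ Y) := by
  calc _ = 𝟙 _ ⊗≫ (P ◁ n ⊗≫ e ▷ P) ▷ Y ⊗≫ 𝟙 _ := by dsimp only [cupAt, capAt]; monoidal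
    _ = _ := by rw [hz]; monoidal

theorem zigzag_right_at {P Q : B} {n : 𝟙_ B ⟶ P ⊗ Q} {e : Q ⊗ P ⟶ 𝟙_ B}
    (hz : n ▷ P ⊗≫ P ◁ e = ⊗𝟙.hom) (Y : B) : cupAt n (P ⊗ Y) ≫ P ◁ capAt e Y = 𝟙 (P ⊗ Y) := by
  calc _ = 𝟙 _ ⊗≫ (n ▷ P ⊗≫ P ◁ e) ▷ Y ⊗≫ 𝟙 _ := by dsimp only [cupAt, capAt]; monoidal
    _ = _ := by rw [hz]; monoidal

variable [BraidedCategory B]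

theorem crossAt_comp_whiskerLeft_capAt (o : Bool) {P Q : B} (e : P ⊗ Q ⟶ 𝟙_ B) (S Y : B) :
    crossAt (crossing o P S) (Q ⊗ Y) ≫ S ◁ capAt e Y =
      P ◁ crossAt (crossing (!o) S Q) Y ≫ capAt e (S ⊗ Y) := by
  calc _ = 𝟙 _ ⊗≫ (crossing o P S ▷ Q ⊗≫ S ◁ e) ▷ Y ⊗≫ 𝟙 _ := by
        dsimp only [crossAt, capAt]; monoidal
    _ = _ := by rw [crossing_slide_to_unit]; dsimp only [crossAt, capAt]; monoidal

theorem whiskerLeft_cupAt_comp_crossAt (o : Bool) {P Q : B} (n : 𝟙_ B ⟶ P ⊗ Q) (S Y : B) :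
    S ◁ cupAt n Y ≫ crossAt (crossing o S P) (Q ⊗ Y) =
      cupAt n (S ⊗ Y) ≫ P ◁ crossAt (crossing (!o) Q S) Y := by
  calc _ = 𝟙 _ ⊗≫ (S ◁ n ⊗≫ crossing o S P ▷ Q) ▷ Y ⊗≫ 𝟙 _ := by
        dsimp only [crossAt, cupAt]; monoidal
    _ = _ := by rw [crossing_slide_from_unit]; dsimp only [crossAt, cupAt]; monoidal

theorem crossAt_yangBaxter (o₁₂ o₁₃ o₂₃ : Bool) (h : o₁₂ = o₂₃ → o₁₃ = o₁₂) (X Y Z W : B) :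
    crossAt (crossing o₁₂ X Y) (Z ⊗ W) ≫ Y ◁ crossAt (crossing o₁₃ X Z) W ≫
        crossAt (crossing o₂₃ Y Z) (X ⊗ W) =
      X ◁ crossAt (crossing o₂₃ Y Z) W ≫ crossAt (crossing o₁₃ X Z) (Y ⊗ W) ≫
        Z ◁ crossAt (crossing o₁₂ X Y) W := by
  calc _ = 𝟙 _ ⊗≫ (crossing o₁₂ X Y ▷ Z ⊗≫ Y ◁ crossing o₁₃ X Z ⊗≫
          crossing o₂₃ Y Z ▷ X) ▷ W ⊗≫ 𝟙 _ := by
        dsimp only [crossAt]; monoidal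
    _ = _ := by rw [crossing_yangBaxter _ _ _ h]; dsimp only [crossAt]; monoidal

end TailIdentities

/-! ### The effect of each local move. -/

section Moves

variable {B : Type u₁} [Category.{v₁} B] [MonoidalCategory B] [BraidedCategory B]
  {G F : B} [ExactPairing G F] (h : IsRigidRMatrix F (β_ G G).hom)

variable (G F) in
/-- The powers of the positive curl. -/
def curlPow (k : ℤ) : End G := (curlIso G F ^ k : Aut G).hom

theorem curlPow_one : curlPow G F 1 = curl G F false := by simp [curlPow]

theorem curlPow_neg_one : curlPow G F (-1) = curl G F true := by
  rw [curlPow, zpow_neg_one]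
  rfl

theorem curlPow_add (k l : ℤ) : curlPow G F (k + l) = curlPow G F l ≫ curlPow G F k := by
  rw [curlPow, zpow_add]
  rfl

/-- The effect of a move on the writhe of the normalization and on the value of a diagram. -/
theorem Move.effect {a b : List Strand} {X Y : Diagram a b} (m : Move X Y) :
    ∃ k : ℤ, X.normalize.writhe = Y.normalize.writhe + 2 * k ∧
      ((k = 0 ∧ diagramMap h X = diagramMap h Y) ∨
        (∃ i < a.length, diagramMap h X =
          beads (curlPow G F k) (fun j => if j = i then 1 else 0) a ≫ diagramMap h Y) ∨
        (∃ i < b.length, diagramMap h X =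
          diagramMap h Y ≫ beads (curlPow G F k) (fun j => if j = i then 1 else 0) b)) := by
  cases m with
  | interchange f g =>
    refine ⟨0, ?_, Or.inl ⟨rfl, ?_⟩⟩
    · simp only [Diagram.two, Diagram.one, Diagram.writhe_normalize_cons,
        Layer.writhe_normalize_whiskerLeft, Layer.writhe_normalize_whiskerRight]
      change _ + (_ + (0 : ℤ)) = _ + (_ + (0 : ℤ)) + _
      omega
    · rw [diagramMap_two, diagramMap_two, layerMap_interchange]
  | zigzagUpR r =>
    refine ⟨0, rfl, Or.inl ⟨rfl, ?_⟩⟩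
    rw [diagramMap_two, layerMap_skip, layerMap_cupR, layerMap_capR]
    exact zigzag_left_at (twisted_zigzag_left G F true) _
  | zigzagUpL r =>
    refine ⟨0, rfl, Or.inl ⟨rfl, ?_⟩⟩
    rw [diagramMap_two, layerMap_skip, layerMap_cupL, layerMap_capL]
    exact zigzag_right_at (ExactPairing.evaluation_coevaluation'' G F) _
  | zigzagDownR r =>
    refine ⟨0, rfl, Or.inl ⟨rfl, ?_⟩⟩
    rw [diagramMap_two, layerMap_skip, layerMap_cupL, layerMap_capL]
    exact zigzag_left_at (ExactPairing.coevaluation_evaluation'' G F) _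
  | zigzagDownL r =>
    refine ⟨0, rfl, Or.inl ⟨rfl, ?_⟩⟩
    rw [diagramMap_two, layerMap_skip, layerMap_cupR, layerMap_capR]
    exact zigzag_right_at (twisted_zigzag_right G F true) _
  | slideCapL o s r =>
    -- The flag of the crossing and the direction of one of its strands are both reversed, so its
    -- sign is unchanged; the same holds for the other slides.
    refine ⟨0, by cases o <;> cases s <;> rfl, Or.inl ⟨rfl, ?_⟩⟩
    simp only [diagramMap_two, layerMap_skip, layerMap_cross, layerMap_capL]
    exact crossAt_comp_whiskerLeft_capAt o (ε_ G F) (strandObj G F s) (tensorObjs G F r)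
  | slideCapR o s r =>
    refine ⟨0, by cases o <;> cases s <;> rfl, Or.inl ⟨rfl, ?_⟩⟩
    simp only [diagramMap_two, layerMap_skip, layerMap_cross, layerMap_capR]
    exact crossAt_comp_whiskerLeft_capAt o (twistedCap G F true) (strandObj G F s)
      (tensorObjs G F r)
  | slideCupL o s r =>
    refine ⟨0, by cases o <;> cases s <;> rfl, Or.inl ⟨rfl, ?_⟩⟩
    simp only [diagramMap_two, layerMap_skip, layerMap_cross, layerMap_cupL]
    exact whiskerLeft_cupAt_comp_crossAt o (η_ G F) (strandObj G F s) (tensorObjs G F r)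
  | slideCupR o s r =>
    refine ⟨0, by cases o <;> cases s <;> rfl, Or.inl ⟨rfl, ?_⟩⟩
    simp only [diagramMap_two, layerMap_skip, layerMap_cross, layerMap_cupR]
    exact whiskerLeft_cupAt_comp_crossAt o (twistedCup G F false) (strandObj G F s)
      (tensorObjs G F r)
  -- The normalization of `capR` contains a crossing with flag `true`, of sign -1. For `o = true`
  -- both sides agree; for `o = false` the left side has sign +1, so the writhe grows by 2 and one
  -- positive curl appears on the upward leg. The other three kinds are similar, with the bead at
  -- the top in the case of minima.
  | reidOneCapR o r =>
    cases o
    · refine ⟨1, rfl, Or.inr (Or.inl ⟨0, by simp, ?_⟩)⟩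
      have h1 := beads_capR h (curlPow G F 1) (fun j => if j = 0 then 1 else 0) (fun _ => 0) b
      simp only [beads_zero, Category.comp_id] at h1
      rw [diagramMap_two, diagramMap_one, h1, layerMap_cross, layerMap_capL]
      simp only [Nat.add_eq_zero_iff, OfNat.ofNat_ne_zero, and_false, if_false, add_zero,
        beads_zero, Category.comp_id, if_true, one_ne_zero, pow_one, curlPow_one]
      rw [← Bool.not_false, curl_whiskerRight_comp_twistedCap]
      exact crossAt_comp_capAt _ _ _
    · refine ⟨0, rfl, Or.inl ⟨rfl, ?_⟩⟩
      rw [diagramMap_two, diagramMap_one, layerMap_cross, layerMap_capL, layerMap_capR]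
      exact crossAt_comp_capAt _ _ _
  | reidOneCapL o r =>
    cases o
    · refine ⟨0, rfl, Or.inl ⟨rfl, ?_⟩⟩
      rw [diagramMap_two, diagramMap_one, layerMap_cross, layerMap_capL, layerMap_capR]
      refine (crossAt_comp_capAt _ _ _).trans ?_
      rw [twistedCap]
      exact congrArg (capAt · _)
        ((Category.assoc _ _ _).symm.trans ((congrArg (· ≫ ε_ G F)
          (crossing_comp_crossing false F G)).trans (Category.id_comp _)))
    · refine ⟨-1, rfl, Or.inr (Or.inl ⟨1, by simp, ?_⟩)⟩
      have h1 := beads_capL h (curlPow G F (-1)) (fun j => if j = 1 then 1 else 0) (fun _ => 0) b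
      simp only [beads_zero, Category.comp_id] at h1
      rw [diagramMap_two, diagramMap_one, h1, layerMap_cross, layerMap_capR]
      simp only [Nat.reduceEqDiff, zero_ne_one, add_zero, zero_add,
        beads_zero, Category.comp_id, if_true, if_false, pow_one, curlPow_neg_one]
      refine (crossAt_comp_capAt _ _ _).trans (congrArg (capAt · _) ?_)
      have hc : crossing true F G ≫ crossing false G F = 𝟙 _ := crossing_comp_crossing true F G
      -- The twisted maximum is replaced by one of the opposite flag with a curl. The curl slides
      -- back through the first crossing, and the two crossings become inverse to each other.
      rw [← curl_whiskerRight_comp_twistedCap, twistedCap]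
      simp only [strandObj]
      rw [← reassoc_of% @crossing_naturality_right, Bool.not_true,
        ← Category.assoc (crossing true F G), hc, Category.id_comp]
  | reidOneCupR o r =>
    cases o
    · refine ⟨0, rfl, Or.inl ⟨rfl, ?_⟩⟩
      rw [diagramMap_two, diagramMap_one, layerMap_cross, layerMap_cupL, layerMap_cupR]
      exact cupAt_comp_crossAt _ _ _
    · refine ⟨-1, rfl, Or.inr (Or.inr ⟨1, by simp, ?_⟩)⟩
      have h1 := beads_cupR h (curlPow G F (-1)) (fun _ => 0) (fun j => if j = 1 then 1 else 0) a
      simp only [beads_zero, Category.id_comp] at h1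
      rw [diagramMap_two, diagramMap_one, h1, layerMap_cross, layerMap_cupL]
      simp only [Nat.reduceEqDiff, zero_ne_one, add_zero, zero_add,
        beads_zero, Category.id_comp, if_true, if_false, pow_one, curlPow_neg_one]
      rw [← Bool.not_true, twistedCup_comp_whiskerLeft_curl]
      exact cupAt_comp_crossAt _ _ _
  | reidOneCupL o r =>
    cases o
    · refine ⟨1, rfl, Or.inr (Or.inr ⟨0, by simp, ?_⟩)⟩
      have h1 := beads_cupL h (curlPow G F 1) (fun _ => 0) (fun j => if j = 0 then 1 else 0) a
      simp only [beads_zero, Category.id_comp] at h1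
      rw [diagramMap_two, diagramMap_one, h1, layerMap_cross, layerMap_cupR]
      simp only [Nat.add_eq_zero_iff, OfNat.ofNat_ne_zero, and_false, if_false, add_zero,
        beads_zero, Category.id_comp, if_true, one_ne_zero, pow_one, curlPow_one]
      -- As for the maximum: the flag of the minimum is changed at the cost of a curl, which slides
      -- through the second crossing before the two crossings cancel.
      refine (cupAt_comp_crossAt _ _ _).trans (congrArg (cupAt · _) ?_)
      have hc : crossing true G F ≫ crossing false F G = 𝟙 _ := crossing_comp_crossing true G F
      rw [← twistedCup_comp_whiskerLeft_curl, twistedCup]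
      simp only [strandObj, Category.assoc]
      rw [crossing_naturality_right, Bool.not_false,
        ← Category.assoc (crossing true G F), hc, Category.id_comp]
    · refine ⟨0, rfl, Or.inl ⟨rfl, ?_⟩⟩
      rw [diagramMap_two, diagramMap_one, layerMap_cross, layerMap_cupL, layerMap_cupR]
      refine (cupAt_comp_crossAt _ _ _).trans (congrArg (cupAt · _) ?_)
      have hc : crossing false G F ≫ crossing true F G = 𝟙 _ := crossing_comp_crossing false G F
      rw [twistedCup, Category.assoc]
      simp only [strandObj]
      rw [hc, Category.comp_id]
  | reidTwo o s t r =>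
    refine ⟨0, by cases o <;> cases s <;> cases t <;> rfl, Or.inl ⟨rfl, ?_⟩⟩
    rw [diagramMap_two, layerMap_cross, layerMap_cross, crossAt_comp_crossAt,
      crossing_comp_crossing]
    simp [crossAt, diagramMap]
  | reidThree o₁₂ o₁₃ o₂₃ ho s₁ s₂ s₃ r =>
    refine ⟨0, ?_, Or.inl ⟨rfl, ?_⟩⟩
    · simp only [Diagram.three, Diagram.two, Diagram.one, Diagram.writhe_normalize_cons,
        Layer.writhe_normalize_skip]
      have hw : ∀ o s t r r', (Layer.cross o s t r).normalize.writhe =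
          (Layer.cross o s t r').normalize.writhe := by
        intro o s t r r'; cases o <;> rfl
      rw [hw o₁₂ _ _ _ r, hw o₁₃ _ _ (s₂ :: r) r, hw o₂₃ _ _ _ r]
      simp only [Diagram.normalize, Diagram.writhe]
      ring
    · simp only [diagramMap_three, layerMap_skip, layerMap_cross]
      exact crossAt_yangBaxter o₁₂ o₁₃ o₂₃ ho (strandObj G F s₁) (strandObj G F s₂)
        (strandObj G F s₃) (tensorObjs G F r)

end Moves

end LongKnotInvariant

end

noncomputable section

namespace LongKnotInvariant

open CategoryTheory MonoidalCategory BraidedCategory Strand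

universe v₁ u₁

/-! ### Naturality of the curl. -/

section CurlNaturality

variable {B : Type u₁} [Category.{v₁} B] [MonoidalCategory B] [BraidedCategory B]
  {G F G' F' : B} [ExactPairing G F] [ExactPairing G' F']

theorem twistedCup_comp_whiskerLeft (o : Bool) (f : G ⟶ G') :
    twistedCup G F o ≫ F ◁ f = twistedCup G' F' o ≫ mate F F' f ▷ G' := by
  rw [twistedCup, twistedCup, Category.assoc, ← crossing_naturality_left, ← Category.assoc,
    ← coevaluation_comp_mate (F := F) (F' := F'), Category.assoc, crossing_naturality_right, Category.assoc]

theorem whiskerLeft_mate_comp_twistedCap (o : Bool) (f : G ⟶ G') :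
    G ◁ mate F F' f ≫ twistedCap G F o = f ▷ F' ≫ twistedCap G' F' o := by
  rw [twistedCap, twistedCap, reassoc_of% @crossing_naturality_right, mate_comp_evaluation,
    reassoc_of% @crossing_naturality_left]

/-- The map passes through the minimum, becoming its mate on the downward piece, and returns to
itself at the maximum. The dual objects on the two sides need not be related. -/
theorem curl_comp (o : Bool) (f : G ⟶ G') : curl G F o ≫ f = f ≫ curl G' F' o := by
  calc _ = 𝟙 _ ⊗≫ G ◁ twistedCup G F o ⊗≫ (twistedCap G F o ▷ G ≫ 𝟙_ B ◁ f) ⊗≫ 𝟙 _ := by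
        dsimp only [curl]; monoidal
    _ = 𝟙 _ ⊗≫ G ◁ (twistedCup G F o ≫ F ◁ f) ⊗≫ twistedCap G F o ▷ G' ⊗≫ 𝟙 _ := by
        rw [← whisker_exchange]; monoidal
    _ = 𝟙 _ ⊗≫ G ◁ twistedCup G' F' o ⊗≫ (G ◁ mate F F' f ≫ twistedCap G F o) ▷ G' ⊗≫ 𝟙 _ := by
        rw [twistedCup_comp_whiskerLeft (F' := F')]; monoidal
    _ = 𝟙 _ ⊗≫ (G ◁ twistedCup G' F' o ≫ f ▷ (F' ⊗ G')) ⊗≫ twistedCap G' F' o ▷ G' ⊗≫ 𝟙 _ := by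
        rw [whiskerLeft_mate_comp_twistedCap]; monoidal
    _ = _ := by rw [whisker_exchange]; dsimp only [curl]; monoidal

theorem curlPow_comp (k : ℤ) (f : G ⟶ G') : curlPow G F k ≫ f = f ≫ curlPow G' F' k := by
  induction k using Int.induction_on with
  | zero => exact (Category.id_comp f).trans (Category.comp_id f).symm
  | succ n ih =>
    rw [curlPow_add, curlPow_add, curlPow_one, curlPow_one, Category.assoc, ih,
      reassoc_of% (curl_comp (F := F) (F' := F'))]
  | pred n ih =>
    rw [sub_eq_add_neg, curlPow_add, curlPow_add, curlPow_neg_one, curlPow_neg_one, Category.assoc,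
      ih, reassoc_of% (curl_comp (F := F) (F' := F'))]

end CurlNaturality

/-! ### Invariance of the writhe-corrected evaluation. -/

section Invariance

variable {B : Type u₁} [Category.{v₁} B] [MonoidalCategory B] [BraidedCategory B]
  {G F G' F' : B} [ExactPairing G F] [ExactPairing G' F'] (h : IsRigidRMatrix F (β_ G G).hom)
  (h' : IsRigidRMatrix F' (β_ G' G').hom)

theorem RT_comp (P Q : Diagram [up] [up]) : RT h (P.comp Q) = RT h P ≫ RT h Q := by
  simp [RT, diagramMap_comp]

theorem RT_normalize (D : Diagram [up] [up]) : RT h D.normalize = RT h D := by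
  rw [RT, diagramMap_normalize, RT]

theorem RT_xiPos : RT h xiPos = curl G F false := by
  simp only [RT, xiPos, diagramMap, layerMap_skip, layerMap_cupL, layerMap_cross, layerMap_capL]
  dsimp only [curl, twistedCup, twistedCap, cupAt, crossAt, capAt]
  monoidal

theorem RT_xiNeg : RT h xiNeg = curl G F true := by
  simp only [RT, xiNeg, diagramMap, layerMap_skip, layerMap_cupL, layerMap_cross, layerMap_capL]
  dsimp only [curl, twistedCup, twistedCap, cupAt, crossAt, capAt]
  monoidal

theorem RT_xi (n : ℤ) : RT h (xi n) = curlPow G F n := by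
  have key : ∀ n : ℕ, RT h (xiPos.iterate n) = curlPow G F n ∧
      RT h (xiNeg.iterate n) = curlPow G F (-n) := by
    intro n
    induction n with
    | zero =>
      have h1 : RT h (.nil [up]) = curlPow G F 0 := by
        simp only [RT, diagramMap, Category.id_comp, Iso.inv_hom_id]
        rfl
      exact ⟨h1, h1⟩
    | succ n ih =>
      rw [Diagram.iterate, Diagram.iterate, RT_comp, RT_comp, ih.1, ih.2, RT_xiPos, RT_xiNeg,
        Nat.cast_succ, neg_add, curlPow_add, curlPow_add, curlPow_one, curlPow_neg_one]
      exact ⟨rfl, rfl⟩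
  cases n with
  | ofNat n => exact (key n).1
  | negSucc n => exact (key (n + 1)).2

/-- ξ⁺ and ξ⁻ evaluate to the positive and negative curl, which are mutually inverse. The correction
is thus an integral power of one automorphism. -/
theorem invariantJ_eq (D : LongKnotDiagram) :
    invariantJ h D = curlPow G F (-(D.1.normalize.writhe / 2)) ≫ RT h D.1 := by
  rw [invariantJ, RT_comp, RT_xi, RT_normalize]

theorem invariantJ_comm (D : LongKnotDiagram) (T : G ⟶ G) :
    T ≫ invariantJ h D = invariantJ h D ≫ T := by
  rw [invariantJ_eq, ← reassoc_of% (curlPow_comp (F := F) (F' := F)), Category.assoc, comp_RT_comm h T D.2]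

theorem comp_invariantJ_of_retract (D : LongKnotDiagram) (i : G ⟶ G') (j : G' ⟶ G)
    (hij : i ≫ j = 𝟙 G) : i ≫ invariantJ h' D = invariantJ h D ≫ i := by
  rw [invariantJ_eq, invariantJ_eq, ← reassoc_of% (curlPow_comp (F := F) (F' := F')), Category.assoc,
    comp_RT_of_retract h h' i j hij D.2]

omit [BraidedCategory B] in
theorem whiskerObjs_beads (T : End G) (l : List Strand) (i : ℕ) (a : List Strand) :
    whiskerObjs G F l (beads (F := F) T (fun j => if j = i then 1 else 0) a) =
      beads T (fun j => if j = l.length + i then 1 else 0) (l ++ a) := by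
  induction l with
  | nil => simp [whiskerObjs]
  | cons s l ih =>
    rw [whiskerObjs, ih]
    simp only [List.cons_append, beads, List.length_cons]
    have h0 : (if 0 = l.length + 1 + i then 1 else 0) = 0 := if_neg (by omega)
    rw [h0, pow_zero]
    rw [End.one_def, strandHom_id, id_tensorHom]
    congr 3
    funext j
    simp only [add_right_comm, Nat.add_right_cancel_iff]

/-- A move deep inside the diagram produces a power of the curl at some point of `E`. As `E` is
connected, it slides to the bottom, wherever the move took place. -/
theorem Step.effect {D E : Diagram [up] [up]} (s : Step D E) (hE : E.IsConnected) :
    ∃ k : ℤ, D.normalize.writhe = E.normalize.writhe + 2 * k ∧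
      RT h D = curlPow G F k ≫ RT h E := by
  obtain ⟨l, P, m, Q⟩ := s
  rename_i X Y
  obtain ⟨k, hk, hm⟩ := m.effect h
  refine ⟨k, ?_, ?_⟩
  · simp only [Diagram.normalize_comp, Diagram.writhe_comp, Diagram.writhe_normalize_whiskerLeft]
    omega
  · simp only [RT]
    have h1 : ∀ T : End G, T ≫ (ρ_ G).inv = (ρ_ G).inv ≫ T ▷ 𝟙_ B := by simp
    suffices hs : diagramMap h (P.comp ((X.whiskerLeft l).comp Q)) =
        curlPow G F k ▷ 𝟙_ B ≫ diagramMap h (P.comp ((Y.whiskerLeft l).comp Q)) by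
      rw [hs, reassoc_of% h1, Category.assoc]
    rcases hm with ⟨rfl, hm⟩ | ⟨i, hi, hm⟩ | ⟨i, hi, hm⟩
    · have h0 : curlPow G F 0 = 𝟙 G := rfl
      rw [h0, MonoidalCategory.id_whiskerRight]
      refine Eq.trans ?_ (Category.id_comp _).symm
      simp only [diagramMap_comp, diagramMap_whiskerLeft, hm]
    · rw [← diagramMap_comp_bead h (curlPow G F k) P _ hE (i := l.length + i) (by simpa using hi)]
      simp only [diagramMap_comp, diagramMap_whiskerLeft, hm, whiskerObjs_comp, whiskerObjs_beads,
        Category.assoc]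
    -- The bead now lies above the replaced piece, so this piece is counted with the lower part of
    -- the diagram.
    · rw [← Diagram.comp_assoc] at hE ⊢
      rw [← Diagram.comp_assoc,
        ← diagramMap_comp_bead h (curlPow G F k) _ Q hE (i := l.length + i) (by simpa using hi)]
      simp only [diagramMap_comp, diagramMap_whiskerLeft, hm, whiskerObjs_comp, whiskerObjs_beads,
        Category.assoc]

theorem invariantJ_step {D E : LongKnotDiagram} (s : Step D.1 E.1) :
    invariantJ h D = invariantJ h E := by
  obtain ⟨k, hk, hR⟩ := s.effect h E.2
  -- Integer division satisfies (w + 2k)/2 = w/2 + k for every w, so the parity of the writhe plays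
  -- no role. The two powers of the curl then cancel.
  rw [invariantJ_eq, invariantJ_eq, hR, hk, Int.add_mul_ediv_left _ _ two_ne_zero,
    ← Category.assoc, ← curlPow_add]
  congr 2
  ring

end Invariance

end LongKnotInvariant

end

noncomputable section

namespace LongKnotInvariant

open scoped TensorProduct
open Coalgebra WithConv

/-! ### Sweedler sums and matrix coefficients of comodules. -/

section Repr

variable {K : Type*} [CommSemiring K] {C : Type*} [AddCommMonoid C] [Module K C] [CoalgebraStruct K C]
  {M : Type*} [AddCommMonoid M] [Module K M]

theorem repr_sum_eq_lift {c : C} {ι : Type*} (r : Coalgebra.Repr K c ι) (f : C →ₗ[K] C →ₗ[K] M) :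
    ∑ i ∈ r.index, f (r.left i) (r.right i) = TensorProduct.lift f (comul c) := by
  rw [← r.eq]
  simp

/-- A bilinear Sweedler sum does not depend on the representation of the comultiplication. -/
theorem repr_sum_eq {c : C} {ι κ : Type*} (r : Coalgebra.Repr K c ι) (s : Coalgebra.Repr K c κ)
    (f : C →ₗ[K] C →ₗ[K] M) :
    ∑ i ∈ r.index, f (r.left i) (r.right i) = ∑ i ∈ s.index, f (s.left i) (s.right i) := by
  rw [repr_sum_eq_lift, repr_sum_eq_lift]

end Repr

namespace RightComodule

section Coefficients

variable {K : Type u} [Field K] {C : Type w} [AddCommGroup C] [Module K C] [Coalgebra K C]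
  {V : Type*} [AddCommGroup V] [Module K V] (δ : RightComodule K C V)
  {ι : Type*} [Fintype ι] (b : Module.Basis ι K V)

theorem ext_coact {δ δ' : RightComodule K C V} (h : δ.coact = δ'.coact) : δ = δ' := by
  cases δ; cases δ'; congr

open Classical in
/-- The matrix coefficients of a comodule with respect to a basis. -/
def coeff (i j : ι) : C := TensorProduct.equivFinsuppOfBasisLeft b (δ.coact (b j)) i

theorem sum_basis_tmul_injective {N : Type*} [AddCommGroup N] [Module K N] {x y : ι → N}
    (h : ∑ i, b i ⊗ₜ[K] x i = ∑ i, b i ⊗ₜ[K] y i) : x = y := by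
  classical
  funext i
  have := congrArg (fun t => TensorProduct.equivFinsuppOfBasisLeft b t i) h
  simpa [Finsupp.finsetSum_apply, Finsupp.single_apply] using this

theorem coact_basis (j : ι) : δ.coact (b j) = ∑ i, b i ⊗ₜ δ.coeff b i j := by
  classical
  apply (TensorProduct.equivFinsuppOfBasisLeft (N := C) b).injective
  ext i
  simp [coeff]

theorem coeff_eq {t : ι → ι → C} (h : ∀ j, δ.coact (b j) = ∑ i, b i ⊗ₜ t i j) (i j : ι) :
    δ.coeff b i j = t i j :=
  congrFun (sum_basis_tmul_injective b ((δ.coact_basis b j).symm.trans (h j))) i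

theorem comul_coeff (i j : ι) :
    comul (R := K) (δ.coeff b i j) = ∑ k, δ.coeff b i k ⊗ₜ δ.coeff b k j := by
  have h := LinearMap.congr_fun δ.coassoc (b j)
  simp only [LinearMap.comp_apply, LinearEquiv.coe_coe, coact_basis, map_sum,
    LinearMap.rTensor_tmul, LinearMap.lTensor_tmul, TensorProduct.sum_tmul,
    TensorProduct.assoc_tmul] at h
  rw [Finset.sum_comm] at h
  simp only [← TensorProduct.tmul_sum] at h
  exact (congrFun (sum_basis_tmul_injective b h) i).symm

theorem counit_coeff [DecidableEq ι] (i j : ι) :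
    counit (R := K) (δ.coeff b i j) = if i = j then 1 else 0 := by
  have h := LinearMap.congr_fun δ.lTensor_counit (b j)
  simp only [LinearMap.comp_apply, coact_basis, map_sum, LinearMap.lTensor_tmul,
    LinearMap.flip_apply, TensorProduct.mk_apply] at h
  have h2 : b j ⊗ₜ[K] (1 : K) = ∑ i, b i ⊗ₜ[K] (if i = j then (1 : K) else 0) := by
    simp [TensorProduct.tmul_ite]
  exact congrFun (sum_basis_tmul_injective b (h.trans h2)) i

/-- The components of the comultiplication of a matrix coefficient. -/
def coeffRepr (i j : ι) : Coalgebra.Repr K (δ.coeff b i j) ι where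
  index := Finset.univ
  left k := δ.coeff b i k
  right k := δ.coeff b k j
  eq := (δ.comul_coeff b i j).symm

/-- The comodule with a given multiplicative matrix of coefficients. -/
def ofMatrix [DecidableEq ι] (t : ι → ι → C)
    (h : ∀ i j, comul (R := K) (t i j) = ∑ k, t i k ⊗ₜ t k j)
    (h' : ∀ i j, counit (R := K) (t i j) = if i = j then 1 else 0) : RightComodule K C V where
  coact := b.constr K fun j => ∑ i, b i ⊗ₜ t i j
  coassoc := b.ext fun j => by
    simp only [LinearMap.comp_apply, LinearEquiv.coe_coe, Module.Basis.constr_basis, map_sum,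
      LinearMap.rTensor_tmul, LinearMap.lTensor_tmul, TensorProduct.sum_tmul,
      TensorProduct.assoc_tmul, h, TensorProduct.tmul_sum]
    exact Finset.sum_comm
  lTensor_counit := b.ext fun j => by
    simp [h', TensorProduct.tmul_ite]

theorem ofMatrix_coact [DecidableEq ι] (t : ι → ι → C) (h h') (j : ι) :
    (ofMatrix (K := K) b t h h').coact (b j) = ∑ i, b i ⊗ₜ t i j := by
  simp [ofMatrix]

theorem coeff_ofMatrix [DecidableEq ι] (t : ι → ι → C) (h h') (i j : ι) :
    (ofMatrix (K := K) b t h h').coeff b i j = t i j :=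
  coeff_eq _ b (ofMatrix_coact b t h h') i j

end Coefficients

/-! ### Tensor products and morphisms of comodules. -/

section Tensor

variable {K : Type u} [Field K] {C : Type w} [Ring C] [Bialgebra K C]
  {U V W : Type*} [AddCommGroup U] [Module K U] [AddCommGroup V] [Module K V]
  [AddCommGroup W] [Module K W]
  [FiniteDimensional K U] [FiniteDimensional K V] [FiniteDimensional K W]
  (δU : RightComodule K C U) (δV : RightComodule K C V) (δW : RightComodule K C W)
  {ι κ μ : Type*} [Fintype ι] [Fintype κ] [Fintype μ]
  (a : Module.Basis ι K U) (b : Module.Basis κ K V) (c : Module.Basis μ K W)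

/-- The coaction on a tensor product, `u ⊗ v ↦ u₍₀₎ ⊗ v₍₀₎ ⊗ u₍₁₎ v₍₁₎`. -/
def tensorCoact : U ⊗[K] V →ₗ[K] (U ⊗[K] V) ⊗[K] C :=
  (LinearMap.mul' K C).lTensor (U ⊗[K] V) ∘ₗ
    (TensorProduct.tensorTensorTensorComm K U C V C).toLinearMap ∘ₗ
    TensorProduct.map δU.coact δV.coact

theorem tensorCoact_basis (i : ι) (j : κ) : tensorCoact δU δV (a i ⊗ₜ b j) =
    ∑ k, ∑ l, (a k ⊗ₜ b l) ⊗ₜ (δU.coeff a k i * δV.coeff b l j) := by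
  simp only [tensorCoact, LinearMap.comp_apply, TensorProduct.map_tmul, coact_basis _ a,
    coact_basis _ b, TensorProduct.sum_tmul, TensorProduct.tmul_sum, map_sum]
  rw [Finset.sum_comm]
  simp

/-- The tensor product of comodules in terms of matrix coefficients. -/
theorem exists_tensorCoact_eq [DecidableEq ι] [DecidableEq κ] :
    ∃ δ : RightComodule K C (U ⊗[K] V), δ.coact = tensorCoact δU δV ∧
      ∀ p q, δ.coeff (a.tensorProduct b) p q = δU.coeff a p.1 q.1 * δV.coeff b p.2 q.2 := by
  -- The Kronecker product of two multiplicative matrices is multiplicative because the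
  -- comultiplication and the counit are algebra maps.
  refine ⟨ofMatrix (a.tensorProduct b) (fun p q => δU.coeff a p.1 q.1 * δV.coeff b p.2 q.2) ?_ ?_,
    ?_, coeff_ofMatrix _ _ _ _⟩
  · rintro ⟨i, j⟩ ⟨k, l⟩
    rw [Bialgebra.comul_mul, comul_coeff, comul_coeff, Finset.sum_mul_sum, Fintype.sum_prod_type]
    simp only [Algebra.TensorProduct.tmul_mul_tmul]
  · rintro ⟨i, j⟩ ⟨k, l⟩
    rw [Bialgebra.counit_mul, counit_coeff, counit_coeff, ite_zero_mul_ite_zero, mul_one]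
    simp only [Prod.mk.injEq]
  · refine (a.tensorProduct b).ext fun ⟨i, j⟩ => ?_
    rw [ofMatrix_coact, Fintype.sum_prod_type]
    simp only [Module.Basis.tensorProduct_apply]
    rw [tensorCoact_basis _ _ a b]

/-- The tensor product of comodules. -/
def tensor : RightComodule K C (U ⊗[K] V) where
  coact := tensorCoact δU δV
  coassoc := by
    obtain ⟨δ, h, -⟩ := exists_tensorCoact_eq δU δV (Module.finBasis K U) (Module.finBasis K V)
    rw [← h, δ.coassoc]
  lTensor_counit := by
    obtain ⟨δ, h, -⟩ := exists_tensorCoact_eq δU δV (Module.finBasis K U) (Module.finBasis K V)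
    rw [← h, δ.lTensor_counit]

@[simp]
theorem tensor_coact : (tensor δU δV).coact = tensorCoact δU δV := rfl

theorem tensor_coeff (p q : ι × κ) : (tensor δU δV).coeff (a.tensorProduct b) p q =
    δU.coeff a p.1 q.1 * δV.coeff b p.2 q.2 := by
  classical
  obtain ⟨δ, h, h'⟩ := exists_tensorCoact_eq δU δV a b
  rw [← h', show tensor δU δV = δ from ext_coact h.symm]

variable (K C) in
/-- The trivial comodule. -/
def unit : RightComodule K C K where
  coact := (TensorProduct.mk K K C).flip 1
  coassoc := by ext; simp [Algebra.TensorProduct.one_def]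
  lTensor_counit := by ext; simp

/-- A linear map between comodules is a morphism if it commutes with the coactions. -/
def IsHom (f : U →ₗ[K] V) : Prop := δV.coact ∘ₗ f = f.rTensor C ∘ₗ δU.coact

variable {δU δV δW}

theorem isHom_id : IsHom δU δU LinearMap.id := by simp [IsHom]

theorem IsHom.comp {f : U →ₗ[K] V} {g : V →ₗ[K] W} (hg : IsHom δV δW g) (hf : IsHom δU δV f) :
    IsHom δU δW (g ∘ₗ f) := by
  rw [IsHom] at *
  rw [← LinearMap.comp_assoc, hg, LinearMap.comp_assoc, hf, LinearMap.rTensor_comp,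
    LinearMap.comp_assoc]

theorem IsHom.inv {e : U ≃ₗ[K] V} (h : IsHom δU δV e.toLinearMap) :
    IsHom δV δU e.symm.toLinearMap := by
  rw [IsHom] at *
  refine LinearMap.ext fun v => ?_
  obtain ⟨u, rfl⟩ := e.surjective v
  have h1 := LinearMap.congr_fun h u
  simp only [LinearMap.comp_apply, LinearEquiv.coe_coe, LinearEquiv.symm_apply_apply] at h1 ⊢
  rw [h1, ← LinearMap.comp_apply, ← LinearMap.rTensor_comp]
  simp

theorem IsHom.tensor {U' V' : Type*} [AddCommGroup U'] [Module K U'] [AddCommGroup V'] [Module K V']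
    [FiniteDimensional K U'] [FiniteDimensional K V'] {δU' : RightComodule K C U'}
    {δV' : RightComodule K C V'} {f : U →ₗ[K] U'} {g : V →ₗ[K] V'} (hf : IsHom δU δU' f)
    (hg : IsHom δV δV' g) : IsHom (δU.tensor δV) (δU'.tensor δV') (TensorProduct.map f g) := by
  rw [IsHom] at *
  refine TensorProduct.ext' fun x y => ?_
  have h1 := LinearMap.congr_fun hf x
  have h2 := LinearMap.congr_fun hg y
  simp only [LinearMap.comp_apply, tensor_coact, tensorCoact, TensorProduct.map_tmul,
    LinearEquiv.coe_coe] at h1 h2 ⊢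
  rw [h1, h2]
  generalize δU.coact x = s
  generalize δV.coact y = t
  induction s with
  | zero => simp
  | add s s' hs hs' => simp only [map_add, TensorProduct.add_tmul, hs, hs']
  | tmul x c =>
    induction t with
    | zero => simp
    | add s s' hs hs' => simp only [map_add, TensorProduct.tmul_add, hs, hs']
    | tmul y d => simp

theorem isHom_assoc : IsHom ((δU.tensor δV).tensor δW) (δU.tensor (δV.tensor δW))
    (TensorProduct.assoc K U V W).toLinearMap := by
  let a := Module.finBasis K U
  let b := Module.finBasis K V
  let c := Module.finBasis K W
  refine ((a.tensorProduct b).tensorProduct c).ext fun ⟨⟨i, j⟩, k⟩ => ?_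
  have h1 := tensorCoact_basis (δU.tensor δV) δW (a.tensorProduct b) c (i, j) k
  have h2 := tensorCoact_basis δU (δV.tensor δW) a (b.tensorProduct c) i (j, k)
  simp only [Module.Basis.tensorProduct_apply, tensor_coeff, Fintype.sum_prod_type] at h1 h2
  simp only [LinearMap.comp_apply, LinearEquiv.coe_coe, Module.Basis.tensorProduct_apply,
    TensorProduct.assoc_tmul, tensor_coact, h1, h2, map_sum, LinearMap.rTensor_tmul, mul_assoc]

theorem isHom_lid : IsHom ((unit K C).tensor δU) δU (TensorProduct.lid K U).toLinearMap := by
  refine TensorProduct.ext' fun r x => ?_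
  simp only [LinearMap.comp_apply, LinearEquiv.coe_coe, TensorProduct.lid_tmul, tensor_coact,
    tensorCoact, TensorProduct.map_tmul, map_smul, unit, LinearMap.flip_apply,
    TensorProduct.mk_apply]
  generalize δU.coact x = s
  induction s with
  | zero => simp
  | add s s' hs hs' => simp only [map_add, TensorProduct.tmul_add, smul_add, hs, hs']
  | tmul x c => simp [TensorProduct.smul_tmul']

theorem isHom_rid : IsHom (δU.tensor (unit K C)) δU (TensorProduct.rid K U).toLinearMap := by
  refine TensorProduct.ext' fun x r => ?_
  simp only [LinearMap.comp_apply, LinearEquiv.coe_coe, TensorProduct.rid_tmul, tensor_coact,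
    tensorCoact, TensorProduct.map_tmul, map_smul, unit, LinearMap.flip_apply,
    TensorProduct.mk_apply]
  generalize δU.coact x = s
  induction s with
  | zero => simp
  | add s s' hs hs' => simp only [map_add, TensorProduct.add_tmul, smul_add, hs, hs']
  | tmul x c => simp [TensorProduct.smul_tmul']

end Tensor

end RightComodule

end LongKnotInvariant

end

noncomputable section

namespace LongKnotInvariant

open scoped TensorProduct
open Coalgebra WithConv

theorem sum_comm_pairs {ι κ ι' κ' M : Type*} [Fintype ι] [Fintype κ] [Fintype ι'] [Fintype κ']
    [AddCommMonoid M] (f : ι → κ → ι' → κ' → M) :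
    ∑ k, ∑ l, ∑ p, ∑ q, f k l p q = ∑ p, ∑ q, ∑ k, ∑ l, f k l p q := by
  simp only [← Fintype.sum_prod_type']
  exact Fintype.sum_equiv ⟨fun x => (x.2.2.1, x.2.2.2, x.1, x.2.1),
    fun x => (x.2.2.1, x.2.2.2, x.1, x.2.1), fun _ => rfl, fun _ => rfl⟩ _ _ fun _ => rfl

/-! ### The axioms of ϱ for arbitrary Sweedler representatives. -/

section DualQuasitriangular

variable {K : Type u} [Field K] {C : Type w} [Ring C] [Bialgebra K C] {ϱ : C ⊗[K] C →ₗ[K] K}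
  (hϱ : IsDualQuasitriangular K C ϱ)

theorem convMul_tmul {ι κ : Type*} (u v : WithConv (C ⊗[K] C →ₗ[K] K))
    {x y : C} (rx : Coalgebra.Repr K x ι) (ry : Coalgebra.Repr K y κ) :
    (u * v) (x ⊗ₜ y) = ∑ a ∈ rx.index, ∑ b ∈ ry.index,
      u (rx.left a ⊗ₜ ry.left b) * v (rx.right a ⊗ₜ ry.right b) := by
  rw [(rx.tmul ry).convMul_apply]
  simp [Coalgebra.Repr.tmul, Finset.sum_product]

theorem repr_sum_sum_eq_apply {M : Type*} [AddCommGroup M] [Module K M] {a b : C} {ι κ : Type*}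
    (r : Coalgebra.Repr K a ι) (s : Coalgebra.Repr K b κ)
    (f : (C ⊗[K] C) ⊗[K] (C ⊗[K] C) →ₗ[K] M) :
    ∑ i ∈ r.index, ∑ j ∈ s.index, f ((r.left i ⊗ₜ r.right i) ⊗ₜ (s.left j ⊗ₜ s.right j)) =
      f (comul a ⊗ₜ comul b) := by
  rw [← r.eq, ← s.eq, TensorProduct.sum_tmul, map_sum]
  simp only [TensorProduct.tmul_sum, map_sum]

include hϱ

/-- The axioms are stated for the chosen representatives `ℛ`. A bilinear Sweedler sum does not
depend on them, so the axioms can be used with the matrix coproduct `coeffRepr`. -/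
theorem IsDualQuasitriangular.mul_left_repr (a b : C) {c : C} {ι : Type*}
    (r : Coalgebra.Repr K c ι) :
    ϱ ((a * b) ⊗ₜ c) = ∑ i ∈ r.index, ϱ (a ⊗ₜ r.left i) * ϱ (b ⊗ₜ r.right i) := by
  rw [hϱ.mul_left]
  exact repr_sum_eq _ r ((LinearMap.mul K K).compl₁₂ (ϱ ∘ₗ TensorProduct.mk K C C a)
    (ϱ ∘ₗ TensorProduct.mk K C C b))

theorem IsDualQuasitriangular.mul_right_repr {a : C} (b c : C) {ι : Type*}
    (r : Coalgebra.Repr K a ι) :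
    ϱ (a ⊗ₜ (b * c)) = ∑ i ∈ r.index, ϱ (r.left i ⊗ₜ c) * ϱ (r.right i ⊗ₜ b) := by
  rw [hϱ.mul_right]
  exact repr_sum_eq _ r ((LinearMap.mul K K).compl₁₂ (ϱ ∘ₗ (TensorProduct.mk K C C).flip c)
    (ϱ ∘ₗ (TensorProduct.mk K C C).flip b))

theorem IsDualQuasitriangular.comm_repr {a b : C} {ι κ : Type*} (r : Coalgebra.Repr K a ι)
    (s : Coalgebra.Repr K b κ) :
    ∑ i ∈ r.index, ∑ j ∈ s.index, ϱ (r.left i ⊗ₜ s.left j) • (r.right i * s.right j) =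
    ∑ i ∈ r.index, ∑ j ∈ s.index, ϱ (r.right i ⊗ₜ s.right j) • (s.left j * r.left i) := by
  have h := hϱ.comm a b
  let f : (C ⊗[K] C) ⊗[K] (C ⊗[K] C) →ₗ[K] C :=
    (TensorProduct.lid K C).toLinearMap ∘ₗ TensorProduct.map ϱ (LinearMap.mul' K C) ∘ₗ
      (TensorProduct.tensorTensorTensorComm K C C C C).toLinearMap
  let g : (C ⊗[K] C) ⊗[K] (C ⊗[K] C) →ₗ[K] C :=
    (TensorProduct.rid K C).toLinearMap ∘ₗ TensorProduct.map (LinearMap.mul' K C ∘ₗ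
      (TensorProduct.comm K C C).toLinearMap) ϱ ∘ₗ
      (TensorProduct.tensorTensorTensorComm K C C C C).toLinearMap
  have hf := (repr_sum_sum_eq_apply r s f).trans (repr_sum_sum_eq_apply (ℛ K a) (ℛ K b) f).symm
  have hg := (repr_sum_sum_eq_apply r s g).trans (repr_sum_sum_eq_apply (ℛ K a) (ℛ K b) g).symm
  simp only [f, g, LinearMap.comp_apply, LinearEquiv.coe_coe, TensorProduct.map_tmul,
    TensorProduct.tensorTensorTensorComm_tmul, LinearMap.mul'_apply, TensorProduct.lid_tmul,
    TensorProduct.rid_tmul, TensorProduct.comm_tmul] at hf hg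
  rw [hf, hg, h]

end DualQuasitriangular

namespace RightComodule

/-! ### The braiding of comodules defined by ϱ. -/

section Braiding

variable {K : Type u} [Field K] {C : Type w} [Ring C] [Bialgebra K C]
  {U V W : Type*} [AddCommGroup U] [Module K U] [AddCommGroup V] [Module K V]
  [AddCommGroup W] [Module K W]
  [FiniteDimensional K U] [FiniteDimensional K V] [FiniteDimensional K W]
  (δU : RightComodule K C U) (δV : RightComodule K C V) (δW : RightComodule K C W)
  {ι κ μ : Type*} [Fintype ι] [Fintype κ] [Fintype μ]
  (a : Module.Basis ι K U) (b : Module.Basis κ K V) (c : Module.Basis μ K W)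

section

variable (ϱ : C ⊗[K] C →ₗ[K] K)

/-- The linear map `u ⊗ v ↦ v₍₀₎ ⊗ u₍₀₎ ϱ(u₍₁₎ ⊗ v₍₁₎)`. -/
def braid : U ⊗[K] V →ₗ[K] V ⊗[K] U :=
  (TensorProduct.rid K (V ⊗[K] U)).toLinearMap ∘ₗ
    TensorProduct.map (TensorProduct.comm K U V).toLinearMap ϱ ∘ₗ
    (TensorProduct.tensorTensorTensorComm K U C V C).toLinearMap ∘ₗ
    TensorProduct.map δU.coact δV.coact

theorem braid_basis (i : ι) (j : κ) : braid δU δV ϱ (a i ⊗ₜ b j) =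
    ∑ k, ∑ l, ϱ (δU.coeff a k i ⊗ₜ δV.coeff b l j) • (b l ⊗ₜ a k) := by
  simp only [braid, LinearMap.comp_apply, TensorProduct.map_tmul, coact_basis _ a,
    coact_basis _ b, TensorProduct.sum_tmul, TensorProduct.tmul_sum, map_sum]
  rw [Finset.sum_comm]
  simp

/-- The inverse of `braid`, in terms of the convolution inverse of `ϱ`. -/
def braidInv : V ⊗[K] U →ₗ[K] U ⊗[K] V :=
  (TensorProduct.rid K (U ⊗[K] V)).toLinearMap ∘ₗ
    (TensorProduct.map .id ϱ) ∘ₗ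
    (TensorProduct.tensorTensorTensorComm K U C V C).toLinearMap ∘ₗ
    TensorProduct.map δU.coact δV.coact ∘ₗ (TensorProduct.comm K V U).toLinearMap

theorem braidInv_basis (i : ι) (j : κ) : braidInv δU δV ϱ (b j ⊗ₜ a i) =
    ∑ k, ∑ l, ϱ (δU.coeff a k i ⊗ₜ δV.coeff b l j) • (a k ⊗ₜ b l) := by
  simp only [braidInv, LinearMap.comp_apply, LinearEquiv.coe_coe, TensorProduct.comm_tmul,
    TensorProduct.map_tmul, coact_basis _ a,
    coact_basis _ b, TensorProduct.sum_tmul, TensorProduct.tmul_sum, map_sum]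
  rw [Finset.sum_comm]
  simp

theorem braid_naturality {U' V' : Type*} [AddCommGroup U'] [Module K U'] [AddCommGroup V']
    [Module K V'] {δU : RightComodule K C U} {δV : RightComodule K C V}
    {δU' : RightComodule K C U'}
    {δV' : RightComodule K C V'} {f : U →ₗ[K] U'} {g : V →ₗ[K] V'} (hf : IsHom δU δU' f)
    (hg : IsHom δV δV' g) : braid δU' δV' ϱ ∘ₗ TensorProduct.map f g =
      TensorProduct.map g f ∘ₗ braid δU δV ϱ := by
  rw [IsHom] at hf hg
  refine TensorProduct.ext' fun x y => ?_
  have h1 := LinearMap.congr_fun hf x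
  have h2 := LinearMap.congr_fun hg y
  simp only [LinearMap.comp_apply, braid, TensorProduct.map_tmul, LinearEquiv.coe_coe] at h1 h2 ⊢
  rw [h1, h2]
  generalize δU.coact x = s
  generalize δV.coact y = t
  induction s with
  | zero => simp
  | add s s' hs hs' => simp only [map_add, TensorProduct.add_tmul, hs, hs']
  | tmul x c =>
    induction t with
    | zero => simp
    | add s s' hs hs' => simp only [map_add, TensorProduct.tmul_add, hs, hs']
    | tmul y d => simp

variable {ϱ}

/-- A convolution inverse evaluated on matrix coefficients: the counit becomes a Kronecker delta, so
the matrices of `braid` and `braidInv` are inverse to each other. -/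
theorem sum_coeff_mul_coeff [DecidableEq ι] [DecidableEq κ] {ϱ' : C ⊗[K] C →ₗ[K] K}
    (h : toConv ϱ' * toConv ϱ = 1) (p i : ι) (q j : κ) :
    ∑ k, ∑ l, ϱ (δU.coeff a k i ⊗ₜ δV.coeff b l j) *
      ϱ' (δU.coeff a p k ⊗ₜ δV.coeff b q l) = if p = i ∧ q = j then 1 else 0 := by
  have h2 := congrArg (fun f : WithConv (C ⊗[K] C →ₗ[K] K) =>
    f (δU.coeff a p i ⊗ₜ δV.coeff b q j)) h
  rw [convMul_tmul _ _ (δU.coeffRepr a p i) (δV.coeffRepr b q j)] at h2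
  simp only [coeffRepr] at h2
  simp only [mul_comm (ϱ _)]
  refine h2.trans ?_
  simp [counit_coeff, ← ite_and]

theorem braidInv_comp_braid {ϱ' : C ⊗[K] C →ₗ[K] K} (h : toConv ϱ' * toConv ϱ = 1) :
    braidInv δU δV ϱ' ∘ₗ braid δU δV ϱ = LinearMap.id := by
  classical
  let a := Module.finBasis K U
  let b := Module.finBasis K V
  refine (a.tensorProduct b).ext fun ⟨i, j⟩ => ?_
  simp only [Module.Basis.tensorProduct_apply, LinearMap.comp_apply, LinearMap.id_apply,
    braid_basis _ _ a b, map_sum, map_smul, braidInv_basis _ _ a b, Finset.smul_sum, smul_smul]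
  rw [sum_comm_pairs]
  simp only [← Finset.sum_smul, sum_coeff_mul_coeff _ _ a b h, ite_and, ite_smul, one_smul,
    zero_smul]
  simp

theorem braid_comp_braidInv {ϱ' : C ⊗[K] C →ₗ[K] K} (h : toConv ϱ * toConv ϱ' = 1) :
    braid δU δV ϱ ∘ₗ braidInv δU δV ϱ' = LinearMap.id := by
  classical
  let a := Module.finBasis K U
  let b := Module.finBasis K V
  refine (b.tensorProduct a).ext fun ⟨j, i⟩ => ?_
  simp only [Module.Basis.tensorProduct_apply, LinearMap.comp_apply, LinearMap.id_apply,
    braid_basis _ _ a b, map_sum, map_smul, braidInv_basis _ _ a b, Finset.smul_sum, smul_smul]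
  rw [sum_comm_pairs]
  simp only [← Finset.sum_smul, sum_coeff_mul_coeff _ _ a b h, ite_and, ite_smul, one_smul,
    zero_smul]
  simp

variable {δU δV δW}

theorem isHom_braid (hϱ : IsDualQuasitriangular K C ϱ) :
    IsHom (δU.tensor δV) (δV.tensor δU) (braid δU δV ϱ) := by
  let a := Module.finBasis K U
  let b := Module.finBasis K V
  refine (a.tensorProduct b).ext fun ⟨i, j⟩ => ?_
  simp only [Module.Basis.tensorProduct_apply, LinearMap.comp_apply, tensor_coact,
    braid_basis _ _ a b, tensorCoact_basis _ _ a b, tensorCoact_basis _ _ b a, map_sum, map_smul,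
    LinearMap.rTensor_tmul, TensorProduct.sum_tmul, ← TensorProduct.smul_tmul', Finset.smul_sum]
  conv_lhs => rw [sum_comm_pairs, Finset.sum_comm]
  conv_rhs => rw [sum_comm_pairs]
  refine Finset.sum_congr rfl fun q _ => Finset.sum_congr rfl fun p _ => ?_
  -- Comparing what is attached to each pair of basis vectors leaves exactly the commutation axiom
  -- for two coefficients.
  have h := hϱ.comm_repr (δU.coeffRepr a q i) (δV.coeffRepr b p j)
  simp only [coeffRepr] at h
  simp only [← TensorProduct.tmul_smul, ← TensorProduct.tmul_sum]
  rw [h]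

/-- Multiplicativity of ϱ in its first variable, read on coefficients: `W` is crossed first by `V`
and then by `U`. -/
theorem braid_tensor_left (hϱ : IsDualQuasitriangular K C ϱ) :
    (TensorProduct.assoc K W U V).symm.toLinearMap ∘ₗ braid (δU.tensor δV) δW ϱ ∘ₗ
      (TensorProduct.assoc K U V W).symm.toLinearMap =
    (braid δU δW ϱ).rTensor V ∘ₗ (TensorProduct.assoc K U W V).symm.toLinearMap ∘ₗ
      (braid δV δW ϱ).lTensor U := by
  let a := Module.finBasis K U
  let b := Module.finBasis K V
  let c := Module.finBasis K W
  refine (a.tensorProduct (b.tensorProduct c)).ext fun ⟨i, j, m⟩ => ?_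
  have h1 := braid_basis (δU.tensor δV) δW (a.tensorProduct b) c ϱ (i, j) m
  simp only [Module.Basis.tensorProduct_apply, tensor_coeff, Fintype.sum_prod_type] at h1
  have h2 := fun k l n => hϱ.mul_left_repr (δU.coeff a k i) (δV.coeff b l j) (δW.coeffRepr c n m)
  simp only [coeffRepr] at h2
  simp only [Module.Basis.tensorProduct_apply, LinearMap.comp_apply, LinearEquiv.coe_coe,
    TensorProduct.assoc_symm_tmul, h1, map_sum, map_smul, LinearMap.lTensor_tmul,
    braid_basis _ _ b c, TensorProduct.tmul_sum, TensorProduct.tmul_smul, LinearMap.rTensor_tmul,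
    braid_basis _ _ a c, TensorProduct.sum_tmul, ← TensorProduct.smul_tmul', Finset.smul_sum,
    smul_smul, h2, Finset.sum_smul]
  simp only [← Fintype.sum_prod_type']
  exact Fintype.sum_equiv ⟨fun x => (x.2.1, x.2.2.2, x.1, x.2.2.1),
    fun x => (x.2.2.1, x.1, x.2.2.2, x.2.1), fun _ => rfl, fun _ => rfl⟩ _ _
    fun _ => by rw [mul_comm]; rfl

/-- Multiplicativity in the second variable. The reversed order of the factors in that axiom matches
`U` crossing `V` before `W`. -/
theorem braid_tensor_right (hϱ : IsDualQuasitriangular K C ϱ) :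
    (TensorProduct.assoc K V W U).toLinearMap ∘ₗ braid δU (δV.tensor δW) ϱ ∘ₗ
      (TensorProduct.assoc K U V W).toLinearMap =
    (braid δU δW ϱ).lTensor V ∘ₗ (TensorProduct.assoc K V U W).toLinearMap ∘ₗ
      (braid δU δV ϱ).rTensor W := by
  let a := Module.finBasis K U
  let b := Module.finBasis K V
  let c := Module.finBasis K W
  refine ((a.tensorProduct b).tensorProduct c).ext fun ⟨⟨i, j⟩, m⟩ => ?_
  have h1 := braid_basis δU (δV.tensor δW) a (b.tensorProduct c) ϱ i (j, m)
  simp only [Module.Basis.tensorProduct_apply, tensor_coeff, Fintype.sum_prod_type] at h1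
  have h2 := fun k l n => hϱ.mul_right_repr (δV.coeff b l j) (δW.coeff c n m) (δU.coeffRepr a k i)
  simp only [coeffRepr] at h2
  simp only [Module.Basis.tensorProduct_apply, LinearMap.comp_apply, LinearEquiv.coe_coe,
    TensorProduct.assoc_tmul, h1, map_sum, map_smul, LinearMap.lTensor_tmul,
    braid_basis _ _ a b, TensorProduct.tmul_sum, TensorProduct.tmul_smul, LinearMap.rTensor_tmul,
    braid_basis _ _ a c, TensorProduct.sum_tmul, ← TensorProduct.smul_tmul', Finset.smul_sum,
    smul_smul, h2, Finset.sum_smul]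
  simp only [← Fintype.sum_prod_type']
  exact Fintype.sum_equiv ⟨fun x => (x.2.2.2, x.2.1, x.1, x.2.2.1),
    fun x => (x.2.2.1, x.2.1, x.2.2.2, x.1), fun _ => rfl, fun _ => rfl⟩ _ _
    fun _ => by rw [mul_comm]; rfl

end

end Braiding

end RightComodule

end LongKnotInvariant

end

noncomputable section

namespace LongKnotInvariant

open scoped TensorProduct
open Coalgebra WithConv

namespace RightComodule

/-! ### Dual comodules. -/

section Dual

variable {K : Type u} [Field K] {C : Type w} [Ring C] [HopfAlgebra K C]
  {V F : Type*} [AddCommGroup V] [Module K V] [AddCommGroup F] [Module K F]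
  [FiniteDimensional K V] [FiniteDimensional K F]
  (δ : RightComodule K C V) {ι : Type*} [Fintype ι] [DecidableEq ι] (b : Module.Basis ι K V)
  (f : Module.Basis ι K F)

/-- The dual comodule, with respect to a pair of dual bases. -/
def dual : RightComodule K C F :=
  ofMatrix f (fun i j => HopfAlgebra.antipode K (δ.coeff b j i))
    (fun i j => by
      -- The antipode reverses the coproduct; the transposition of the matrix undoes this reversal.
      rw [QuantumDouble.comul_antipode (δ.coeffRepr b j i)]
      rfl)
    (fun i j => by
      rw [HopfAlgebra.counit_antipode, counit_coeff]
      simp only [eq_comm])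

theorem dual_coeff (i j : ι) :
    (δ.dual b f).coeff f i j = HopfAlgebra.antipode K (δ.coeff b j i) :=
  coeff_ofMatrix _ _ _ _ i j

/-- In dual bases this is the antipode identity S(c₍₁₎)c₍₂₎ = ε(c) on matrix coefficients; the
coevaluation uses the other one, c₍₁₎S(c₍₂₎) = ε(c). -/
theorem isHom_evaluation {ev : F ⊗[K] V →ₗ[K] K}
    (h : ∀ i j, ev (f i ⊗ₜ b j) = if i = j then 1 else 0) :
    IsHom ((δ.dual b f).tensor δ) (unit K C) ev := by
  refine (f.tensorProduct b).ext fun ⟨i, j⟩ => ?_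
  simp only [Module.Basis.tensorProduct_apply, LinearMap.comp_apply, tensor_coact,
    tensorCoact_basis _ _ f b, h, map_sum, LinearMap.rTensor_tmul, dual_coeff]
  have h1 := HopfAlgebra.sum_antipode_mul_eq_smul (R := K) (δ.coeffRepr b i j)
  simp only [coeffRepr, counit_coeff] at h1
  have h2 : ∀ x y : ι, (if x = y then (1 : K) else 0) ⊗ₜ[K]
      (HopfAlgebra.antipode K (δ.coeff b i x) * δ.coeff b y j) =
      if x = y then 1 ⊗ₜ (HopfAlgebra.antipode K (δ.coeff b i x) * δ.coeff b y j) else 0 := by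
    intro x y
    split_ifs <;> simp
  simp only [h2, Finset.sum_ite_eq, Finset.mem_univ, if_true, ← TensorProduct.tmul_sum, h1]
  by_cases hij : i = j <;> simp [unit, hij]

theorem isHom_coevaluation {co : K →ₗ[K] V ⊗[K] F} (h : co 1 = ∑ i, b i ⊗ₜ f i) :
    IsHom (unit K C) (δ.tensor (δ.dual b f)) co := by
  refine LinearMap.ext_ring ?_
  simp only [LinearMap.comp_apply, h, map_sum, tensor_coact, tensorCoact_basis _ _ b f, dual_coeff,
    unit, LinearMap.flip_apply, TensorProduct.mk_apply, LinearMap.rTensor_tmul]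
  have h1 : ∀ k l, ∑ i, δ.coeff b k i * HopfAlgebra.antipode K (δ.coeff b i l) =
      if k = l then 1 else 0 := by
    intro k l
    have h1 := HopfAlgebra.sum_mul_antipode_eq_smul (R := K) (δ.coeffRepr b k l)
    simp only [coeffRepr, counit_coeff] at h1
    rw [h1]
    simp
  rw [Finset.sum_comm, TensorProduct.sum_tmul]
  refine Finset.sum_congr rfl fun k _ => ?_
  rw [Finset.sum_comm]
  simp only [← TensorProduct.tmul_sum, h1]
  simp [TensorProduct.tmul_ite]

end Dual

/-! ### Coefficient maps, quotients, subcomodules of C and direct sums. -/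

section Constructions

variable {K : Type u} [Field K] {C : Type w} [AddCommGroup C] [Module K C] [Coalgebra K C]
  {U V Q : Type*} [AddCommGroup U] [Module K U] [AddCommGroup V] [Module K V]
  [AddCommGroup Q] [Module K Q]
  (δU : RightComodule K C U) (δ : RightComodule K C V)

theorem coassoc_apply (v : V) : TensorProduct.assoc K V C C (δ.coact.rTensor C (δ.coact v)) =
    comul.lTensor V (δ.coact v) := LinearMap.congr_fun δ.coassoc v

theorem lTensor_counit_apply (v : V) : counit.lTensor V (δ.coact v) = v ⊗ₜ (1 : K) :=
  LinearMap.congr_fun δ.lTensor_counit v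

/-- The coefficient map `v ↦ ⟨f, v₍₀₎⟩ v₍₁₎`. -/
def coeffMap (f : Module.Dual K V) : V →ₗ[K] C :=
  (TensorProduct.lid K C).toLinearMap ∘ₗ f.rTensor C ∘ₗ δ.coact

/-- The coefficient map is a comodule morphism from `V` to C with the regular coaction. Hence its
kernel is a subcomodule. -/
theorem comul_coeffMap (f : Module.Dual K V) (v : V) :
    comul (R := K) (δ.coeffMap f v) = (δ.coeffMap f).rTensor C (δ.coact v) := by
  have h1 : ∀ t : V ⊗[K] C, comul (R := K) (TensorProduct.lid K C (f.rTensor C t)) =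
      TensorProduct.lid K (C ⊗[K] C) (f.rTensor (C ⊗[K] C) (comul.lTensor V t)) := by
    intro t
    induction t with
    | zero => simp
    | add a b ha hb => simp only [map_add, ha, hb]
    | tmul a b => simp
  have h2 : ∀ t : V ⊗[K] C, (δ.coeffMap f).rTensor C t =
      TensorProduct.lid K (C ⊗[K] C) (f.rTensor (C ⊗[K] C)
        (TensorProduct.assoc K V C C (δ.coact.rTensor C t))) := by
    intro t
    induction t with
    | zero => simp
    | add a b ha hb => simp only [map_add, ha, hb]
    | tmul a b =>
      simp only [coeffMap, LinearMap.rTensor_tmul, LinearMap.comp_apply, LinearEquiv.coe_coe]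
      generalize δ.coact a = s
      induction s with
      | zero => simp
      | add a b ha hb => simp only [map_add, TensorProduct.add_tmul, ha, hb]
      | tmul c d => simp [TensorProduct.smul_tmul']
  rw [h2, coassoc_apply, ← h1]
  rfl

theorem counit_coeffMap (f : Module.Dual K V) (v : V) :
    counit (R := K) (δ.coeffMap f v) = f v := by
  have h1 : ∀ t : V ⊗[K] C, counit (R := K) (TensorProduct.lid K C (f.rTensor C t)) =
      TensorProduct.lid K K (f.rTensor K (counit.lTensor V t)) := by
    intro t
    induction t with
    | zero => simp
    | add a b ha hb => simp only [map_add, ha, hb]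
    | tmul a b => simp
  refine (h1 _).trans ?_
  rw [lTensor_counit_apply]
  simp

omit [Coalgebra K C] in
theorem lTensor_rTensor_apply {C' : Type*} [AddCommGroup C'] [Module K C'] (f : V →ₗ[K] Q)
    (g : C →ₗ[K] C') (t : V ⊗[K] C) :
    g.lTensor Q (f.rTensor C t) = f.rTensor C' (g.lTensor V t) := by
  rw [← LinearMap.comp_apply, ← LinearMap.comp_apply, LinearMap.lTensor_comp_rTensor,
    LinearMap.rTensor_comp_lTensor]

omit [Coalgebra K C] in
theorem rTensor_assoc_apply (f : V →ₗ[K] Q) (t : (V ⊗[K] C) ⊗[K] C) :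
    f.rTensor (C ⊗[K] C) (TensorProduct.assoc K V C C t) =
      TensorProduct.assoc K Q C C ((f.rTensor C).rTensor C t) := by
  rw [LinearMap.rTensor_tensor]
  simp

variable {δ} in
-- The comodule law for `P` holds on the image of any map intertwining `P` with a genuine coaction.
-- It is used for a surjection (quotients) and for a pair of jointly surjective inclusions (direct
-- sums).
theorem coassoc_of_comp_eq {P : Q →ₗ[K] Q ⊗[K] C} {f : V →ₗ[K] Q}
    (h : P ∘ₗ f = f.rTensor C ∘ₗ δ.coact) :
    ((TensorProduct.assoc K Q C C).toLinearMap ∘ₗ P.rTensor C ∘ₗ P) ∘ₗ f =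
      (comul.lTensor Q ∘ₗ P) ∘ₗ f := by
  refine LinearMap.ext fun v => ?_
  have hv := LinearMap.congr_fun h v
  simp only [LinearMap.comp_apply, LinearEquiv.coe_coe] at hv ⊢
  rw [hv, ← LinearMap.comp_apply (P.rTensor C), ← LinearMap.rTensor_comp, h,
    LinearMap.rTensor_comp, LinearMap.comp_apply, ← rTensor_assoc_apply, coassoc_apply,
    lTensor_rTensor_apply]

variable {δ} in
theorem lTensor_counit_of_comp_eq {P : Q →ₗ[K] Q ⊗[K] C} {f : V →ₗ[K] Q}
    (h : P ∘ₗ f = f.rTensor C ∘ₗ δ.coact) :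
    (counit.lTensor Q ∘ₗ P) ∘ₗ f = (TensorProduct.mk K Q K).flip 1 ∘ₗ f := by
  refine LinearMap.ext fun v => ?_
  have hv := LinearMap.congr_fun h v
  simp only [LinearMap.comp_apply] at hv ⊢
  rw [hv, lTensor_rTensor_apply, lTensor_counit_apply]
  simp

/-- The comodule structure on the target of a surjection. -/
def descend (q : V →ₗ[K] Q) (s : Q →ₗ[K] V) (hs : q ∘ₗ s = LinearMap.id)
    (h : ∀ v, q.rTensor C (δ.coact (s (q v))) = q.rTensor C (δ.coact v)) : RightComodule K C Q where
  coact := q.rTensor C ∘ₗ δ.coact ∘ₗ s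
  coassoc := LinearMap.cancel_right (LinearMap.surjective_of_comp_eq_id s q hs) |>.1
    (coassoc_of_comp_eq (δ := δ) (LinearMap.ext h))
  lTensor_counit := LinearMap.cancel_right (LinearMap.surjective_of_comp_eq_id s q hs) |>.1
    (lTensor_counit_of_comp_eq (δ := δ) (LinearMap.ext h))

theorem descend_isHom (q : V →ₗ[K] Q) (s : Q →ₗ[K] V) (hs h) :
    (δ.descend q s hs h).coact ∘ₗ q = q.rTensor C ∘ₗ δ.coact :=
  LinearMap.ext h

/-- The comodule structure on the source of an injection. -/
def restrict (i : Q →ₗ[K] C) (p : C →ₗ[K] Q) (hp : p ∘ₗ i = LinearMap.id)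
    (h : ∀ x, (i ∘ₗ p).rTensor C (comul (i x)) = comul (i x)) : RightComodule K C Q where
  coact := p.rTensor C ∘ₗ comul ∘ₗ i
  coassoc := by
    refine LinearMap.ext fun x => ?_
    have h0 : ∀ x, i.rTensor C (p.rTensor C (comul (i x))) = comul (i x) := by
      intro x
      rw [← LinearMap.comp_apply, ← LinearMap.rTensor_comp, h]
    have h1 : ∀ t : Q ⊗[K] C, i.rTensor (C ⊗[K] C) (TensorProduct.assoc K Q C C
        ((p.rTensor C ∘ₗ comul ∘ₗ i).rTensor C t)) =
        TensorProduct.assoc K C C C (comul.rTensor C (i.rTensor C t)) := by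
      intro t
      induction t with
      | zero => simp
      | add a b ha hb => simp only [map_add, ha, hb]
      | tmul a b =>
        simp only [LinearMap.rTensor_tmul]
        rw [← h0 a]
        simp only [LinearMap.comp_apply]
        generalize p.rTensor C (comul (i a)) = u
        induction u with
        | zero => simp
        | add a b ha hb => simp only [map_add, TensorProduct.add_tmul, ha, hb]
        | tmul c d => simp
    -- Coassociativity is compared inside C ⊗ C ⊗ C, where it is that of C; tensoring with `i` stays
    -- injective over a field.
    apply Module.Flat.rTensor_preserves_injective_linearMap (M := C ⊗[K] C) i
      (Function.LeftInverse.injective (g := p) (LinearMap.congr_fun hp))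
    simp only [LinearMap.comp_apply, LinearEquiv.coe_coe]
    have h2 := h1 (p.rTensor C (comul (i x)))
    rw [h0, Coalgebra.coassoc_apply] at h2
    refine h2.trans ?_
    rw [← lTensor_rTensor_apply, h0]
  lTensor_counit := by
    refine LinearMap.ext fun x => ?_
    simp only [LinearMap.comp_apply]
    rw [lTensor_rTensor_apply, Coalgebra.lTensor_counit_comul]
    have := LinearMap.congr_fun hp x
    simp only [LinearMap.comp_apply, LinearMap.id_apply] at this
    simp [this]

theorem coeffMap_restrict (i : Q →ₗ[K] C) (p : C →ₗ[K] Q) (hp h) (x : Q) :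
    (restrict (K := K) i p hp h).coeffMap (counit ∘ₗ i) x = i x := by
  simp only [coeffMap, restrict, LinearMap.comp_apply, LinearEquiv.coe_coe]
  rw [← LinearMap.comp_apply (LinearMap.rTensor C _), ← LinearMap.rTensor_comp,
    LinearMap.comp_assoc, LinearMap.rTensor_comp, LinearMap.comp_apply, h,
    Coalgebra.rTensor_counit_comul]
  simp

/-- Every element of a coalgebra is a coefficient of a finite-dimensional comodule. -/
theorem exists_coeffMap_eq (c : C) : ∃ (n : ℕ) (δ : RightComodule K C (Fin n → K))
    (f : Module.Dual K (Fin n → K)) (v : Fin n → K), δ.coeffMap f v = c := by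
  classical
  let B := Module.Basis.ofVectorSpace K C
  -- Δ(c) is expanded in a basis of the right factor. The finitely many left components span the
  -- comodule sought.
  let t := TensorProduct.equivFinsuppOfBasisRight (M := C) B (comul c)
  have ht : comul (R := K) c = ∑ k ∈ t.support, t k ⊗ₜ B k := by
    rw [← (TensorProduct.equivFinsuppOfBasisRight (M := C) B).symm_apply_apply (comul c),
      TensorProduct.equivFinsuppOfBasisRight_symm_apply]
    rfl
  let V : Submodule K C := Submodule.span K (t '' t.support)
  have hV : FiniteDimensional K V :=
    FiniteDimensional.span_of_finite K (t.support.finite_toSet.image t)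
  have hk : ∀ k, t k ∈ V := by
    intro k
    by_cases h : k ∈ t.support
    · exact Submodule.subset_span ⟨k, h, rfl⟩
    · rw [Finsupp.notMem_support_iff.1 h]; exact V.zero_mem
  -- Applying the counit to the right factor of Δ(c) writes c as a combination of the left
  -- components.
  have hc : c ∈ V := by
    have := Coalgebra.lTensor_counit_comul (R := K) c
    rw [ht, map_sum] at this
    have h1 := congrArg (TensorProduct.rid K C) this
    simp only [LinearMap.lTensor_tmul, map_sum, TensorProduct.rid_tmul, one_smul] at h1
    rw [← h1]
    exact V.sum_mem fun k _ => V.smul_mem _ (hk k)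
  let e := Module.finBasis K V
  let i : (Fin (Module.finrank K V) → K) →ₗ[K] C := V.subtype ∘ₗ e.equivFun.symm.toLinearMap
  have hi : LinearMap.ker i = ⊥ := by
    rw [LinearMap.ker_eq_bot]
    exact V.injective_subtype.comp e.equivFun.symm.injective
  obtain ⟨p, hp⟩ := i.exists_leftInverse_of_injective hi
  have hiV : ∀ x ∈ V, i (p x) = x := by
    intro x hx
    have : i (e.equivFun ⟨x, hx⟩) = x := by simp [i]
    conv_lhs => rw [← this]
    rw [← LinearMap.comp_apply p, hp, LinearMap.id_apply, this]
  -- `V` is a right coideal: by coassociativity the sum of Δ(t k) ⊗ B k has its first leg in `V`,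
  -- hence is fixed by the projection `i ∘ p`, and the coefficient of each B k gives the claim for t
  -- k.
  have hΔ : ∀ x ∈ V, (i ∘ₗ p).rTensor C (comul x) = comul (R := K) x := by
    have hlin : V ≤ LinearMap.eqLocus ((i ∘ₗ p).rTensor C ∘ₗ comul) (comul (R := K)) := by
      rw [Submodule.span_le]
      rintro _ ⟨k, hk', rfl⟩
      have h1 := Coalgebra.coassoc_apply (R := K) c
      rw [ht] at h1
      simp only [map_sum, LinearMap.rTensor_tmul, LinearMap.lTensor_tmul] at h1
      have h2 := congrArg ((i ∘ₗ p).rTensor (C ⊗[K] C)) h1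
      simp only [map_sum, rTensor_assoc_apply, LinearMap.rTensor_tmul, LinearMap.comp_apply,
        hiV _ (hk _)] at h2
      rw [← h1] at h2
      simp only [← map_sum] at h2
      have h3 := congrArg (fun t => TensorProduct.rid K _ ((B.coord k).lTensor _ t))
        ((TensorProduct.assoc K C C C).injective h2)
      have hk0 : t k ≠ 0 := Finsupp.mem_support_iff.1 (by simpa using hk')
      simpa [Finsupp.single_apply, hk0] using h3
    exact fun x hx => hlin hx
  have himem : ∀ x, i x ∈ V := fun x => (e.equivFun.symm x).2
  refine ⟨_, restrict i p hp fun x => hΔ _ (himem x), counit ∘ₗ i, p c, ?_⟩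
  rw [coeffMap_restrict, hiV c hc]

/-- A vector on which a coefficient map vanishes is killed by a morphism to a comodule through
which the functional factors. -/
theorem exists_quotient (f : Module.Dual K V) (v : V) (hv : δ.coeffMap f v = 0) :
    ∃ (N : Submodule K V) (δ' : RightComodule K C (V ⧸ N)) (g : Module.Dual K (V ⧸ N)),
      δ'.coact ∘ₗ N.mkQ = N.mkQ.rTensor C ∘ₗ δ.coact ∧ g ∘ₗ N.mkQ = f ∧ v ∈ N := by
  -- The functional factors through the quotient by this kernel because it is the counit composed
  -- with the coefficient map.
  let N := LinearMap.ker (δ.coeffMap f)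
  obtain ⟨s, hs⟩ := N.mkQ.exists_rightInverse_of_surjective N.range_mkQ
  -- The quotient embeds in C through the coefficient map, and there the coaction of `w` becomes the
  -- coproduct of its coefficient, which is zero.
  have hN : ∀ w ∈ N, N.mkQ.rTensor C (δ.coact w) = 0 := by
    intro w hw
    let i : V ⧸ N →ₗ[K] C := N.liftQ (δ.coeffMap f) le_rfl
    have hi : Function.Injective i := LinearMap.ker_eq_bot.1 (N.ker_liftQ_eq_bot _ _ le_rfl)
    apply Module.Flat.rTensor_preserves_injective_linearMap (M := C) i hi
    rw [map_zero, ← LinearMap.comp_apply, ← LinearMap.rTensor_comp, Submodule.liftQ_mkQ,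
      ← comul_coeffMap, LinearMap.mem_ker.1 hw, map_zero]
  refine ⟨N, δ.descend N.mkQ s hs fun w => ?_, N.liftQ f ?_, descend_isHom _ _ _ _ _,
    N.liftQ_mkQ _ _, LinearMap.mem_ker.2 hv⟩
  · rw [← sub_eq_zero, ← map_sub, ← map_sub]
    apply hN
    exact (Submodule.Quotient.eq N).1 (LinearMap.congr_fun hs (N.mkQ w))
  · intro w hw
    rw [LinearMap.mem_ker, ← counit_coeffMap δ, LinearMap.mem_ker.1 hw, map_zero]

/-- The coaction on a direct sum. -/
def prodCoact : U × V →ₗ[K] (U × V) ⊗[K] C :=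
  ((LinearMap.inl K U V).rTensor C ∘ₗ δU.coact).coprod ((LinearMap.inr K U V).rTensor C ∘ₗ δ.coact)

theorem prodCoact_inl :
    prodCoact δU δ ∘ₗ LinearMap.inl K U V = (LinearMap.inl K U V).rTensor C ∘ₗ δU.coact :=
  LinearMap.coprod_inl _ _

theorem prodCoact_inr :
    prodCoact δU δ ∘ₗ LinearMap.inr K U V = (LinearMap.inr K U V).rTensor C ∘ₗ δ.coact :=
  LinearMap.coprod_inr _ _

/-- The direct sum of comodules. -/
def prod : RightComodule K C (U × V) where
  coact := prodCoact δU δ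
  coassoc := LinearMap.prod_ext (coassoc_of_comp_eq (prodCoact_inl δU δ))
    (coassoc_of_comp_eq (prodCoact_inr δU δ))
  lTensor_counit := LinearMap.prod_ext (lTensor_counit_of_comp_eq (prodCoact_inl δU δ))
    (lTensor_counit_of_comp_eq (prodCoact_inr δU δ))

theorem coeffMap_prod (f : Module.Dual K U) (g : Module.Dual K V) (u : U) (v : V) :
    (δU.prod δ).coeffMap (f.coprod g) (u, v) = δU.coeffMap f u + δ.coeffMap g v := by
  simp only [coeffMap, prod, prodCoact, LinearMap.comp_apply, LinearMap.coprod_apply, map_add]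
  rw [← LinearMap.rTensor_comp_apply, ← LinearMap.rTensor_comp_apply, LinearMap.coprod_inl,
    LinearMap.coprod_inr]

end Constructions

end RightComodule

end LongKnotInvariant

end

/-! ### The braided category of finite-dimensional comodules. -/

noncomputable section

namespace LongKnotInvariant

open scoped TensorProduct
open Coalgebra CategoryTheory MonoidalCategory

/-- The finite-dimensional comodules over a dual quasitriangular bialgebra. -/
structure FDComodule {K : Type u} [Field K] {C : Type w} [Ring C] [Bialgebra K C]
    {ϱ : C ⊗[K] C →ₗ[K] K} (hϱ : IsDualQuasitriangular K C ϱ) where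
  /-- The underlying vector space. -/
  obj : FGModuleCat.{u} K
  /-- The coaction. -/
  coaction : RightComodule K C obj

namespace FDComodule

open RightComodule

section

variable {K : Type u} [Field K] {C : Type w} [Ring C] [Bialgebra K C] {ϱ : C ⊗[K] C →ₗ[K] K}
  {hϱ : IsDualQuasitriangular K C ϱ}

/-- Morphisms of comodules. -/
@[ext]
structure Hom (X Y : FDComodule hϱ) where
  /-- The underlying linear map. -/
  hom : X.obj ⟶ Y.obj
  isHom : IsHom X.coaction Y.coaction hom.hom.hom

instance : Category (FDComodule hϱ) where
  Hom := Hom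
  id X := ⟨𝟙 X.obj, isHom_id⟩
  comp f g := ⟨f.hom ≫ g.hom, g.isHom.comp f.isHom⟩

@[ext]
theorem hom_ext {X Y : FDComodule hϱ} {f g : X ⟶ Y} (h : f.hom = g.hom) : f = g := Hom.ext h

variable (hϱ) in
/-- The forgetful functor to finite-dimensional vector spaces. -/
def forget : FDComodule hϱ ⥤ FGModuleCat.{u} K where
  obj X := X.obj
  map f := f.hom

/-- An isomorphism of the underlying vector spaces which commutes with the coactions. -/
def mkIso {X Y : FDComodule hϱ} (e : X.obj ≅ Y.obj)
    (h : IsHom X.coaction Y.coaction e.hom.hom.hom) : X ≅ Y where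
  hom := ⟨e.hom, h⟩
  inv := ⟨e.inv, IsHom.inv (e := FGModuleCat.isoToLinearEquiv e) h⟩
  hom_inv_id := hom_ext e.hom_inv_id
  inv_hom_id := hom_ext e.inv_hom_id

instance : MonoidalCategoryStruct (FDComodule hϱ) where
  tensorObj X Y := ⟨X.obj ⊗ Y.obj, X.coaction.tensor Y.coaction⟩
  whiskerLeft X _ _ f := ⟨X.obj ◁ f.hom, IsHom.tensor isHom_id f.isHom⟩
  whiskerRight f Y := ⟨f.hom ▷ Y.obj, IsHom.tensor f.isHom isHom_id⟩
  tensorHom f g := ⟨f.hom ⊗ₘ g.hom, IsHom.tensor f.isHom g.isHom⟩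
  tensorUnit := ⟨𝟙_ _, RightComodule.unit K C⟩
  associator X Y Z := mkIso (α_ X.obj Y.obj Z.obj) isHom_assoc
  leftUnitor X := mkIso (λ_ X.obj) isHom_lid
  rightUnitor X := mkIso (ρ_ X.obj) isHom_rid

/-- The structure maps are those of vector spaces and the forgetful functor is faithful, so every
axiom is inherited. -/
instance : MonoidalCategory (FDComodule hϱ) where
  tensorHom_def f g := hom_ext (tensorHom_def f.hom g.hom)
  id_tensorHom_id X Y := hom_ext (id_tensorHom_id X.obj Y.obj)
  tensorHom_comp_tensorHom f g f' g' :=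
    hom_ext (tensorHom_comp_tensorHom f.hom g.hom f'.hom g'.hom)
  whiskerLeft_id X Y := hom_ext (whiskerLeft_id X.obj Y.obj)
  id_whiskerRight X Y := hom_ext (id_whiskerRight X.obj Y.obj)
  associator_naturality f g h := hom_ext (associator_naturality f.hom g.hom h.hom)
  leftUnitor_naturality f := hom_ext (leftUnitor_naturality f.hom)
  rightUnitor_naturality f := hom_ext (rightUnitor_naturality f.hom)
  pentagon X Y Z W := hom_ext (pentagon X.obj Y.obj Z.obj W.obj)
  triangle X Y := hom_ext (triangle X.obj Y.obj)

/-- The inverse of the R-matrix functional. -/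
def inverse (hϱ : IsDualQuasitriangular K C ϱ) : C ⊗[K] C →ₗ[K] K :=
  (hϱ.isUnit.unit⁻¹ : (WithConv (C ⊗[K] C →ₗ[K] K))ˣ).val.ofConv

/-- The braiding of a pair of comodules. -/
def braidingIso (X Y : FDComodule hϱ) : X ⊗ Y ≅ Y ⊗ X :=
  mkIso
    (LinearEquiv.toFGModuleCatIso (LinearEquiv.ofLinearMap (braid X.coaction Y.coaction ϱ)
      (braidInv X.coaction Y.coaction (inverse hϱ))
      (braid_comp_braidInv _ _ hϱ.isUnit.mul_val_inv)
      (braidInv_comp_braid _ _ hϱ.isUnit.val_inv_mul)))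
    (isHom_braid hϱ)

/-- The hexagons are the two multiplicativity axioms of ϱ; the commutation axiom has made the
braiding a morphism of comodules. -/
instance : BraidedCategory (FDComodule hϱ) where
  braiding := braidingIso
  braiding_naturality_right X _ _ f :=
    hom_ext (FGModuleCat.hom_ext (braid_naturality ϱ (isHom_id (δU := X.coaction)) f.isHom))
  braiding_naturality_left f Z :=
    hom_ext (FGModuleCat.hom_ext (braid_naturality ϱ f.isHom (isHom_id (δU := Z.coaction))))
  hexagon_forward _ _ _ := hom_ext (FGModuleCat.hom_ext
    (braid_tensor_right hϱ))
  hexagon_reverse _ _ _ := hom_ext (FGModuleCat.hom_ext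
    (braid_tensor_left hϱ))

end

end FDComodule

end LongKnotInvariant

end

/-! ### Exact pairings of vector spaces lift to comodules. -/

noncomputable section

namespace LongKnotInvariant

open scoped TensorProduct
open Coalgebra CategoryTheory MonoidalCategory

/-- Expand `co 1` as a sum of b i ⊗ c i. One zigzag identity says that c is biorthogonal to b, the
other that c spans `F`. So every adjunction is the standard one in suitable bases, which permits
arbitrary `F`. -/
theorem exists_dualBasis {K : Type*} [Field K] {V F : Type*} [AddCommGroup V] [Module K V]
    [AddCommGroup F] [Module K F] {ι : Type*} [Fintype ι] [DecidableEq ι] (b : Module.Basis ι K V)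
    (ev : F ⊗[K] V →ₗ[K] K) (co : K →ₗ[K] V ⊗[K] F)
    (h₁ : ev.lTensor V ∘ₗ (TensorProduct.assoc K V F V).toLinearMap ∘ₗ co.rTensor V =
      (TensorProduct.rid K V).symm.toLinearMap ∘ₗ (TensorProduct.lid K V).toLinearMap)
    (h₂ : ev.rTensor F ∘ₗ (TensorProduct.assoc K F V F).symm.toLinearMap ∘ₗ co.lTensor F =
      (TensorProduct.lid K F).symm.toLinearMap ∘ₗ (TensorProduct.rid K F).toLinearMap) :
    ∃ f : Module.Basis ι K F, (∀ i j, ev (f i ⊗ₜ b j) = if i = j then 1 else 0) ∧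
      co 1 = ∑ i, b i ⊗ₜ f i := by
  obtain ⟨c, hc⟩ := TensorProduct.eq_repr_basis_left b (co 1)
  rw [Finsupp.sum_fintype _ _ (by simp)] at hc
  have hev : ∀ i j, ev (c i ⊗ₜ b j) = if i = j then 1 else 0 := by
    intro i j
    have h := congrArg (TensorProduct.rid K V) (LinearMap.congr_fun h₁ (1 ⊗ₜ b j))
    simp only [LinearMap.comp_apply, LinearMap.rTensor_tmul, ← hc, TensorProduct.sum_tmul, map_sum,
      LinearEquiv.coe_coe, TensorProduct.assoc_tmul, LinearMap.lTensor_tmul, TensorProduct.rid_tmul,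
      TensorProduct.lid_tmul, one_smul, LinearEquiv.apply_symm_apply] at h
    have h' := congrArg (fun v => b.repr v i) h
    simpa [Finsupp.single_apply, eq_comm] using h'
  have hsum : ∀ x, ∑ i, ev (x ⊗ₜ b i) • c i = x := by
    intro x
    have h := congrArg (TensorProduct.lid K F) (LinearMap.congr_fun h₂ (x ⊗ₜ 1))
    simpa [← hc, TensorProduct.tmul_sum] using h
  have hli : LinearIndependent K c := by
    rw [Fintype.linearIndependent_iff]
    intro g hg j
    have h := congrArg (fun x => ev (x ⊗ₜ b j)) hg
    simpa [TensorProduct.sum_tmul, ← TensorProduct.smul_tmul', hev] using h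
  refine ⟨Module.Basis.mk hli fun x _ => ?_, by simpa using hev, by simpa using hc.symm⟩
  rw [← hsum x]
  exact Submodule.sum_mem _ fun i _ => Submodule.smul_mem _ _ (Submodule.subset_span ⟨i, rfl⟩)

namespace FDComodule

open RightComodule

variable {K : Type u} [Field K] {C : Type w} [Ring C] [HopfAlgebra K C] {ϱ : C ⊗[K] C →ₗ[K] K}
  {hϱ : IsDualQuasitriangular K C ϱ}

theorem exists_exactPairing (X : FDComodule hϱ) (F : FGModuleCat.{u} K) [ExactPairing X.obj F] :
    ∃ δ : RightComodule K C F,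
      IsHom (δ.tensor X.coaction) (RightComodule.unit K C)
        (ExactPairing.evaluation X.obj F).hom.hom ∧
      IsHom (RightComodule.unit K C) (X.coaction.tensor δ)
        (ExactPairing.coevaluation X.obj F).hom.hom := by
  obtain ⟨f, h₁, h₂⟩ := exists_dualBasis (Module.finBasis K X.obj)
    (ExactPairing.evaluation X.obj F).hom.hom
    (ExactPairing.coevaluation X.obj F).hom.hom
    (congrArg (fun f => f.hom.hom) (ExactPairing.evaluation_coevaluation X.obj F))
    (congrArg (fun f => f.hom.hom) (ExactPairing.coevaluation_evaluation X.obj F))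
  exact ⟨X.coaction.dual _ f, isHom_evaluation _ _ _ h₁, isHom_coevaluation _ _ _ h₂⟩

/-- The coaction on a dual of the underlying vector space. -/
def dualObj (X : FDComodule hϱ) (F : FGModuleCat.{u} K) [ExactPairing X.obj F] :
    FDComodule hϱ :=
  ⟨F, (exists_exactPairing X F).choose⟩

instance (X : FDComodule hϱ) (F : FGModuleCat.{u} K) [ExactPairing X.obj F] :
    ExactPairing X (dualObj X F) where
  coevaluation' := ⟨ExactPairing.coevaluation X.obj F, (exists_exactPairing X F).choose_spec.2⟩
  evaluation' := ⟨ExactPairing.evaluation X.obj F, (exists_exactPairing X F).choose_spec.1⟩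
  coevaluation_evaluation' := hom_ext (ExactPairing.coevaluation_evaluation X.obj F)
  evaluation_coevaluation' := hom_ext (ExactPairing.evaluation_coevaluation X.obj F)

end FDComodule

end LongKnotInvariant

end

/-! ### Forgetting the coaction commutes with the evaluation of diagrams. -/

noncomputable section

namespace LongKnotInvariant

open scoped TensorProduct
open Coalgebra CategoryTheory MonoidalCategory

namespace FDComodule

open RightComodule Strand

variable {K : Type u} [Field K] {C : Type w} [Ring C] [HopfAlgebra K C] {ϱ : C ⊗[K] C →ₗ[K] K}
  {hϱ : IsDualQuasitriangular K C ϱ} (G : FDComodule hϱ) (F : FGModuleCat.{u} K)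
  [ExactPairing G.obj F]

theorem rotate_hom {X Y : FDComodule hϱ} (f : X ⊗ G ⟶ G ⊗ Y) :
    (rotate (dualObj G F) f).hom =
      rotate (C := FGModuleCat K) (G := G.obj) (X := X.obj) (Y := Y.obj) F f.hom := by
  rfl

theorem inv_hom {X Y : FDComodule hϱ} (f : X ⟶ Y) [IsIso f] :
    ∃ _ : IsIso f.hom, (inv f).hom = inv f.hom := by
  have : IsIso ((forget hϱ).map f) := inferInstance
  exact ⟨this, (forget hϱ).map_inv f⟩

/-- Forgetting the coaction keeps the monoidal structure, the pairing and all inverses, hence also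
rotations and rigidity. -/
theorem isRigidRMatrix_hom {r : G ⊗ G ⟶ G ⊗ G} (h : IsRigidRMatrix (dualObj G F) r) :
    IsRigidRMatrix (C := FGModuleCat K) (G := G.obj) F r.hom := by
  have := h.isIso
  have := h.isIso_rotate
  have := h.isIso_rotate_inv
  obtain ⟨h1, h1'⟩ := inv_hom r
  refine ⟨h1, congrArg Hom.hom h.yangBaxter, ?_, ?_⟩
  · rw [← rotate_hom]
    exact (inv_hom _).1
  · have h2 := rotate_hom G F (inv r)
    rw [h1'] at h2
    erw [← h2]
    exact (inv_hom _).1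

variable {G F}

section

theorem inv_congr {D : Type*} [Category D] {X Y : D} {f g : X ⟶ Y} [IsIso f] [IsIso g]
    (e : f = g) : inv f = inv g := by
  subst e
  rfl

theorem comp_id_tensorHom_id {D : Type*} [Category D] [MonoidalCategory D] {X Y : D}
    {f g : X ⊗ Y ⟶ Y ⊗ X} (e : f = g) : f ≫ (𝟙 Y ⊗ₘ 𝟙 X) = (𝟙 X ⊗ₘ 𝟙 Y) ≫ g := by
  simp [e]

variable {r : G ⊗ G ⟶ G ⊗ G} (h : IsRigidRMatrix (dualObj G F) r)
  (h' : IsRigidRMatrix (C := FGModuleCat K) (G := G.obj) F r.hom)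

theorem rInv_hom : (rInv h).hom = rInv h' := by
  have := h.isIso
  exact (inv_hom r).2

theorem rotateInv_hom : (rotateInv h).hom = rotateInv h' := by
  have := h.isIso_rotate
  exact (inv_hom (rotate (dualObj G F) r)).2

theorem rotateRInvInv_hom : (rotateRInvInv h).hom = rotateRInvInv h' := by
  have := h.isIso
  have := h.isIso_rotate_inv
  have := h'.isIso
  have := h'.isIso_rotate_inv
  obtain ⟨_, h1⟩ := inv_hom (rotate (dualObj G F) (inv r))
  refine h1.trans (@inv_congr _ _ _ _ _ _ (_) h'.isIso_rotate_inv ?_)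
  rw [rotate_hom, (inv_hom r).2]

/-- The object of a strand, compared with its underlying vector space. -/
def strandIso : (s : Strand) → ((strandObj G (dualObj G F) s).obj ≅ strandObj G.obj F s)
  | up => Iso.refl _
  | down => Iso.refl _

/-- The object of a sequence of strands, compared with its underlying vector space. -/
def tensorIso : (a : List Strand) → ((tensorObjs G (dualObj G F) a).obj ≅ tensorObjs G.obj F a)
  | [] => Iso.refl _
  | s :: a => strandIso s ⊗ᵢ tensorIso a

/-- The comparison maps are all identities. They are present because the two objects of a strand are
identified only after its direction is known. -/
theorem crossingMap_hom (o : Bool) (s t : Strand) :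
    (crossingMap h o s t).hom ≫ ((strandIso t).hom ⊗ₘ (strandIso s).hom) =
      ((strandIso s).hom ⊗ₘ (strandIso t).hom) ≫ crossingMap h' o s t := by
  match o, s, t with
  | true, up, up => exact comp_id_tensorHom_id rfl
  | false, up, up => exact comp_id_tensorHom_id (rInv_hom h h')
  | false, down, up => exact comp_id_tensorHom_id (rotate_hom G F r)
  | true, down, up => exact comp_id_tensorHom_id ((rotate_hom G F _).trans (by rw [rInv_hom h h']; rfl))
  | true, down, down =>
    exact comp_id_tensorHom_id ((rotate_hom G F _).trans (by erw [rotate_hom G F]; rfl))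
  | false, down, down =>
    exact comp_id_tensorHom_id ((rotate_hom G F _).trans
      (by erw [rotate_hom G F, rInv_hom h h']; rfl))
  | false, up, down => exact comp_id_tensorHom_id (rotateRInvInv_hom h h')
  | true, up, down => exact comp_id_tensorHom_id (rotateInv_hom h h')

theorem cap_comp {D : Type*} [Category D] [MonoidalCategory D] {X Y T T' : D} (e : X ⊗ Y ⟶ 𝟙_ D)
    (t : T ⟶ T') : ((α_ X Y T).inv ≫ e ▷ T ≫ (λ_ T).hom) ≫ t =
      (𝟙 X ⊗ₘ (𝟙 Y ⊗ₘ t)) ≫ (α_ X Y T').inv ≫ e ▷ T' ≫ (λ_ T').hom := by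
  simp only [id_tensorHom, Category.assoc]
  rw [associator_inv_naturality_right_assoc, whisker_exchange_assoc, leftUnitor_naturality]

theorem cup_comp {D : Type*} [Category D] [MonoidalCategory D] {X Y T T' : D} (e : 𝟙_ D ⟶ X ⊗ Y)
    (t : T ⟶ T') : ((λ_ T).inv ≫ e ▷ T ≫ (α_ X Y T).hom) ≫ (𝟙 X ⊗ₘ (𝟙 Y ⊗ₘ t)) =
      t ≫ (λ_ T').inv ≫ e ▷ T' ≫ (α_ X Y T').hom := by
  simp only [id_tensorHom, Category.assoc]
  rw [← associator_naturality_right, ← whisker_exchange_assoc, leftUnitor_inv_naturality_assoc]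

theorem cross_comp {D : Type*} [Category D] [MonoidalCategory D] {X Y X' Y' T T' : D}
    {c : X ⊗ Y ⟶ Y ⊗ X} {c' : X' ⊗ Y' ⟶ Y' ⊗ X'} {x : X ⟶ X'} {y : Y ⟶ Y'}
    (e : c ≫ (y ⊗ₘ x) = (x ⊗ₘ y) ≫ c')
    (t : T ⟶ T') : ((α_ X Y T).inv ≫ c ▷ T ≫ (α_ Y X T).hom) ≫ (y ⊗ₘ (x ⊗ₘ t)) =
      (x ⊗ₘ (y ⊗ₘ t)) ≫ (α_ X' Y' T').inv ≫ c' ▷ T' ≫ (α_ Y' X' T').hom := by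
  have h1 : c ▷ T ≫ ((y ⊗ₘ x) ⊗ₘ t) = ((x ⊗ₘ y) ⊗ₘ t) ≫ c' ▷ T' := by
    rw [← tensorHom_id, ← tensorHom_id, tensorHom_comp_tensorHom, tensorHom_comp_tensorHom, e,
      Category.id_comp, Category.comp_id]
  rw [Category.assoc, Category.assoc, ← associator_naturality, associator_inv_naturality_assoc,
    reassoc_of% h1]

theorem layerMap_hom {a b : List Strand} (L : Layer a b) :
    (layerMap h L).hom ≫ (tensorIso b).hom = (tensorIso a).hom ≫ layerMap h' L := by
  induction L with
  | capL a => exact cap_comp (ExactPairing.evaluation G.obj F) (tensorIso a).hom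
  | capR a =>
    have h1 : (crossingMap h true up down).hom = crossingMap h' true up down := rotateInv_hom h h'
    refine (cap_comp ((crossingMap h true up down).hom ≫ ExactPairing.evaluation G.obj F)
      (tensorIso a).hom).trans ?_
    rw [h1]
    rfl
  | cupL a => exact cup_comp (ExactPairing.coevaluation G.obj F) (tensorIso a).hom
  | cupR a =>
    have h1 : (crossingMap h false up down).hom = crossingMap h' false up down :=
      rotateRInvInv_hom h h'
    refine (cup_comp (ExactPairing.coevaluation G.obj F ≫ (crossingMap h false up down).hom)
      (tensorIso a).hom).trans ?_
    rw [h1]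
    rfl
  | cross o s t a => exact cross_comp (crossingMap_hom h h' o s t) (tensorIso a).hom
  | @skip s a b L ih =>
    change _ ◁ (layerMap h L).hom ≫ ((strandIso s).hom ⊗ₘ (tensorIso b).hom) =
      ((strandIso s).hom ⊗ₘ (tensorIso a).hom) ≫ _ ◁ layerMap h' L
    rw [MonoidalCategory.tensorHom_def, whisker_exchange_assoc, ← MonoidalCategory.whiskerLeft_comp, ih]
    simp [MonoidalCategory.tensorHom_def]

theorem diagramMap_hom {a b : List Strand} (D : Diagram a b) :
    (diagramMap h D).hom ≫ (tensorIso b).hom = (tensorIso a).hom ≫ diagramMap h' D := by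
  induction D with
  | nil a => exact (Category.id_comp _).trans (Category.comp_id _).symm
  | cons L D ih =>
    refine (Category.assoc _ _ _).trans ?_
    rw [ih, ← Category.assoc, layerMap_hom h h', Category.assoc]
    rfl

theorem RT_hom (D : Diagram [up] [up]) : (RT h D).hom = RT h' D := by
  have h1 := diagramMap_hom h h' D
  have h2 : (tensorIso (G := G) (F := F) [up]).hom = 𝟙 _ := by
    exact id_tensorHom_id _ _
  rw [h2] at h1
  have h3 : (diagramMap h D).hom = diagramMap h' D :=
    (Category.comp_id _).symm.trans (h1.trans (Category.id_comp _))
  change (ρ_ G.obj).inv ≫ (diagramMap h D).hom ≫ (ρ_ G.obj).hom = _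
  rw [h3]
  rfl

theorem invariantJ_hom (D : LongKnotDiagram) : (invariantJ h D).hom = invariantJ h' D :=
  RT_hom h h' _

end

end FDComodule

end LongKnotInvariant

end

/-! ### From a natural endomorphism to a functional on C. -/

noncomputable section

namespace LongKnotInvariant

open scoped TensorProduct
open Coalgebra CategoryTheory MonoidalCategory

namespace RightComodule

variable {K : Type u} [Field K] {C : Type w} [AddCommGroup C] [Module K C] [Coalgebra K C]
  {U V : Type*} [AddCommGroup U] [Module K U] [AddCommGroup V] [Module K V]
  (δU : RightComodule K C U) (δ : RightComodule K C V)

theorem coact_fst : δU.coact ∘ₗ LinearMap.fst K U V =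
    (LinearMap.fst K U V).rTensor C ∘ₗ (δU.prod δ).coact := by
  refine LinearMap.prod_ext ?_ ?_
  · rw [LinearMap.comp_assoc, LinearMap.comp_assoc, prod, prodCoact_inl, ← LinearMap.comp_assoc,
      ← LinearMap.comp_assoc, ← LinearMap.rTensor_comp, LinearMap.fst_comp_inl, LinearMap.rTensor_id]
    rfl
  · rw [LinearMap.comp_assoc, LinearMap.comp_assoc, prod, prodCoact_inr, ← LinearMap.comp_assoc,
      ← LinearMap.comp_assoc, ← LinearMap.rTensor_comp, LinearMap.fst_comp_inr, LinearMap.rTensor_zero,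
      LinearMap.zero_comp, LinearMap.comp_assoc]
    simp

theorem coact_snd : δ.coact ∘ₗ LinearMap.snd K U V =
    (LinearMap.snd K U V).rTensor C ∘ₗ (δU.prod δ).coact := by
  refine LinearMap.prod_ext ?_ ?_
  · rw [LinearMap.comp_assoc, LinearMap.comp_assoc, prod, prodCoact_inl, ← LinearMap.comp_assoc,
      ← LinearMap.comp_assoc, ← LinearMap.rTensor_comp, LinearMap.snd_comp_inl, LinearMap.rTensor_zero,
      LinearMap.zero_comp, LinearMap.comp_assoc]
    simp
  · rw [LinearMap.comp_assoc, LinearMap.comp_assoc, prod, prodCoact_inr, ← LinearMap.comp_assoc,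
      ← LinearMap.comp_assoc, ← LinearMap.rTensor_comp, LinearMap.snd_comp_inr, LinearMap.rTensor_id]
    rfl

/-- The action of a functional on a comodule is determined by the coefficients. -/
theorem rid_lTensor_coact (z : C →ₗ[K] K) (f : Module.Dual K V) (v : V) :
    f (TensorProduct.rid K V (z.lTensor V (δ.coact v))) = z (δ.coeffMap f v) := by
  simp only [coeffMap, LinearMap.comp_apply, LinearEquiv.coe_coe]
  generalize δ.coact v = t
  induction t with
  | zero => simp
  | add a b ha hb => simp only [map_add, ha, hb]
  | tmul a b => simp [mul_comm]

end RightComodule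

namespace FDComodule

open RightComodule

variable {K : Type u} [Field K] {C : Type w} [Ring C] [HopfAlgebra K C] {ϱ : C ⊗[K] C →ₗ[K] K}
  {hϱ : IsDualQuasitriangular K C ϱ}

section Invariant

variable (D : LongKnotDiagram)

/-- The invariant of a diagram, as an endomorphism of a comodule. -/
def knotHom (X : FDComodule hϱ) : X ⟶ X :=
  invariantJ (isRigidRMatrix_braiding (dualObj X (FGModuleCat.FGModuleCatDual K X.obj))) D

/-- Independence of the adjunction: compatibility with summands applied to the identity of `X`, with
two different pairings. -/
theorem invariantJ_eq_knotHom (X : FDComodule hϱ) (F : FDComodule hϱ) [ExactPairing X F] :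
    invariantJ (isRigidRMatrix_braiding (G := X) F) D = knotHom D X := by
  have := comp_invariantJ_of_retract (isRigidRMatrix_braiding (G := X) F)
    (isRigidRMatrix_braiding (dualObj X (FGModuleCat.FGModuleCatDual K X.obj))) D (𝟙 X) (𝟙 X)
    (Category.comp_id _)
  rw [Category.id_comp, Category.comp_id] at this
  exact this.symm

theorem knotHom_retract {X Y : FDComodule hϱ} (i : X ⟶ Y) (j : Y ⟶ X) (hij : i ≫ j = 𝟙 X) :
    i ≫ knotHom D Y = knotHom D X ≫ i :=
  comp_invariantJ_of_retract _ _ D i j hij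

theorem knotHom_comm {X : FDComodule hϱ} (T : X ⟶ X) : T ≫ knotHom D X = knotHom D X ≫ T :=
  invariantJ_comm _ D T

theorem knotHom_step {D E : LongKnotDiagram} (s : Step D.1 E.1) (X : FDComodule hϱ) :
    knotHom D X = knotHom E X :=
  invariantJ_step _ s

/-- The direct sum of comodules. -/
def prodObj (X Y : FDComodule hϱ) : FDComodule hϱ :=
  ⟨FGModuleCat.of K (X.obj × Y.obj), X.coaction.prod Y.coaction⟩

/-- A linear map which commutes with the coactions, as a morphism. -/
def homMk {X Y : FDComodule hϱ} (f : X.obj →ₗ[K] Y.obj) (h : IsHom X.coaction Y.coaction f) :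
    X ⟶ Y :=
  ⟨ObjectProperty.homMk (ModuleCat.ofHom f), h⟩

/-- The inclusion of the first summand. -/
def inl (X Y : FDComodule hϱ) : X ⟶ prodObj X Y :=
  homMk (LinearMap.inl K X.obj Y.obj) (prodCoact_inl X.coaction Y.coaction)

/-- The inclusion of the second summand. -/
def inr (X Y : FDComodule hϱ) : Y ⟶ prodObj X Y :=
  homMk (LinearMap.inr K X.obj Y.obj) (prodCoact_inr X.coaction Y.coaction)

/-- The projection to the first summand. -/
def fst (X Y : FDComodule hϱ) : prodObj X Y ⟶ X :=
  homMk (LinearMap.fst K X.obj Y.obj) (coact_fst X.coaction Y.coaction)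

/-- The projection to the second summand. -/
def snd (X Y : FDComodule hϱ) : prodObj X Y ⟶ Y :=
  homMk (LinearMap.snd K X.obj Y.obj) (coact_snd X.coaction Y.coaction)

theorem inl_fst (X Y : FDComodule hϱ) : inl X Y ≫ fst X Y = 𝟙 X := rfl

theorem inr_snd (X Y : FDComodule hϱ) : inr X Y ≫ snd X Y = 𝟙 Y := rfl

/-- The invariant of a diagram is a natural transformation. -/
theorem knotHom_naturality {X Y : FDComodule hϱ} (g : X ⟶ Y) :
    g ≫ knotHom D Y = knotHom D X ≫ g := by
  have h1 := knotHom_retract D _ _ (inl_fst X Y)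
  have h2 := knotHom_retract D _ _ (inr_snd X Y)
  -- A map between different objects cannot be a bead, but as an off-diagonal endomorphism of X ⊕ Y
  -- it can. Naturality is the component from `X` to `Y` of the resulting commutation.
  have h3 := knotHom_comm D (fst X Y ≫ g ≫ inr X Y)
  have h4 := congrArg (fun f => inl X Y ≫ f ≫ snd X Y) h3
  simp only [Category.assoc] at h4
  rw [reassoc_of% (inl_fst X Y), reassoc_of% h2, inr_snd, Category.comp_id, reassoc_of% h1,
    reassoc_of% (inl_fst X Y), Category.comp_id] at h4
  exact h4

/-- The invariant of a diagram, as a linear map. -/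
def knotMap (X : FDComodule hϱ) : X.obj →ₗ[K] X.obj := (knotHom D X).hom.hom.hom

theorem knotMap_naturality {X Y : FDComodule hϱ} (g : X ⟶ Y) (x : X.obj) :
    knotMap D Y (g.hom.hom.hom x) = g.hom.hom.hom (knotMap D X x) :=
  LinearMap.congr_fun (congrArg (fun f => f.hom.hom.hom) (knotHom_naturality D g)) x

theorem knotMap_prod {X Y : FDComodule hϱ} (x : X.obj) (y : Y.obj) :
    knotMap D (prodObj X Y) (x, y) = (knotMap D X x, knotMap D Y y) := by
  have h1 : knotMap D (prodObj X Y) (x, 0) = (knotMap D X x, 0) := knotMap_naturality D (inl X Y) x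
  have h2 : knotMap D (prodObj X Y) (0, y) = (0, knotMap D Y y) := knotMap_naturality D (inr X Y) y
  have h3 : ((x, y) : X.obj × Y.obj) = (x, 0) + (0, y) := by simp
  refine (congrArg (knotMap D (prodObj X Y)) h3).trans ?_
  refine (map_add (knotMap D (prodObj X Y)) (x, 0) (0, y)).trans ?_
  refine (congrArg₂ (· + ·) h1 h2).trans ?_
  exact Prod.ext (add_zero _) (zero_add _)

/-- A vector with zero coefficient dies in a quotient comodule through which `f` factors, and the
invariant is natural for the quotient map. -/
theorem knotMap_eq_zero {X : FDComodule hϱ} {f : Module.Dual K X.obj} {x : X.obj}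
    (h : X.coaction.coeffMap f x = 0) : f (knotMap D X x) = 0 := by
  obtain ⟨N, δ, g, h1, rfl, hx⟩ := X.coaction.exists_quotient f x h
  let Y : FDComodule hϱ := ⟨FGModuleCat.of K (X.obj ⧸ N), δ⟩
  have h2 : knotMap D Y (N.mkQ x) = N.mkQ (knotMap D X x) :=
    knotMap_naturality D (homMk (Y := Y) N.mkQ h1) x
  rw [LinearMap.comp_apply, ← h2, show N.mkQ x = 0 from (Submodule.Quotient.mk_eq_zero N).2 hx]
  exact (congrArg g (map_zero (knotMap D Y))).trans (map_zero g)

/-- The difference of the two coefficients is the coefficient of (x, -y) in X ⊕ Y, so the vanishing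
case applies. This makes the functional on C well defined. -/
theorem knotMap_congr {X Y : FDComodule hϱ} {f : Module.Dual K X.obj} {g : Module.Dual K Y.obj}
    {x : X.obj} {y : Y.obj} (h : X.coaction.coeffMap f x = Y.coaction.coeffMap g y) :
    f (knotMap D X x) = g (knotMap D Y y) := by
  have h1 : (prodObj X Y).coaction.coeffMap (f.coprod g) (x, -y) = 0 := by
    refine (coeffMap_prod X.coaction Y.coaction f g x (-y)).trans ?_
    rw [h, map_neg, add_neg_cancel]
  have h2 := knotMap_eq_zero D h1
  erw [knotMap_prod] at h2
  have h3 : f (knotMap D X x) + g (knotMap D Y (-y)) = 0 := h2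
  rwa [map_neg, map_neg, add_neg_eq_zero] at h3

variable (hϱ) in
theorem exists_coeff (c : C) : ∃ p : (X : FDComodule hϱ) × Module.Dual K X.obj × X.obj,
    p.1.coaction.coeffMap p.2.1 p.2.2 = c := by
  obtain ⟨n, δ, f, v, h⟩ := exists_coeffMap_eq (K := K) c
  exact ⟨⟨⟨FGModuleCat.of K (Fin n → K), δ⟩, f, v⟩, h⟩

variable (hϱ) in
/-- The value of the invariant functional of a diagram. -/
def knotValue (c : C) : K :=
  (exists_coeff hϱ c).choose.2.1 (knotMap D _ (exists_coeff hϱ c).choose.2.2)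

theorem knotValue_coeffMap (X : FDComodule hϱ) (f : Module.Dual K X.obj) (x : X.obj) :
    knotValue hϱ D (X.coaction.coeffMap f x) = f (knotMap D X x) :=
  knotMap_congr D (exists_coeff hϱ _).choose_spec

variable (hϱ) in
/-- The invariant functional of a diagram. -/
def knotFunctional : C →ₗ[K] K where
  toFun := knotValue hϱ D
  map_add' a b := by
    obtain ⟨⟨X, f, x⟩, rfl⟩ := exists_coeff hϱ a
    obtain ⟨⟨Y, g, y⟩, rfl⟩ := exists_coeff hϱ b
    -- A sum of two coefficients is a coefficient of the direct sum, on which the invariant acts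
    -- componentwise.
    have h1 : knotValue hϱ D ((prodObj X Y).coaction.coeffMap (f.coprod g) (x, y)) =
        (f.coprod g) (knotMap D X x, knotMap D Y y) := 
      (knotValue_coeffMap D (prodObj X Y) _ _).trans (congrArg (f.coprod g) (knotMap_prod D x y))
    have h2 : (prodObj X Y).coaction.coeffMap (f.coprod g) (x, y) =
      X.coaction.coeffMap f x + Y.coaction.coeffMap g y := coeffMap_prod _ _ _ _ _ _
    rw [h2] at h1
    rw [h1, knotValue_coeffMap, knotValue_coeffMap]
    rfl
  map_smul' k a := by
    obtain ⟨⟨X, f, x⟩, rfl⟩ := exists_coeff hϱ a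
    simp only [← map_smul, knotValue_coeffMap, RingHom.id_apply]

theorem knotFunctional_step {D E : LongKnotDiagram} (s : Step D.1 E.1) :
    knotFunctional hϱ D = knotFunctional hϱ E := by
  refine LinearMap.ext fun c => ?_
  obtain ⟨⟨X, f, x⟩, rfl⟩ := exists_coeff hϱ c
  refine (knotValue_coeffMap D X f x).trans (Eq.trans ?_ (knotValue_coeffMap E X f x).symm)
  rw [knotMap, knotMap, knotHom_step s]

end Invariant

variable (hϱ) in
/-- The universal invariant of long knots. -/
def universalInvariant : LongKnot → WithConv (C →ₗ[K] K) :=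
  Quot.lift (fun D => WithConv.toConv (knotFunctional hϱ D)) fun _ _ s =>
    congrArg WithConv.toConv (knotFunctional_step s)

section

variable {V : Type u} [AddCommGroup V] [Module K V] [FiniteDimensional K V]
  (δ : RightComodule K C V) (F : FGModuleCat.{u} K) [ExactPairing (FGModuleCat.of K V) F]

variable (hϱ) in
/-- A finite-dimensional comodule as an object. -/
abbrev of : FDComodule hϱ := ⟨FGModuleCat.of K V, δ⟩

-- `rMatrixHom` is the linear map underlying the braiding of the comodule with itself, so rigidity
-- descends from the braided category.
include hϱ in
theorem isRigidRMatrix_rMatrixHom : IsRigidRMatrix F (δ.rMatrixHom ϱ) :=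
  let : ExactPairing (of hϱ δ).obj F := inferInstanceAs (ExactPairing (FGModuleCat.of K V) F)
  isRigidRMatrix_hom (of hϱ δ) F (isRigidRMatrix_braiding (dualObj (of hϱ δ) F))

theorem invariantJ_apply (h : IsRigidRMatrix F (δ.rMatrixHom ϱ)) (D : LongKnotDiagram) (v : V) :
    (invariantJ h D).hom.hom v = TensorProduct.rid K V
      ((universalInvariant hϱ D.toLongKnot).ofConv.lTensor V (δ.coact v)) := by
  let : ExactPairing (of hϱ δ).obj F := inferInstanceAs (ExactPairing (FGModuleCat.of K V) F)
  have h1 := invariantJ_hom (isRigidRMatrix_braiding (dualObj (of hϱ δ) F)) h D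
  rw [invariantJ_eq_knotHom] at h1
  refine (LinearMap.congr_fun (congrArg (fun f => f.hom.hom) h1) v).symm.trans ?_
  -- Functionals separate vectors, and each functional turns the claim into the defining property of
  -- Z on a coefficient.
  rw [← sub_eq_zero, ← Module.forall_dual_apply_eq_zero_iff K]
  intro f
  rw [map_sub, sub_eq_zero, rid_lTensor_coact]
  exact (knotValue_coeffMap D (of hϱ δ) f v).symm

end

end FDComodule

end LongKnotInvariant

end

noncomputable section

namespace LongKnotInvariant

open scoped TensorProduct
open Coalgebra WithConv

/-! ### The Yang–Baxter relation and convolution invertibility. -/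

section Legs

variable {K : Type u} [Field K] {C : Type w} [Ring C] [Bialgebra K C] (ϱ : C ⊗[K] C →ₗ[K] K)

theorem sum_counit_mul {a : C} {ι : Type*} (r : Coalgebra.Repr K a ι) (g : C →ₗ[K] K) :
    ∑ i ∈ r.index, counit (R := K) (r.left i) * g (r.right i) = g a := by
  conv_rhs => rw [← sum_counit_smul r]
  simp

theorem sum_mul_counit {a : C} {ι : Type*} (r : Coalgebra.Repr K a ι) (g : C →ₗ[K] K) :
    ∑ i ∈ r.index, g (r.left i) * counit (R := K) (r.right i) = g a := by
  have h := congrArg (TensorProduct.rid K C) (sum_tmul_counit_eq r)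
  simp only [map_sum, TensorProduct.rid_tmul, one_smul] at h
  conv_rhs => rw [← h]
  simp [mul_comm]

theorem convMul_tmul_tmul {ι κ μ : Type*} (u v : WithConv (C ⊗[K] (C ⊗[K] C) →ₗ[K] K))
    {x y z : C} (rx : Coalgebra.Repr K x ι) (ry : Coalgebra.Repr K y κ)
    (rz : Coalgebra.Repr K z μ) :
    (u * v) (x ⊗ₜ (y ⊗ₜ z)) = ∑ a ∈ rx.index, ∑ b ∈ ry.index, ∑ c ∈ rz.index,
      u (rx.left a ⊗ₜ (ry.left b ⊗ₜ rz.left c)) * v (rx.right a ⊗ₜ (ry.right b ⊗ₜ rz.right c)) := by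
  rw [(rx.tmul (ry.tmul rz)).convMul_apply]
  simp [Coalgebra.Repr.tmul, Finset.sum_product]

theorem leg12_tmul (a b c : C) : leg12 ϱ (a ⊗ₜ (b ⊗ₜ c)) = ϱ (a ⊗ₜ b) * counit (R := K) c := by
  simp [leg12]

theorem leg13_tmul (a b c : C) : leg13 ϱ (a ⊗ₜ (b ⊗ₜ c)) = counit (R := K) b * ϱ (a ⊗ₜ c) := by
  simp [leg13]

theorem leg23_tmul (a b c : C) : leg23 ϱ (a ⊗ₜ (b ⊗ₜ c)) = counit (R := K) a * ϱ (b ⊗ₜ c) := by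
  simp [leg23]

theorem leg12_mul_tmul (w : WithConv (C ⊗[K] (C ⊗[K] C) →ₗ[K] K)) (a b c : C) :
    (leg12 ϱ * w) (a ⊗ₜ (b ⊗ₜ c)) = ∑ i ∈ (ℛ K a).index, ∑ j ∈ (ℛ K b).index,
      ϱ ((ℛ K a).left i ⊗ₜ (ℛ K b).left j) *
        w ((ℛ K a).right i ⊗ₜ ((ℛ K b).right j ⊗ₜ c)) := by
  rw [convMul_tmul_tmul _ _ (ℛ K a) (ℛ K b) (ℛ K c)]
  simp only [leg12_tmul, mul_assoc, ← Finset.mul_sum]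
  exact Finset.sum_congr rfl fun i _ => Finset.sum_congr rfl fun j _ => congrArg _
    (sum_counit_mul (ℛ K c) (w.ofConv ∘ₗ TensorProduct.mk K C (C ⊗[K] C) ((ℛ K a).right i) ∘ₗ
      TensorProduct.mk K C C ((ℛ K b).right j)))

theorem mul_leg12_tmul (w : WithConv (C ⊗[K] (C ⊗[K] C) →ₗ[K] K)) (a b c : C) :
    (w * leg12 ϱ) (a ⊗ₜ (b ⊗ₜ c)) = ∑ i ∈ (ℛ K a).index, ∑ j ∈ (ℛ K b).index,
      ϱ ((ℛ K a).right i ⊗ₜ (ℛ K b).right j) *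
        w ((ℛ K a).left i ⊗ₜ ((ℛ K b).left j ⊗ₜ c)) := by
  rw [convMul_tmul_tmul _ _ (ℛ K a) (ℛ K b) (ℛ K c)]
  simp only [leg12_tmul, mul_left_comm _ (ϱ _), ← Finset.mul_sum]
  exact Finset.sum_congr rfl fun i _ => Finset.sum_congr rfl fun j _ => congrArg _
    (sum_mul_counit (ℛ K c) (w.ofConv ∘ₗ TensorProduct.mk K C (C ⊗[K] C) ((ℛ K a).left i) ∘ₗ
      TensorProduct.mk K C C ((ℛ K b).left j)))

variable {ϱ}

/-- The counits in the two legs collapse the sums over `a` and `b`; what remains is multiplicativity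
in the first variable. The opposite order of the legs gives the opposite product. -/
theorem IsDualQuasitriangular.leg13_mul_leg23 (hϱ : IsDualQuasitriangular K C ϱ) (a b c : C) :
    (leg13 ϱ * leg23 ϱ) (a ⊗ₜ (b ⊗ₜ c)) = ϱ ((a * b) ⊗ₜ c) := by
  rw [convMul_tmul_tmul _ _ (ℛ K a) (ℛ K b) (ℛ K c), hϱ.mul_left]
  simp only [leg13_tmul, leg23_tmul]
  have h1 : ∀ k, ∑ i ∈ (ℛ K a).index, ϱ ((ℛ K a).left i ⊗ₜ (ℛ K c).left k) *
      counit (R := K) ((ℛ K a).right i) = ϱ (a ⊗ₜ (ℛ K c).left k) := fun k =>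
    sum_mul_counit (ℛ K a) (ϱ ∘ₗ (TensorProduct.mk K C C).flip ((ℛ K c).left k))
  have h2 : ∀ k, ∑ j ∈ (ℛ K b).index, counit (R := K) ((ℛ K b).left j) *
      ϱ ((ℛ K b).right j ⊗ₜ (ℛ K c).right k) = ϱ (b ⊗ₜ (ℛ K c).right k) := fun k =>
    sum_counit_mul (ℛ K b) (ϱ ∘ₗ (TensorProduct.mk K C C).flip ((ℛ K c).right k))
  simp only [← h1, ← h2, Finset.sum_mul_sum]
  rw [Finset.sum_comm_cycle]
  exact Finset.sum_congr rfl fun _ _ => Finset.sum_congr rfl fun _ _ =>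
    Finset.sum_congr rfl fun _ _ => by ring

theorem IsDualQuasitriangular.leg23_mul_leg13 (hϱ : IsDualQuasitriangular K C ϱ) (a b c : C) :
    (leg23 ϱ * leg13 ϱ) (a ⊗ₜ (b ⊗ₜ c)) = ϱ ((b * a) ⊗ₜ c) := by
  rw [convMul_tmul_tmul _ _ (ℛ K a) (ℛ K b) (ℛ K c), hϱ.mul_left]
  simp only [leg13_tmul, leg23_tmul]
  have h1 : ∀ k, ∑ i ∈ (ℛ K a).index, counit (R := K) ((ℛ K a).left i) *
      ϱ ((ℛ K a).right i ⊗ₜ (ℛ K c).right k) = ϱ (a ⊗ₜ (ℛ K c).right k) := fun k =>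
    sum_counit_mul (ℛ K a) (ϱ ∘ₗ (TensorProduct.mk K C C).flip ((ℛ K c).right k))
  have h2 : ∀ k, ∑ j ∈ (ℛ K b).index, ϱ ((ℛ K b).left j ⊗ₜ (ℛ K c).left k) *
      counit (R := K) ((ℛ K b).right j) = ϱ (b ⊗ₜ (ℛ K c).left k) := fun k =>
    sum_mul_counit (ℛ K b) (ϱ ∘ₗ (TensorProduct.mk K C C).flip ((ℛ K c).left k))
  simp only [← h1, ← h2, mul_comm (∑ j ∈ (ℛ K b).index, _), Finset.sum_mul_sum]
  rw [Finset.sum_comm_cycle]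
  exact Finset.sum_congr rfl fun _ _ => Finset.sum_congr rfl fun _ _ =>
    Finset.sum_congr rfl fun _ _ => by ring

/-- The Yang–Baxter relation in the convolution algebra. -/
theorem IsDualQuasitriangular.yangBaxter (hϱ : IsDualQuasitriangular K C ϱ) :
    leg12 ϱ * leg13 ϱ * leg23 ϱ = leg23 ϱ * leg13 ϱ * leg12 ϱ := by
  rw [mul_assoc]
  refine WithConv.ext (TensorProduct.ext' fun a t => ?_)
  induction t with
  | zero => simp
  | add s t hs ht => simp only [TensorProduct.tmul_add, map_add, hs, ht]
  | tmul b c =>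
    refine (leg12_mul_tmul ϱ _ a b c).trans (Eq.trans ?_ (mul_leg12_tmul ϱ _ a b c).symm)
    simp only [hϱ.leg13_mul_leg23, hϱ.leg23_mul_leg13]
    -- Both sides have become sums of ϱ of a product of `a` and `b` components against `c`: this is
    -- the commutation axiom with ϱ(· ⊗ c) applied.
    have h := congrArg (ϱ ∘ₗ (TensorProduct.mk K C C).flip c) (hϱ.comm a b)
    simpa only [map_sum, map_smul, LinearMap.comp_apply, LinearMap.flip_apply,
      TensorProduct.mk_apply, smul_eq_mul] using h

end Legs

section HopfAlgebra

variable {K : Type u} [Field K] {C : Type w} [Ring C] [HopfAlgebra K C] {ϱ : C ⊗[K] C →ₗ[K] K}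

/-- In a Hopf algebra the invertibility of the form follows from its multiplicativity. -/
theorem isUnit_of_mul_left (one_left : ∀ b, ϱ (1 ⊗ₜ b) = counit b)
    (mul_left : ∀ a b c, ϱ ((a * b) ⊗ₜ c) =
      ∑ i ∈ (ℛ K c).index, ϱ (a ⊗ₜ (ℛ K c).left i) * ϱ (b ⊗ₜ (ℛ K c).right i)) :
    IsUnit (toConv ϱ) := by
  -- The inverse form is ϱ(S(a) ⊗ b). In either convolution product multiplicativity merges the two
  -- first arguments, and the antipode identity finishes.
  let ϱ' : C ⊗[K] C →ₗ[K] K := ϱ ∘ₗ (HopfAlgebra.antipode K).rTensor C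
  have h' : ∀ a b, ϱ' (a ⊗ₜ b) = ϱ (HopfAlgebra.antipode K a ⊗ₜ b) := fun a b => rfl
  refine isUnit_iff_exists.2 ⟨toConv ϱ', ?_, ?_⟩
  · refine WithConv.ext (TensorProduct.ext' fun a b => ?_)
    refine (convMul_tmul _ _ (ℛ K a) (ℛ K b)).trans ?_
    simp only [h', ← mul_left]
    rw [← map_sum, ← TensorProduct.sum_tmul, HopfAlgebra.sum_mul_antipode_eq_smul]
    rw [← TensorProduct.smul_tmul', map_smul, one_left]
    simp [mul_comm]
  · refine WithConv.ext (TensorProduct.ext' fun a b => ?_)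
    refine (convMul_tmul _ _ (ℛ K a) (ℛ K b)).trans ?_
    simp only [h', ← mul_left]
    rw [← map_sum, ← TensorProduct.sum_tmul, HopfAlgebra.sum_antipode_mul_eq_smul]
    rw [← TensorProduct.smul_tmul', map_smul, one_left]
    simp [mul_comm]

end HopfAlgebra

/-! ### Dual quasitriangularity of the restricted dual of the double. -/

namespace QuantumDouble

variable {K : Type u} [Field K] {H : Type v} [Ring H] [HopfAlgebra K H]

/-- The components of the coproduct of `f ∘ ι`. -/
def reprComap {ι : Type*} {f : RestrictedDual K (QuantumDouble K H)} (r : Coalgebra.Repr K f ι) :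
    Coalgebra.Repr K (RestrictedDual.comap (incl K H) f) ι where
  index := r.index
  left i := RestrictedDual.comap (incl K H) (r.left i)
  right i := RestrictedDual.comap (incl K H) (r.right i)
  eq := tensorToDual_ext fun x y => by
    simp only [map_sum, LinearMap.sum_apply, tensorToDual_tmul, tensorToDual_comul,
      RestrictedDual.comap_apply, map_mul, repr_apply]

/-- The components of the coproduct of `j(f)`. -/
def reprInclDual {ι : Type*} {f : RestrictedDual K H} (r : Coalgebra.Repr K f ι) :
    Coalgebra.Repr K (inclDualₗ K H f) ι where
  index := r.index
  left i := inclDualₗ K H (r.left i)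
  right i := inclDualₗ K H (r.right i)
  eq := by
    rw [comul_inclDualₗ, ← r.eq]
    simp

/-- The components of the coproduct of `ι(x)`. -/
def reprIncl {ι : Type*} {x : H} (r : Coalgebra.Repr K x ι) :
    Coalgebra.Repr K (incl K H x) ι where
  index := r.index
  left i := incl K H (r.left i)
  right i := incl K H (r.right i)
  eq := by
    rw [comul_incl, ← r.eq]
    simp

theorem comap_mul (f g : RestrictedDual K (QuantumDouble K H)) :
    RestrictedDual.comap (incl K H) (f * g) =
      RestrictedDual.comap (incl K H) f * RestrictedDual.comap (incl K H) g := by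
  refine RestrictedDual.ext fun x => ?_
  rw [RestrictedDual.comap_apply, RestrictedDual.mul_apply_repr _ _ (reprIncl (ℛ K x)),
    RestrictedDual.mul_apply_repr _ _ (ℛ K x)]
  rfl

/-- The map `y ↦ j(ι^o(y))`. -/
def dualToDouble (K : Type u) [Field K] (H : Type v) [Ring H] [HopfAlgebra K H] :
    RestrictedDual K (QuantumDouble K H) →ₗ[K] QuantumDouble K H :=
  inclDualₗ K H ∘ₗ RestrictedDual.comap (incl K H)

theorem dualRMatrix_tmul (x y : RestrictedDual K (QuantumDouble K H)) :
    dualRMatrix K H (x ⊗ₜ y) = x (dualToDouble K H y) := rfl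

/-- The components of the coproduct of `j(ι^o(y))`. -/
def reprDualToDouble {ι : Type*} {f : RestrictedDual K (QuantumDouble K H)}
    (r : Coalgebra.Repr K f ι) : Coalgebra.Repr K (dualToDouble K H f) ι :=
  reprInclDual (reprComap r)

theorem dualToDouble_mul (f g : RestrictedDual K (QuantumDouble K H)) :
    dualToDouble K H (f * g) = dualToDouble K H g * dualToDouble K H f := by
  simp only [dualToDouble, LinearMap.comp_apply, comap_mul, inclDualₗ_mul]

section Comm

open RestrictedDual

variable (z w : QuantumDouble K H)

/-- The map `b ↦ z₍₁₎ ⟨b, z₍₂₎⟩`. -/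
def rightAct : WithConv (RestrictedDual K (QuantumDouble K H) →ₗ[K] QuantumDouble K H) :=
  toConv
    { toFun := fun b => TensorProduct.rid K _ ((toDual K _ b).lTensor _ (comul z))
      map_add' := fun a b => by simp [LinearMap.lTensor_add]
      map_smul' := fun k a => by simp [LinearMap.lTensor_smul] }

/-- The map `b ↦ ⟨b, z₍₁₎⟩ z₍₂₎`. -/
def leftAct : WithConv (RestrictedDual K (QuantumDouble K H) →ₗ[K] QuantumDouble K H) :=
  toConv
    { toFun := fun b => TensorProduct.lid K _ ((toDual K _ b).rTensor _ (comul z))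
      map_add' := fun a b => by simp [LinearMap.rTensor_add]
      map_smul' := fun k a => by simp [LinearMap.rTensor_smul] }

variable {z w}

theorem rightAct_apply {ι : Type*} (r : Coalgebra.Repr K z ι)
    (b : RestrictedDual K (QuantumDouble K H)) :
    rightAct z b = ∑ i ∈ r.index, b (r.right i) • r.left i := by
  change TensorProduct.rid K _ ((toDual K _ b).lTensor _ (comul z)) = _
  rw [← r.eq]
  simp

theorem leftAct_apply {ι : Type*} (r : Coalgebra.Repr K z ι)
    (b : RestrictedDual K (QuantumDouble K H)) :
    leftAct z b = ∑ i ∈ r.index, b (r.left i) • r.right i := by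
  change TensorProduct.lid K _ ((toDual K _ b).rTensor _ (comul z)) = _
  rw [← r.eq]
  simp

/-- Since Δ is multiplicative and ⟨b, zw⟩ = ⟨b₍₁₎, z⟩⟨b₍₂₎, w⟩, z ↦ `rightAct z` respects products,
with convolution on the right. Identities in z can then be checked on generators. -/
theorem rightAct_mul : rightAct (z * w) = rightAct z * rightAct w := by
  refine WithConv.ext (LinearMap.ext fun b => ?_)
  refine (rightAct_apply ((ℛ K z).mul (ℛ K w)) b).trans
    (Eq.trans ?_ ((ℛ K b).convMul_apply _ _).symm)
  simp only [rightAct_apply (ℛ K z), rightAct_apply (ℛ K w), Finset.sum_mul_sum]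
  conv_rhs => rw [Finset.sum_comm_cycle, Finset.sum_comm_cycle]
  simp only [Coalgebra.Repr.mul, Coalgebra.Repr.induced, Coalgebra.Repr.tmul, Finset.sum_product,
    smul_mul_smul_comm]
  refine Finset.sum_congr rfl fun i _ => Finset.sum_congr rfl fun j _ => ?_
  rw [← Finset.sum_smul, repr_apply]
  rfl

theorem leftAct_mul : leftAct (z * w) = leftAct z * leftAct w := by
  refine WithConv.ext (LinearMap.ext fun b => ?_)
  refine (leftAct_apply ((ℛ K z).mul (ℛ K w)) b).trans
    (Eq.trans ?_ ((ℛ K b).convMul_apply _ _).symm)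
  simp only [leftAct_apply (ℛ K z), leftAct_apply (ℛ K w), Finset.sum_mul_sum]
  conv_rhs => rw [Finset.sum_comm_cycle, Finset.sum_comm_cycle]
  simp only [Coalgebra.Repr.mul, Coalgebra.Repr.induced, Coalgebra.Repr.tmul, Finset.sum_product,
    smul_mul_smul_comm]
  refine Finset.sum_congr rfl fun i _ => Finset.sum_congr rfl fun j _ => ?_
  rw [← Finset.sum_smul, repr_apply]
  rfl

theorem rightAct_add : rightAct (z + w) = rightAct z + rightAct w := by
  refine WithConv.ext (LinearMap.ext fun b => ?_)
  simp [rightAct]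

theorem leftAct_add : leftAct (z + w) = leftAct z + leftAct w := by
  refine WithConv.ext (LinearMap.ext fun b => ?_)
  simp [leftAct]

theorem rightAct_algebraMap (k : K) :
    rightAct (algebraMap K (QuantumDouble K H) k) = algebraMap K _ k := by
  refine WithConv.ext (LinearMap.ext fun b => ?_)
  simp [rightAct, Algebra.TensorProduct.one_def, Algebra.algebraMap_eq_smul_one]

theorem leftAct_algebraMap (k : K) :
    leftAct (algebraMap K (QuantumDouble K H) k) = algebraMap K _ k := by
  refine WithConv.ext (LinearMap.ext fun b => ?_)
  simp [leftAct, Algebra.TensorProduct.one_def, Algebra.algebraMap_eq_smul_one]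

/-- The cross relation with the antipode factor cancelled: the pairing is moved to the other side by
its convolution inverse. It is symmetric enough to serve for both kinds of generators. -/
theorem cross_sum (f : RestrictedDual K H) (x : H) {ι κ : Type*} (r : Coalgebra.Repr K f ι)
    (s : Coalgebra.Repr K x κ) :
    ∑ a ∈ r.index, ∑ b ∈ s.index,
      r.right a (s.right b) • (inclDualₗ K H (r.left a) * incl K H (s.left b)) =
    ∑ a ∈ r.index, ∑ b ∈ s.index,
      r.left a (s.left b) • (incl K H (s.right b) * inclDualₗ K H (r.right a)) := by
  have h := congrArg (fun u : WithConv (RestrictedDual K H ⊗[K] H →ₗ[K] QuantumDouble K H) =>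
    u (f ⊗ₜ x)) (cross_algHom (AlgHom.id K _))
  simp only [conv_apply _ _ r s] at h
  simpa [Algebra.smul_def, ← Algebra.commutes] using h

/-- The map `j ∘ ι^o` intertwines the two actions. -/
theorem dualToDouble_mul_rightAct (z : QuantumDouble K H) :
    toConv (dualToDouble K H) * rightAct z = leftAct z * toConv (dualToDouble K H) := by
  induction z using QuantumDouble.induction with
  | algebraMap r => rw [rightAct_algebraMap, leftAct_algebraMap, Algebra.commutes]
  | incl x =>
    refine WithConv.ext (LinearMap.ext fun b => ?_)
    refine ((ℛ K b).convMul_apply _ _).trans (Eq.trans ?_ ((ℛ K b).convMul_apply _ _).symm)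
    simp only [rightAct_apply (reprIncl (ℛ K x)), leftAct_apply (reprIncl (ℛ K x))]
    -- For z from H the claim is the cross relation itself, for the functional b ∘ ι.
    have h := cross_sum (RestrictedDual.comap (incl K H) b) x (reprComap (ℛ K b)) (ℛ K x)
    simpa [Finset.mul_sum, Finset.sum_mul, reprIncl, reprComap, dualToDouble] using h
  | inclDual f =>
    refine WithConv.ext (LinearMap.ext fun b => ?_)
    refine ((ℛ K b).convMul_apply _ _).trans (Eq.trans ?_ ((ℛ K b).convMul_apply _ _).symm)
    simp only [rightAct_apply (reprInclDual (ℛ K f)), leftAct_apply (reprInclDual (ℛ K f))]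
    -- For z from H^o everything lies in the image of j, which reverses products. It is enough to
    -- compare elements of H^o at each x in H, and there the claim is `b` applied to the cross
    -- relation.
    have h : ∑ i ∈ (ℛ K b).index, ∑ j ∈ (ℛ K f).index,
        (ℛ K b).right i (inclDualₗ K H ((ℛ K f).right j)) •
          ((ℛ K f).left j * RestrictedDual.comap (incl K H) ((ℛ K b).left i)) =
        ∑ i ∈ (ℛ K b).index, ∑ j ∈ (ℛ K f).index,
        (ℛ K b).left i (inclDualₗ K H ((ℛ K f).left j)) •
          (RestrictedDual.comap (incl K H) ((ℛ K b).right i) * (ℛ K f).right j) := by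
      refine RestrictedDual.ext fun x => ?_
      have h := congrArg (RestrictedDual.toDual K _ b) (cross_sum f x (ℛ K f) (ℛ K x))
      simp only [map_sum, map_smul, smul_eq_mul, ← repr_apply (ℛ K b), LinearMap.sum_apply,
        LinearMap.smul_apply, RestrictedDual.mul_apply_repr _ _ (ℛ K x),
        RestrictedDual.comap_apply, Finset.mul_sum] at h ⊢
      conv_lhs at h => rw [Finset.sum_comm_cycle]
      conv_rhs at h => rw [Finset.sum_comm_cycle]
      refine Eq.trans ?_ (h.symm.trans ?_) <;>
        exact Finset.sum_congr rfl fun _ _ => Finset.sum_congr rfl fun _ _ =>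
          Finset.sum_congr rfl fun _ _ => by ring
    have h' := congrArg (inclDualₗ K H) h
    simpa [Finset.mul_sum, Finset.sum_mul, reprInclDual, dualToDouble, inclDualₗ_mul] using h'
  | mul a b ha hb => rw [rightAct_mul, leftAct_mul, ← mul_assoc, ha, mul_assoc, hb, mul_assoc]
  | add a b ha hb => rw [rightAct_add, leftAct_add, mul_add, add_mul, ha, hb]

end Comm

variable [InvertibleAntipode K H]

/-- Multiplicativity in the two variables reflects that j ∘ ι^o preserves coproducts and reverses
products. Commutation is the intertwining property, and invertibility uses the antipode of the
double, hence that of H being bijective. -/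
theorem isDualQuasitriangular_dualRMatrix :
    IsDualQuasitriangular K (RestrictedDual K (QuantumDouble K H)) (dualRMatrix K H) := by
  have mul_left : ∀ a b c : RestrictedDual K (QuantumDouble K H),
      dualRMatrix K H ((a * b) ⊗ₜ c) = ∑ i ∈ (ℛ K c).index,
        dualRMatrix K H (a ⊗ₜ (ℛ K c).left i) * dualRMatrix K H (b ⊗ₜ (ℛ K c).right i) :=
    fun a b c => RestrictedDual.mul_apply_repr a b (reprDualToDouble (ℛ K c))
  refine ⟨isUnit_of_mul_left (fun b => ?_) mul_left, mul_left, fun a b c => ?_, fun a b => ?_⟩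
  · rw [dualRMatrix_tmul, RestrictedDual.one_apply, dualToDouble, LinearMap.comp_apply,
      counit_inclDualₗ, restrictedDual_counit, RestrictedDual.comap_apply, map_one]
    rfl
  · simp only [dualRMatrix_tmul, dualToDouble_mul, repr_apply]
  · refine RestrictedDual.ext fun z => ?_
    -- Expanding `a` on the products in D(H) through its coproduct turns the intertwining relation
    -- at `b` into the commutation axiom evaluated at `z`.
    have h := congrArg (RestrictedDual.toDual K _ a) (congrArg
      (fun u : WithConv (RestrictedDual K (QuantumDouble K H) →ₗ[K] QuantumDouble K H) => u b)
        (dualToDouble_mul_rightAct z))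
    simp only [(ℛ K b).convMul_apply, rightAct_apply (ℛ K z), leftAct_apply (ℛ K z)] at h
    simp only [map_sum, map_smul, LinearMap.sum_apply,
        LinearMap.smul_apply, RestrictedDual.mul_apply_repr _ _ (ℛ K z), dualRMatrix_tmul]
    simp only [Finset.mul_sum, Finset.sum_mul, map_sum, map_smul, mul_smul_comm, smul_mul_assoc, 
      smul_eq_mul, ← repr_apply (ℛ K a)] at h ⊢
    conv_lhs at h => rw [Finset.sum_comm_cycle]
    conv_rhs at h => rw [Finset.sum_comm_cycle]
    refine Eq.trans ?_ (h.trans ?_) <;>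
      exact Finset.sum_congr rfl fun _ _ => Finset.sum_congr rfl fun _ _ =>
        Finset.sum_congr rfl fun _ _ => by ring

end QuantumDouble

end LongKnotInvariant

end

theorem mainTheorem3 (K : Type u) [Field K] (H : Type v) [Ring H] [HopfAlgebra K H]
    [InvertibleAntipode K H] :
    -- the restricted dual of the quantum double is dual quasitriangular
    IsDualQuasitriangular K (RestrictedDual K (QuantumDouble K H)) (dualRMatrix K H) ∧
    -- the Yang-Baxter relation in the convolution algebra
    leg12 (dualRMatrix K H) * leg13 (dualRMatrix K H) * leg23 (dualRMatrix K H) =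
      leg23 (dualRMatrix K H) * leg13 (dualRMatrix K H) * leg12 (dualRMatrix K H) ∧
    -- every finite-dimensional comodule gives a rigid R-matrix
    (∀ (V : Type u) [AddCommGroup V] [Module K V] [FiniteDimensional K V]
      (δ : RightComodule K (RestrictedDual K (QuantumDouble K H)) V)
      (F : FGModuleCat.{u} K) [CategoryTheory.ExactPairing (FGModuleCat.of K V) F],
      IsRigidRMatrix F (δ.rMatrixHom (dualRMatrix K H))) ∧
    -- the universal invariant
    ∃ Z : LongKnot → WithConv (RestrictedDual K (QuantumDouble K H) →ₗ[K] K),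
      ∀ (V : Type u) [AddCommGroup V] [Module K V] [FiniteDimensional K V]
        (δ : RightComodule K (RestrictedDual K (QuantumDouble K H)) V)
        (F : FGModuleCat.{u} K) [CategoryTheory.ExactPairing (FGModuleCat.of K V) F],
        ∃ h : IsRigidRMatrix F (δ.rMatrixHom (dualRMatrix K H)),
          ∀ (D : LongKnotDiagram) (v : V),
            (invariantJ h D).hom.hom v =
              TensorProduct.rid K V ((Z D.toLongKnot).ofConv.lTensor V (δ.coact v)) := by
  have hϱ := QuantumDouble.isDualQuasitriangular_dualRMatrix (K := K) (H := H)
  refine ⟨hϱ, hϱ.yangBaxter, fun V _ _ _ δ F _ =>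
    FDComodule.isRigidRMatrix_rMatrixHom (hϱ := hϱ) δ F, FDComodule.universalInvariant hϱ,
    fun V _ _ _ δ F _ => ⟨FDComodule.isRigidRMatrix_rMatrixHom (hϱ := hϱ) δ F, fun D v =>
      FDComodule.invariantJ_apply δ F _ D v⟩⟩
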